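/- An instance of Minimum Cost Flow with Outliers (MCFO) consists of a finite directed graph $G=(V,E)$, a set $F\subseteq V$ of facilities with supplies $u_i\in\mathbb{N}$ ($i\in F$), a set $C\subseteq V$ of demand points with demands $w(j)\in\mathbb{N}$ ($j\in C$), nonnegative rational costs $d(u,v)$ for $(u,v)\in E$, and an integer $m\ge 0$. A feasible solution consists of nonnegative real flow values $\phi(e)$ ($e\in E$), served amounts $0\le s(j)\le w(j)$ ($j\in C$), and received amounts $0\le r(i)\le u_i$ ($i\in F$) (with $s=0$ outside $C$ and $r=0$ outside $F$), such that for every $v\in V$ $$\sum_{u:(u,v)\in E}\phi(u,v)+s(v)=\sum_{u:(v,u)\in E}\phi(v,u)+r(v),$$ and $\sum_{j\in C}s(j)\ge\sum_{j\in C}w(j)-m$. Its cost is $\sum_{e\in E}d(e)\phi(e)$. Statement. There is an algorithm that, for every instance of MCFO with all numbers written in binary, runs in time polynomial in the bit size of the instance and, if the instance has a feasible solution, returns an integral feasible solution (all $\phi(e)$, $s(j)$, $r(i)$ are integers) whose cost is minimum among all feasible, also fractional, solutions; if there is no feasible solution, it reports this. Here an algorithm is a program for a random access machine, and its running time is measured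 by the logarithmic cost criterion. -/

import Mathlib

/-! ### A random access machine with logarithmic cost

Programs are structured (`while`) programs over finitely many integer arrays; an integer variable is
an array of which only the cell `0` is used.  Every arithmetic operation and every memory access is
charged the bit lengths of all the numbers (operands, results and addresses) that it handles. -/

namespace RAM

/-- The memory: `s a i` is the natural number in the cell `i` of the array with name `a`. -/
abbrev State := ℕ → ℕ → ℕ

/-- Arithmetic expressions.  `get a e` reads the cell of the array `a` whose address is the value
of `e`. -/
inductive Expr where
  | const (k : ℕ)
  | get (a : ℕ) (e : Expr)
  | add (e₁ e₂ : Expr)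
  | sub (e₁ e₂ : Expr)
  | mul (e₁ e₂ : Expr)
  | div (e₁ e₂ : Expr)

namespace Expr

/-- The value of an expression (with truncated subtraction and floor division). -/
def val (s : State) : Expr → ℕ
  | const k => k
  | get a e => s a (e.val s)
  | add e₁ e₂ => e₁.val s + e₂.val s
  | sub e₁ e₂ => e₁.val s - e₂.val s
  | mul e₁ e₂ => e₁.val s * e₂.val s
  | div e₁ e₂ => e₁.val s / e₂.val s

/-- The logarithmic cost of evaluating an expression: each node costs one plus the bit length of
its value. -/
def time (s : State) : Expr → ℕ
  | const k => 1 + Nat.size k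
  | get a e => e.time s + (1 + Nat.size ((get a e).val s))
  | add e₁ e₂ => e₁.time s + e₂.time s + (1 + Nat.size ((add e₁ e₂).val s))
  | sub e₁ e₂ => e₁.time s + e₂.time s + (1 + Nat.size ((sub e₁ e₂).val s))
  | mul e₁ e₂ => e₁.time s + e₂.time s + (1 + Nat.size ((mul e₁ e₂).val s))
  | div e₁ e₂ => e₁.time s + e₂.time s + (1 + Nat.size ((div e₁ e₂).val s))

end Expr

/-- Programs.  `assign a i e` stores the value of `e` in the cell of the array `a` whose address is
the value of `i`.  A test `e` counts as true if its value is nonzero. -/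
inductive Program where
  | skip
  | assign (a : ℕ) (i e : Expr)
  | seq (c₁ c₂ : Program)
  | ite (e : Expr) (c₁ c₂ : Program)
  | loop (e : Expr) (c : Program)

/-- The memory after storing `x` in the cell `i` of the array `a`. -/
def State.set (s : State) (a i x : ℕ) : State :=
  Function.update s a (Function.update (s a) i x)

/-- `Exec c s t s'`: the program `c`, started with memory `s`, halts with memory `s'` after running
for time exactly `t`. -/
inductive Exec : Program → State → ℕ → State → Prop where
  | skip (s : State) : Exec .skip s 1 s
  | assign (s : State) (a : ℕ) (i e : Expr) :
      Exec (.assign a i e) s (i.time s + e.time s + 1) (s.set a (i.val s) (e.val s))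
  | seq {c₁ c₂ : Program} {s s₁ s₂ : State} {t₁ t₂ : ℕ} :
      Exec c₁ s t₁ s₁ → Exec c₂ s₁ t₂ s₂ → Exec (.seq c₁ c₂) s (t₁ + t₂ + 1) s₂
  | ite_true {e : Expr} {c₁ c₂ : Program} {s s' : State} {t : ℕ} :
      e.val s ≠ 0 → Exec c₁ s t s' → Exec (.ite e c₁ c₂) s (e.time s + t + 1) s'
  | ite_false {e : Expr} {c₁ c₂ : Program} {s s' : State} {t : ℕ} :
      e.val s = 0 → Exec c₂ s t s' → Exec (.ite e c₁ c₂) s (e.time s + t + 1) s'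
  | loop_done {e : Expr} {c : Program} {s : State} :
      e.val s = 0 → Exec (.loop e c) s (e.time s + 1) s
  | loop_step {e : Expr} {c : Program} {s s₁ s₂ : State} {t₁ t₂ : ℕ} :
      e.val s ≠ 0 → Exec c s t₁ s₁ → Exec (.loop e c) s₁ t₂ s₂ →
        Exec (.loop e c) s (e.time s + t₁ + t₂ + 1) s₂

/-- The initial memory: the array `0` holds the length of the input, followed by the input; every
other cell is `0`. -/
def initial (input : List ℕ) : State := fun a i =>
  if a = 0 then (input.length :: input).getD i 0 else 0

/-- The output: the array `1` holds the length of the output, followed by the output. -/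
def output (s : State) : List ℕ :=
  List.ofFn fun i : Fin (s 1 0) => s 1 (i + 1)

/-- The size, in bits, of a list of natural numbers written in binary. -/
def bitSize (l : List ℕ) : ℕ := (l.map fun x => Nat.size x + 1).sum

/-- A search problem, with instances `a : α` and answers `b : β a`, is solvable in polynomial time
if one program halts on every instance within a number of steps that is polynomial in the
bit size of the instance, and outputs a correct answer. -/
def SolvableInPolyTime {α : Type} {β : α → Type} (encodeInput : α → List ℕ)
    (encodeAnswer : (a : α) → β a → List ℕ) (Correct : (a : α) → β a → Prop) : Prop :=
  ∃ (c : Program) (p : Polynomial ℕ), ∀ a : α, ∃ (t : ℕ) (s : State),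
    Exec c (initial (encodeInput a)) t s ∧ t ≤ p.eval (bitSize (encodeInput a)) ∧
      ∃ b : β a, Correct a b ∧ output s = encodeAnswer a b

end RAM

/-! ### Minimum cost flow with outliers -/

/-- An instance of minimum cost flow with outliers, on the vertex set `Fin n`.  Only the supplies
of facilities, the demands of demand points, and the costs of edges are relevant. -/
structure MCFOInstance where
  n : ℕ
  /-- the directed edges -/
  E : Finset (Fin n × Fin n)
  /-- the facilities -/
  F : Finset (Fin n)
  /-- the demand points -/
  C : Finset (Fin n)
  supply : Fin n → ℕ
  demand : Fin n → ℕ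
  /-- the cost of an edge per unit of flow -/
  cost : Fin n × Fin n → ℚ≥0
  /-- the amount of demand that need not be routed -/
  m : ℕ

/-- A candidate solution on the vertex set `Fin n`, with amounts in `R`: `flow (u, v)` is sent along
the edge `(u, v)`, `served v` of the demand of `v` is sent out, and `received v` is absorbed by the
facility `v`. -/
structure MCFOFlow (n : ℕ) (R : Type) where
  flow : Fin n × Fin n → R
  served : Fin n → R
  received : Fin n → R

namespace MCFOFlow

/-- An integral candidate solution, viewed as a real one. -/
def toReal {n : ℕ} (S : MCFOFlow n ℕ) : MCFOFlow n ℝ where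
  flow e := (S.flow e : ℝ)
  served v := (S.served v : ℝ)
  received v := (S.received v : ℝ)

end MCFOFlow

namespace MCFOInstance

/-- Feasibility of a (possibly fractional) candidate solution. -/
structure IsFeasible (I : MCFOInstance) (S : MCFOFlow I.n ℝ) : Prop where
  flow_nonneg : ∀ e, 0 ≤ S.flow e
  flow_off : ∀ e, e ∉ I.E → S.flow e = 0
  served_nonneg : ∀ v, 0 ≤ S.served v
  served_le : ∀ v ∈ I.C, S.served v ≤ I.demand v
  served_off : ∀ v, v ∉ I.C → S.served v = 0
  received_nonneg : ∀ v, 0 ≤ S.received v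
  received_le : ∀ v ∈ I.F, S.received v ≤ I.supply v
  received_off : ∀ v, v ∉ I.F → S.received v = 0
  conservation : ∀ v, ∑ u, S.flow (u, v) + S.served v = ∑ u, S.flow (v, u) + S.received v
  outliers : ∑ v ∈ I.C, (I.demand v : ℝ) - I.m ≤ ∑ v ∈ I.C, S.served v

/-- The total cost of a candidate solution. -/
noncomputable def totalCost (I : MCFOInstance) (S : MCFOFlow I.n ℝ) : ℝ :=
  ∑ e ∈ I.E, (I.cost e : ℝ) * S.flow e

/-- `S` is a feasible solution of minimum cost among all, also fractional, feasible solutions. -/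
def IsOptimal (I : MCFOInstance) (S : MCFOFlow I.n ℝ) : Prop :=
  I.IsFeasible S ∧ ∀ T, I.IsFeasible T → I.totalCost S ≤ I.totalCost T

/-- The instance as a list of natural numbers: `n` and `m`, then for each vertex whether it is a
demand point and its demand, then for each vertex whether it is a facility and its supply, and
then for each pair of vertices whether it is an edge and the numerator and denominator of its
cost. -/
def encode (I : MCFOInstance) : List ℕ :=
  [I.n, I.m] ++
  (List.finRange I.n).flatMap (fun v => if v ∈ I.C then [1, I.demand v] else [0, 0]) ++
  (List.finRange I.n).flatMap (fun v => if v ∈ I.F then [1, I.supply v] else [0, 0]) ++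
  (List.finRange I.n).flatMap (fun u => (List.finRange I.n).flatMap fun v =>
    if (u, v) ∈ I.E then [1, (I.cost (u, v)).num, (I.cost (u, v)).den] else [0, 0, 0])

/-- The answer as a list of natural numbers: `0` if it is "infeasible", and otherwise `1`, followed
by all the amounts of the integral solution. -/
def encodeAnswer (I : MCFOInstance) : Option (MCFOFlow I.n ℕ) → List ℕ
  | none => [0]
  | some S =>
    [1] ++
    (List.finRange I.n).flatMap (fun u => (List.finRange I.n).map fun v => S.flow (u, v)) ++
    (List.finRange I.n).map S.served ++
    (List.finRange I.n).map S.received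

/-- The correct answers: "infeasible" if there is no (fractional) feasible solution, and otherwise
an integral optimal solution. -/
def IsCorrectAnswer (I : MCFOInstance) : Option (MCFOFlow I.n ℕ) → Prop
  | none => ∀ T, ¬ I.IsFeasible T
  | some S => I.IsOptimal S.toReal

end MCFOInstance

/-! The problem is reduced to an uncapacitated transshipment problem on a complete digraph with `N =
3 * n + 2` nodes, which is solved by capacity scaling with shortest augmenting paths.

In the reduction every vertex gets a copy that supplies its demand and a copy that demands its
supply. A further node absorbs `m` outliers, and another sends out the total supply plus `m` minus
the total demand. If this difference is negative, nothing is feasible. Costs are multiplied by a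
common denominator, so they are integers at most `H` on arcs; every pair that is not an arc gets the
cost `N * H + 1`. Hence the digraph is complete, a flow always exists, and infeasibility shows in
the optimum: by `Opt.not_feasible`, an optimal flow that uses an expensive pair leaves a gap in its
potentials, and the cut at the gap excludes any flow on arcs alone. If no expensive pair is used,
linear programming duality (`Opt.sum_le`) gives optimality among all real flows, while the flow
itself is integral.

The scaling algorithm keeps integral potentials with complementary slackness (`Opt`). With the scale
`d = 2 ^ e`, all flow values are multiples of `d`, so `d` units can be cancelled on any pair that
carries flow. As long as some node has `d` units of supply left and some node has `d` units of
demand left, `d` units are sent along a path of reduced cost zero, found by a search in the manner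
of Dijkstra; otherwise `d` is halved. After a halving less than `2 * N * d` remains to be sent, so
each scale has fewer than `2 * N` augmentations (`isScaled_halve`, `wp_solveStep`).

Running time is separated from correctness. `wp` asserts termination in a correct state with at most
`R` iterations in each execution of a loop. For programs that never write the input and whose stored
products have an input cell as a factor (`tame`), an assignment increases bit lengths only
additively; so `exec_of_wp` turns an iteration bound into a polynomial bound for the logarithmic
cost. -/

/-! ### A program logic for the random access machine -/

namespace RAM

namespace Expr

/-- The number of nodes of an expression, constants being counted with their bit length. -/
def weight : Expr → ℕ
  | const k => Nat.size k + 1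
  | get _ e => e.weight + 1
  | add e₁ e₂ => e₁.weight + e₂.weight + 1
  | sub e₁ e₂ => e₁.weight + e₂.weight + 1
  | mul e₁ e₂ => e₁.weight + e₂.weight + 1
  | div e₁ e₂ => e₁.weight + e₂.weight + 1

/-- Outside of addresses, the expression multiplies only by cells of the input. -/
def tame : Expr → Bool
  | const _ => true
  | get _ _ => true
  | add e₁ e₂ => e₁.tame && e₂.tame
  | sub e₁ e₂ => e₁.tame && e₂.tame
  | mul (get 0 _) e₂ => e₂.tame
  | mul _ _ => false
  | div e₁ e₂ => e₁.tame && e₂.tame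

end Expr

theorem size_add_le_max (a b : ℕ) : Nat.size (a + b) ≤ max (Nat.size a) (Nat.size b) + 1 := by
  rw [Nat.size_le, pow_succ]
  have ha := (Nat.size_le (m := a)).1 (le_max_left (Nat.size a) (Nat.size b))
  have hb := (Nat.size_le (m := b)).1 (le_max_right (Nat.size a) (Nat.size b))
  omega

theorem size_mul_le (a b : ℕ) : Nat.size (a * b) ≤ Nat.size a + Nat.size b := by
  rw [Nat.size_le, pow_add]
  exact Nat.mul_lt_mul'' (Nat.lt_size_self a) (Nat.lt_size_self b)

/-- Every cell of the memory has bit length at most `L`. -/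
def State.SizeLE (s : State) (L : ℕ) : Prop := ∀ a i, Nat.size (s a i) ≤ L

/-- Every cell of the input array has bit length at most `X`. -/
def State.InputLE (s : State) (X : ℕ) : Prop := ∀ i, Nat.size (s 0 i) ≤ X

theorem Expr.size_val_le {s : State} {L : ℕ} (hL : 1 ≤ L) (hs : s.SizeLE L) (e : Expr) :
    Nat.size (e.val s) ≤ e.weight * L := by
  induction e with
  | const k => simp only [val, weight]; nlinarith
  | get a e ih => simp only [val, weight]; have := hs a (e.val s); nlinarith
  | add e₁ e₂ h₁ h₂ =>
    simp only [val, weight]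
    have := size_add_le_max (e₁.val s) (e₂.val s)
    have : max (e₁.val s).size (e₂.val s).size ≤ e₁.weight * L + e₂.weight * L :=
      max_le (by omega) (by omega)
    rw [add_mul, add_mul]; omega
  | sub e₁ e₂ h₁ h₂ =>
    simp only [val, weight]
    have := Nat.size_le_size (Nat.sub_le (e₁.val s) (e₂.val s))
    rw [add_mul, add_mul]; omega
  | mul e₁ e₂ h₁ h₂ =>
    simp only [val, weight]
    have := size_mul_le (e₁.val s) (e₂.val s)
    rw [add_mul, add_mul]; omega
  | div e₁ e₂ h₁ h₂ =>
    simp only [val, weight]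
    have := Nat.size_le_size (Nat.div_le_self (e₁.val s) (e₂.val s))
    rw [add_mul, add_mul]; omega

theorem Expr.time_le {s : State} {L : ℕ} (hL : 1 ≤ L) (hs : s.SizeLE L) (e : Expr) {W : ℕ}
    (hW : e.weight * L ≤ W) : e.time s ≤ e.weight * (W + 1) := by
  have hv := e.size_val_le hL hs
  induction e with
  | const k =>
    simp only [time, weight, val] at *
    nlinarith
  | get a e ih =>
    simp only [time, weight] at *
    have := ih (by nlinarith) (e.size_val_le hL hs)
    nlinarith
  | add e₁ e₂ h₁ h₂ | sub e₁ e₂ h₁ h₂ | mul e₁ e₂ h₁ h₂ | div e₁ e₂ h₁ h₂ =>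
    simp only [time, weight] at *
    have := h₁ (by nlinarith) (e₁.size_val_le hL hs)
    have := h₂ (by nlinarith) (e₂.size_val_le hL hs)
    nlinarith

/-- `L` enters with the coefficient one: a sum is only one bit longer than its longer summand, and a
product has a factor with at most `X` bits. So the growth caused by a stored value does not depend
on `L`. With unrestricted products, repeated squaring in a loop would double the bit length in each
iteration. -/
theorem Expr.size_val_le_of_tame {s : State} {L X : ℕ} (hX : 1 ≤ X) (hs : s.SizeLE L)
    (h0 : s.InputLE X) (e : Expr) (he : e.tame) :
    Nat.size (e.val s) ≤ L + e.weight * X := by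
  induction e with
  | const k => simp only [val, weight]; nlinarith
  | get a e ih => simp only [val, weight]; have := hs a (e.val s); nlinarith
  | add e₁ e₂ h₁ h₂ =>
    simp only [tame, Bool.and_eq_true] at he
    have h₁ := h₁ he.1
    have h₂ := h₂ he.2
    simp only [val, weight]
    have := size_add_le_max (e₁.val s) (e₂.val s)
    have : max (e₁.val s).size (e₂.val s).size ≤ L + e₁.weight * X + e₂.weight * X :=
      max_le (by omega) (by omega)
    rw [add_mul, add_mul]; omega
  | sub e₁ e₂ h₁ h₂ =>
    simp only [tame, Bool.and_eq_true] at he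
    have h₁ := h₁ he.1
    simp only [val, weight]
    have := Nat.size_le_size (Nat.sub_le (e₁.val s) (e₂.val s))
    rw [add_mul, add_mul]; omega
  | mul e₁ e₂ h₁ h₂ =>
    simp only [val, weight]
    have := size_mul_le (e₁.val s) (e₂.val s)
    unfold tame at he
    split at he <;> try simp_all
    rename_i e' _ _
    simp only [val] at *
    have := h0 (e'.val s)
    rw [add_mul, add_mul]; omega
  | div e₁ e₂ h₁ h₂ =>
    simp only [tame, Bool.and_eq_true] at he
    have h₁ := h₁ he.1
    simp only [val, weight]
    have := Nat.size_le_size (Nat.div_le_self (e₁.val s) (e₂.val s))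
    rw [add_mul, add_mul]; omega

/-! ### Polynomial bounds for bit lengths and running time, and weakest preconditions. -/

namespace Program

/-- The program never writes the input array and all values that it stores are tame. -/
def tame : Program → Bool
  | skip => true
  | assign a _ e => (a != 0) && e.tame
  | seq c₁ c₂ => c₁.tame && c₂.tame
  | ite _ c₁ c₂ => c₁.tame && c₂.tame
  | loop _ c => c.tame

/-- `c.writes a`: some assignment of the program stores into the array `a`. -/
def writes (a : ℕ) : Program → Bool
  | skip => false
  | assign b _ _ => a == b
  | seq c₁ c₂ => c₁.writes a || c₂.writes a
  | ite _ c₁ c₂ => c₁.writes a || c₂.writes a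
  | loop _ c => c.writes a

open Polynomial in
/-- A bound for the growth of the bit lengths of all cells, if all loops run at most `X` times. -/
noncomputable def growth : Program → Polynomial ℕ
  | skip => 0
  | assign _ _ e => C e.weight * X
  | seq c₁ c₂ => c₁.growth + c₂.growth
  | ite _ c₁ c₂ => c₁.growth + c₂.growth
  | loop _ c => X * c.growth

open Polynomial in
/-- A bound for the time for evaluating an expression in a memory with bit lengths at most `l`. -/
noncomputable def exprTime (e : Expr) (l : Polynomial ℕ) : Polynomial ℕ :=
  C e.weight * (C e.weight * l + 1)

open Polynomial in
/-- A bound for the running time, if all loops run at most `X` times and the memory initially has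
bit lengths at most `l`. -/
noncomputable def timeBound : Program → Polynomial ℕ → Polynomial ℕ
  | skip, _ => 1
  | assign _ i e, l => exprTime i l + exprTime e l + 1
  | seq c₁ c₂, l => c₁.timeBound l + c₂.timeBound (l + c₁.growth) + 1
  | ite e c₁ c₂, l => exprTime e l + c₁.timeBound l + c₂.timeBound l + 1
  | loop e c, l => (X + 1) * (exprTime e (l + X * c.growth) + c.timeBound (l + X * c.growth) + 1)

end Program

/-- `wpLoop e F k Q s`: the loop with test `e` and with a body whose weakest preconditions are given
by `F` makes at most `k` iterations from `s`, and then `Q` holds. -/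
def wpLoop (e : Expr) (F : (State → Prop) → State → Prop) : ℕ → (State → Prop) → State → Prop
  | 0, Q, s => e.val s = 0 ∧ Q s
  | k + 1, Q, s => (e.val s = 0 ∧ Q s) ∨ (e.val s ≠ 0 ∧ F (wpLoop e F k Q) s)

/-- `wp R c Q s`: started in `s`, the program `c` halts in a state with `Q`, and no execution of a
loop makes more than `R` iterations. -/
def wp (R : ℕ) : Program → (State → Prop) → State → Prop
  | .skip, Q, s => Q s
  | .assign a i e, Q, s => Q (s.set a (i.val s) (e.val s))
  | .seq c₁ c₂, Q, s => wp R c₁ (wp R c₂ Q) s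
  | .ite e c₁ c₂, Q, s => (e.val s ≠ 0 → wp R c₁ Q s) ∧ (e.val s = 0 → wp R c₂ Q s)
  | .loop e c, Q, s => wpLoop e (wp R c) R Q s

theorem State.set_of_ne (s : State) {a b : ℕ} (i x : ℕ) (h : b ≠ a) : s.set a i x b = s b :=
  Function.update_of_ne h _ _

theorem State.set_same (s : State) (a i x : ℕ) :
    s.set a i x a = Function.update (s a) i x :=
  Function.update_self _ _ _

theorem State.set_apply (s : State) (a i x b j : ℕ) :
    s.set a i x b j = if b = a ∧ j = i then x else s b j := by
  by_cases hb : b = a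
  · subst hb
    rw [set_same, Function.update_apply]; simp
  · rw [set_of_ne _ _ _ hb]; simp [hb]

theorem exprTime_eval {s : State} {L X : ℕ} {l : Polynomial ℕ} (hL : 1 ≤ L) (hs : s.SizeLE L)
    (hl : L ≤ l.eval X) (e : Expr) : e.time s ≤ (Program.exprTime e l).eval X := by
  simp only [Program.exprTime, Polynomial.eval_mul, Polynomial.eval_add, Polynomial.eval_C,
    Polynomial.eval_one]
  exact e.time_le hL hs (Nat.mul_le_mul_left _ hl)

/-- Soundness of `wp`: it yields an execution whose time is polynomial in the bound for the numbers
of iterations and the bit length of the input. -/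
theorem exec_of_wp {X : ℕ} (hX : 1 ≤ X) (c : Program) (hc : c.tame) :
    ∀ (Q : State → Prop) (s : State) (L : ℕ) (l : Polynomial ℕ), 1 ≤ L → L ≤ l.eval X →
      s.SizeLE L → s.InputLE X → wp X c Q s →
      ∃ t s', Exec c s t s' ∧ t ≤ (c.timeBound l).eval X ∧ s'.SizeLE (L + c.growth.eval X) ∧
        s'.InputLE X ∧ Q s' := by
  induction c with
  | skip =>
    intro Q s L l hL hl hs h0 h
    exact ⟨1, s, .skip s, by simp [Program.timeBound], by simpa [Program.growth] using hs, h0, h⟩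
  | assign a i e =>
    intro Q s L l hL hl hs h0 h
    simp only [Program.tame, Bool.and_eq_true, bne_iff_ne] at hc
    refine ⟨_, _, .assign s a i e, ?_, ?_, ?_, h⟩
    · simp only [Program.timeBound, Polynomial.eval_add, Polynomial.eval_one]
      have := exprTime_eval hL hs hl i
      have := exprTime_eval hL hs hl e
      omega
    · intro b j
      have := e.size_val_le_of_tame hX hs h0 hc.2
      simp only [Program.growth, Polynomial.eval_mul, Polynomial.eval_C, Polynomial.eval_X]
      rw [State.set_apply]
      split_ifs
      · exact this
      · exact (hs b j).trans (Nat.le_add_right _ _)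
    · intro j
      rw [State.set_of_ne _ _ _ (Ne.symm hc.1)]
      exact h0 j
  | seq c₁ c₂ h₁ h₂ =>
    intro Q s L l hL hl hs h0 h
    simp only [Program.tame, Bool.and_eq_true] at hc
    obtain ⟨t₁, s₁, e₁, ht₁, hs₁, h0₁, q₁⟩ := h₁ hc.1 _ s L l hL hl hs h0 h
    obtain ⟨t₂, s₂, e₂, ht₂, hs₂, h0₂, q₂⟩ := h₂ hc.2 _ s₁ _ (l + c₁.growth) (by omega)
      (by rw [Polynomial.eval_add]; omega) hs₁ h0₁ q₁
    refine ⟨_, _, .seq e₁ e₂, ?_, ?_, h0₂, q₂⟩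
    · simp only [Program.timeBound, Polynomial.eval_add, Polynomial.eval_one]; omega
    · simpa only [Program.growth, Polynomial.eval_add, add_assoc] using hs₂
  | ite e c₁ c₂ h₁ h₂ =>
    intro Q s L l hL hl hs h0 h
    simp only [Program.tame, Bool.and_eq_true] at hc
    have he := exprTime_eval hL hs hl e
    by_cases hv : e.val s = 0
    · obtain ⟨t₂, s₂, e₂, ht₂, hs₂, h0₂, q₂⟩ := h₂ hc.2 _ s L l hL hl hs h0 (h.2 hv)
      refine ⟨_, _, .ite_false hv e₂, ?_, ?_, h0₂, q₂⟩
      · simp only [Program.timeBound, Polynomial.eval_add, Polynomial.eval_one]; omega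
      · intro b j
        have := hs₂ b j
        simp only [Program.growth, Polynomial.eval_add]; omega
    · obtain ⟨t₂, s₂, e₂, ht₂, hs₂, h0₂, q₂⟩ := h₁ hc.1 _ s L l hL hl hs h0 (h.1 hv)
      refine ⟨_, _, .ite_true hv e₂, ?_, ?_, h0₂, q₂⟩
      · simp only [Program.timeBound, Polynomial.eval_add, Polynomial.eval_one]; omega
      · intro b j
        have := hs₂ b j
        simp only [Program.growth, Polynomial.eval_add]; omega
  | loop e c ih =>
    intro Q s L l hL hl hs h0 h
    simp only [Program.tame] at hc
    set l' := l + Polynomial.X * c.growth with hl'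
    set g := c.growth.eval X with hg
    have hl'X : l'.eval X = l.eval X + X * g := by
      simp [hl', hg]
    set B := (Program.exprTime e l').eval X + (c.timeBound l').eval X + 1 with hB
    -- Here `k` is the number of iterations still allowed. The current size bound `L'` may grow by
    -- `g` in each of them and still stays below the bound for the whole loop, so one time bound `B`
    -- serves every iteration.
    suffices H : ∀ k ≤ X, ∀ s L', L' + k * g ≤ L + X * g → 1 ≤ L' → s.SizeLE L' → s.InputLE X →
        wpLoop e (wp X c) k Q s → ∃ t s', Exec (.loop e c) s t s' ∧ t ≤ (k + 1) * B ∧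
          s'.SizeLE (L' + k * g) ∧ s'.InputLE X ∧ Q s' by
      obtain ⟨t, s', h₁, h₂, h₃, h₄⟩ := H X le_rfl s L le_rfl hL hs h0 h
      refine ⟨t, s', h₁, ?_, ?_, h₄⟩
      · simpa [Program.timeBound] using h₂
      · simpa [Program.growth] using h₃
    intro k
    induction k with
    | zero =>
      intro _ s L' hL' h1 hs h0 h
      refine ⟨_, s, .loop_done h.1, ?_, by simpa using hs, h0, h.2⟩
      have := exprTime_eval (X := X) (l := l') h1 hs (by rw [hl'X]; omega) e
      omega
    | succ k ihk =>
      intro hk s L' hL' h1 hs h0 h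
      have het := exprTime_eval (X := X) (l := l') h1 hs (by rw [hl'X]; omega) e
      rcases h with h | h
      · refine ⟨_, s, .loop_done h.1, ?_, fun b j => (hs b j).trans (Nat.le_add_right _ _), h0, h.2⟩
        nlinarith
      · have : (k + 1) * g = k * g + g := by ring
        obtain ⟨t₁, s₁, e₁, ht₁, hs₁, h0₁, q₁⟩ := ih hc _ s L' l' h1 (by rw [hl'X]; omega) hs h0 h.2
        obtain ⟨t₂, s₂, e₂, ht₂, hs₂, h0₂, q₂⟩ := ihk (by omega) s₁ (L' + g) (by omega) (by omega)
          hs₁ h0₁ q₁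
        refine ⟨_, _, .loop_step h.1 e₁ e₂, ?_, ?_, h0₂, q₂⟩
        · have : (k + 1 + 1) * B = (k + 1) * B + B := by ring
          omega
        · intro b j
          have := hs₂ b j
          omega

/-! ### Monotonicity, framing and loop rules. -/

theorem wpLoop_mono {e : Expr} {F : (State → Prop) → State → Prop}
    (hF : ∀ Q Q' s, (∀ s', Q s' → Q' s') → F Q s → F Q' s) {k : ℕ} :
    ∀ {Q Q' : State → Prop} {s : State}, (∀ s', Q s' → Q' s') → wpLoop e F k Q s →
      wpLoop e F k Q' s := by
  induction k with
  | zero => exact fun h hs => ⟨hs.1, h _ hs.2⟩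
  | succ k ih =>
    intro Q Q' s h hs
    rcases hs with hs | hs
    · exact .inl ⟨hs.1, h _ hs.2⟩
    · exact .inr ⟨hs.1, hF _ _ _ (fun s' h' => ih h h') hs.2⟩

theorem wp_mono {R : ℕ} {c : Program} : ∀ {Q Q' : State → Prop} {s : State},
    wp R c Q s → (∀ s', Q s' → Q' s') → wp R c Q' s := by
  induction c with
  | skip => exact fun hs h => h _ hs
  | assign a i e => exact fun hs h => h _ hs
  | seq c₁ c₂ h₁ h₂ => exact fun hs h => h₁ hs fun s' h' => h₂ h' h
  | ite e c₁ c₂ h₁ h₂ =>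
    exact fun hs h => ⟨fun hv => h₁ (hs.1 hv) h, fun hv => h₂ (hs.2 hv) h⟩
  | loop e c ih =>
    intro Q Q' s hs h
    exact wpLoop_mono (F := wp R c) (fun Q Q' s h h' => ih h' h) h hs

/-- Arrays to which the program does not write keep their contents. -/
theorem wp_frame {R : ℕ} {c : Program} : ∀ {Q : State → Prop} {s : State},
    wp R c Q s → wp R c (fun s' => Q s' ∧ ∀ a, c.writes a = false → s' a = s a) s := by
  induction c with
  | skip => exact fun h => ⟨h, fun _ _ => rfl⟩
  | assign a i e =>
    refine fun h => ⟨h, fun b hb => ?_⟩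
    simp only [Program.writes, beq_eq_false_iff_ne] at hb
    exact State.set_of_ne _ _ _ hb
  | seq c₁ c₂ h₁ h₂ =>
    intro Q s h
    refine wp_mono (c := c₁) (h₁ h) ?_
    rintro s₁ ⟨h₁', f₁⟩
    refine wp_mono (h₂ h₁') ?_
    rintro s₂ ⟨h₂', f₂⟩
    refine ⟨h₂', fun a ha => ?_⟩
    simp only [Program.writes, Bool.or_eq_false_iff] at ha
    rw [f₂ a ha.2, f₁ a ha.1]
  | ite e c₁ c₂ h₁ h₂ =>
    intro Q s h
    refine ⟨fun hv => wp_mono (h₁ (h.1 hv)) ?_, fun hv => wp_mono (h₂ (h.2 hv)) ?_⟩ <;>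
    · rintro s' ⟨h', f⟩
      refine ⟨h', fun a ha => ?_⟩
      simp only [Program.writes, Bool.or_eq_false_iff] at ha
      first | exact f a ha.1 | exact f a ha.2
  | loop e c ih =>
    intro Q s h
    simp only [wp, Program.writes] at h ⊢
    suffices H : ∀ k s₁, (∀ a, c.writes a = false → s₁ a = s a) → wpLoop e (wp R c) k Q s₁ →
        wpLoop e (wp R c) k (fun s' => Q s' ∧ ∀ a, c.writes a = false → s' a = s a) s₁ from
      H R s (fun _ _ => rfl) h
    intro k
    induction k with
    | zero => exact fun s₁ h₁ h => ⟨h.1, h.2, h₁⟩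
    | succ k ihk =>
      intro s₁ h₁ h
      rcases h with h | h
      · exact .inl ⟨h.1, h.2, h₁⟩
      · refine .inr ⟨h.1, wp_mono (ih h.2) ?_⟩
        rintro s₂ ⟨h₂, f₂⟩
        exact ihk s₂ (fun a ha => by rw [f₂ a ha, h₁ a ha]) h₂

/-- The rule for loops, with an invariant and a variant. -/
theorem wp_loop {R k : ℕ} {e : Expr} {c : Program} {Q : State → Prop} {s : State}
    (Inv : ℕ → State → Prop) (hk : k < R) (h0 : Inv k s)
    (h : ∀ k s₁, (∀ a, c.writes a = false → s₁ a = s a) → Inv k s₁ →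
      (e.val s₁ = 0 → Q s₁) ∧ (e.val s₁ ≠ 0 → wp R c (fun s' => ∃ k' < k, Inv k' s') s₁)) :
    wp R (.loop e c) Q s := by
  suffices H : ∀ r k s₁, k < r → (∀ a, c.writes a = false → s₁ a = s a) → Inv k s₁ →
      wpLoop e (wp R c) r Q s₁ from H R k s hk (fun _ _ => rfl) h0
  have hstep : ∀ k s₁, (∀ a, c.writes a = false → s₁ a = s a) → Inv k s₁ → e.val s₁ ≠ 0 →
      wp R c (fun s' => (∃ k' < k, Inv k' s') ∧ ∀ a, c.writes a = false → s' a = s a) s₁ := by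
    intro k s₁ hf hI he
    refine wp_mono (wp_frame ((h k s₁ hf hI).2 he)) ?_
    rintro s₂ ⟨h₂, f₂⟩
    exact ⟨h₂, fun a ha => by rw [f₂ a ha, hf a ha]⟩
  intro r
  induction r with
  | zero =>
    exact fun k s₁ hkr => absurd hkr (Nat.not_lt_zero k)
  | succ r ih =>
    intro k s₁ hkr hf hI
    by_cases he : e.val s₁ = 0
    · exact .inl ⟨he, (h _ _ hf hI).1 he⟩
    · refine .inr ⟨he, wp_mono (hstep k s₁ hf hI he) ?_⟩
      rintro s₂ ⟨⟨k', hk', hI'⟩, hf'⟩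
      exact ih k' s₂ (by omega) hf' hI'

/-- `for i < v do c`, where `i` and `v` are variables. -/
def Program.forTo (i v : ℕ) (c : Program) : Program :=
  .seq (.assign i (.const 0) (.const 0))
    (.loop (.sub (.get v (.const 0)) (.get i (.const 0)))
      (.seq c (.assign i (.const 0) (.add (.get i (.const 0)) (.const 1)))))

/-- The rule for `for` loops.  The invariant must not depend on the loop variable. -/
theorem wp_forTo {R m i v : ℕ} {c : Program} {Q : State → Prop} {s : State} (hm : s v 0 = m)
    (hmR : m < R) (hv : (Program.forTo i v c).writes v = false) (hi : c.writes i = false)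
    (Inv : ℕ → State → Prop)
    (hInv : ∀ j s₁ s₂, (∀ a, a ≠ i → s₂ a = s₁ a) → Inv j s₁ → Inv j s₂)
    (h0 : Inv 0 s)
    (hstep : ∀ j < m, ∀ s₁, (∀ a, (Program.forTo i v c).writes a = false → s₁ a = s a) →
      s₁ i 0 = j → Inv j s₁ → wp R c (Inv (j + 1)) s₁)
    (hend : ∀ s₁, (∀ a, (Program.forTo i v c).writes a = false → s₁ a = s a) →
      Inv m s₁ → Q s₁) : wp R (Program.forTo i v c) Q s := by
  -- An array is untouched by the whole loop iff it is neither the counter nor written by the body.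
  have hw : ∀ a, (Program.forTo i v c).writes a = false ↔ a ≠ i ∧ c.writes a = false := by
    intro a
    simp only [Program.forTo, Program.writes, Bool.or_eq_false_iff, beq_eq_false_iff_ne]
    tauto
  set s₀ := s.set i 0 0 with hs₀
  have hs₀' : ∀ a, a ≠ i → s₀ a = s a := fun a ha => State.set_of_ne _ _ _ ha
  have hvi := ((hw v).1 hv).1
  refine wp_loop (fun k s' => ∃ j, j + k = m ∧ s' i 0 = j ∧ Inv j s') hmR
    ⟨0, by omega, by simp [State.set_apply, Expr.val], hInv 0 s s₀ hs₀' h0⟩ ?_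
  rintro k s₁ hf ⟨j, hjk, hij, hI⟩
  have hf' : ∀ a, (Program.forTo i v c).writes a = false → s₁ a = s a := by
    intro a ha
    obtain ⟨hai, hac⟩ := (hw a).1 ha
    rw [hf a (by simp [Program.writes, hac, hai])]
    exact hs₀' a hai
  have hval : (Expr.sub (.get v (.const 0)) (.get i (.const 0))).val s₁ = m - j := by
    simp only [Expr.val, hij, hf' v hv, hm]
  rw [hval]
  refine ⟨fun h => hend s₁ hf' ?_, fun h => ?_⟩
  · obtain rfl : j = m := by omega
    exact hI
  · refine wp_mono (c := c) (wp_frame (hstep j (by omega) s₁ hf' hij hI)) ?_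
    rintro s₂ ⟨hI₂, hf₂⟩
    refine ⟨k - 1, by omega, j + 1, by omega, ?_, hInv _ s₂ _ ?_ hI₂⟩
    · simp [State.set_apply, Expr.val, hf₂ i hi, hij]
    · exact fun a ha => State.set_of_ne _ _ _ ha

end RAM

/-! ### Uncapacitated transshipment on a complete digraph -/

namespace Transship

/-- The potential `π` certifies the optimality of the flow `x` for the costs `c`. -/
structure Opt (N : ℕ) (c x : ℕ → ℕ → ℕ) (π : ℕ → ℕ) : Prop where
  le : ∀ u < N, ∀ v < N, π v ≤ π u + c u v
  tight : ∀ u < N, ∀ v < N, x u v ≠ 0 → π u + c u v ≤ π v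

/-- The reduced cost of the pair `(u, v)` in the residual network. -/
def red (c x : ℕ → ℕ → ℕ) (π : ℕ → ℕ) (u v : ℕ) : ℕ :=
  if x v u ≠ 0 then 0 else c u v + π u - π v

/-- In the residual network there is an arc from `u` to `v` of reduced cost zero. -/
def Tight (c x : ℕ → ℕ → ℕ) (π : ℕ → ℕ) (u v : ℕ) : Prop :=
  x v u ≠ 0 ∨ π v = π u + c u v

/-- The flow after sending `d` units from `u` to `v` in the residual network. -/
def push (x : ℕ → ℕ → ℕ) (d u v : ℕ) : ℕ → ℕ → ℕ := fun a b =>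
  if x v u ≠ 0 then (if a = v ∧ b = u then x a b - d else x a b)
  else (if a = u ∧ b = v then x a b + d else x a b)

/-- With supplies `P` and demands `Q`, the flow `x` leaves the supplies `p` and demands `q`. -/
def Balanced (N : ℕ) (x : ℕ → ℕ → ℕ) (P Q p q : ℕ → ℕ) : Prop :=
  ∀ w < N, ∑ u ∈ Finset.range N, x u w + P w + q w = ∑ u ∈ Finset.range N, x w u + Q w + p w

/-- The number of nodes that are not marked in `A`. -/
def unmarked (N : ℕ) (A : ℕ → ℕ) : ℕ := ((Finset.range N).filter fun v => A v = 0).card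

/-- The parents `par` form a tree with root `s` on the nodes marked in `A`; it consists of
residual arcs of reduced cost zero, and `rk` increases along its arcs. -/
structure Tree (N : ℕ) (c x : ℕ → ℕ → ℕ) (π A par rk : ℕ → ℕ) (s : ℕ) : Prop where
  root : A s ≠ 0
  par_lt : ∀ v < N, A v ≠ 0 → v ≠ s → par v < N
  par_mem : ∀ v < N, A v ≠ 0 → v ≠ s → A (par v) ≠ 0
  rk_lt : ∀ v < N, A v ≠ 0 → v ≠ s → rk (par v) < rk v
  tight : ∀ v < N, A v ≠ 0 → v ≠ s → Tight c x π (par v) v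
  rk_le : ∀ v < N, A v ≠ 0 → rk v + unmarked N A ≤ N

variable {N : ℕ} {c x : ℕ → ℕ → ℕ} {π A par rk P Q p q : ℕ → ℕ} {s : ℕ}

/-- Only pairs between marked and unmarked nodes matter. From marked to unmarked, the slack is at
least `δ`. If such a pair carries flow in either direction, one of the two residual directions from
marked to unmarked has reduced cost zero; then `δ = 0`, or the pair itself is tight and again `δ =
0`. -/
theorem Opt.raise (h : Opt N c x π) {δ : ℕ}
    (hδ : ∀ u < N, ∀ v < N, A u ≠ 0 → A v = 0 → δ ≤ red c x π u v) :
    Opt N c x fun w => if A w = 0 then π w + δ else π w := by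
  constructor
  · intro u hu v hv
    have h1 := h.le u hu v hv
    have h2 := hδ u hu v hv
    unfold red at h2
    split_ifs at h2 ⊢ <;> simp_all <;> omega
  · intro u hu v hv hx
    have h1 := h.tight u hu v hv hx
    have h3 := h.le u hu v hv
    have h2 := hδ u hu v hv
    have h4 := hδ v hv u hu
    unfold red at h2 h4
    split_ifs at h2 h4 ⊢ <;> simp_all <;> omega

/-- Cancelling flow creates no new positive entry, and the only entry that can become positive
belongs to a pair that is tight by assumption. -/
theorem Opt.push (h : Opt N c x π) {u v : ℕ} (ht : Tight c x π u v) (d : ℕ) :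
    Opt N c (push x d u v) π := by
  refine ⟨h.le, fun a ha b hb hx => ?_⟩
  have h1 := h.tight a ha b hb
  unfold Transship.push at hx
  unfold Tight at ht
  by_cases hvu : x v u ≠ 0
  · rw [if_pos hvu] at hx
    split_ifs at hx with hab
    · exact h1 (by omega)
    · exact h1 hx
  · rw [if_neg hvu] at hx
    split_ifs at hx with hab
    · obtain ⟨rfl, rfl⟩ := hab
      exact (ht.resolve_left hvu).ge
    · exact h1 hx

/-- Divisibility by the scale makes residual capacities sufficient: a nonzero entry is at least `d`.
-/
theorem dvd_push {d u v : ℕ} (h : ∀ a b, d ∣ x a b) (a b : ℕ) : d ∣ push x d u v a b := by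
  have := h a b
  unfold push
  split_ifs
  · exact Nat.dvd_sub this dvd_rfl
  · exact this
  · exact this.add dvd_rfl
  · exact this

/-- Since `d` divides `x v u`, this entry is zero or at least `d`; hence the truncated subtraction
in `push` is exact. The equation is stated additively to stay within `ℕ`. -/
theorem push_sum {d u v : ℕ} (hu : u < N) (hv : v < N) (hd : d ∣ x v u) (w : ℕ) :
    ∑ a ∈ Finset.range N, push x d u v a w + ∑ a ∈ Finset.range N, x w a + (if w = u then d else 0)
      = ∑ a ∈ Finset.range N, x a w + ∑ a ∈ Finset.range N, push x d u v w a
        + (if w = v then d else 0) := by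
  by_cases hvu : x v u ≠ 0
  · have hd' := Nat.le_of_dvd (Nat.pos_of_ne_zero hvu) hd
    have key : ∀ a b, push x d u v a b + (if a = v ∧ b = u then d else 0) = x a b := by
      intro a b
      simp only [push, if_pos hvu]
      split_ifs with h
      · obtain ⟨rfl, rfl⟩ := h; omega
      · rfl
    have e1 : ∑ a ∈ Finset.range N, push x d u v a w + (if w = u then d else 0) =
        ∑ a ∈ Finset.range N, x a w := by
      rw [← Finset.sum_congr rfl fun a _ => key a w, Finset.sum_add_distrib]
      congr 1
      by_cases hw : w = u <;> simp [hw, hv]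
    have e2 : ∑ a ∈ Finset.range N, push x d u v w a + (if w = v then d else 0) =
        ∑ a ∈ Finset.range N, x w a := by
      rw [← Finset.sum_congr rfl fun a _ => key w a, Finset.sum_add_distrib]
      congr 1
      by_cases hw : w = v <;> simp [hw, hu]
    omega
  · have key : ∀ a b, push x d u v a b = x a b + (if a = u ∧ b = v then d else 0) := by
      intro a b
      simp only [push, if_neg hvu]
      split_ifs with h <;> rfl
    have e1 : ∑ a ∈ Finset.range N, push x d u v a w =
        ∑ a ∈ Finset.range N, x a w + (if w = v then d else 0) := by
      rw [Finset.sum_congr rfl fun a _ => key a w, Finset.sum_add_distrib]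
      congr 1
      by_cases hw : w = v <;> simp [hw, hu]
    have e2 : ∑ a ∈ Finset.range N, push x d u v w a =
        ∑ a ∈ Finset.range N, x w a + (if w = u then d else 0) := by
      rw [Finset.sum_congr rfl fun a _ => key w a, Finset.sum_add_distrib]
      congr 1
      by_cases hw : w = u <;> simp [hw, hv]
    omega

theorem unmarked_update {v : ℕ} (hv : v < N) (hA : A v = 0) :
    unmarked N (Function.update A v 1) + 1 = unmarked N A := by
  unfold unmarked
  rw [← Finset.card_erase_add_one (a := v) (s := (Finset.range N).filter fun v => A v = 0)
    (by simp [hv, hA])]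
  congr 2
  ext a
  by_cases ha : a = v <;> simp [ha, Function.update_apply]

/-- Raising by the reduced cost of `(u, v)` makes this pair tight, and the old tree arcs stay tight
because both ends are marked and keep their potentials. The new rank is one larger than that of `u`
while one node fewer is unmarked, so `rk_le` survives; it is what later bounds the length of tree
paths by `N`. -/
theorem Tree.extend (h : Tree N c x π A par rk s) (ho : Opt N c x π) {u v : ℕ} (hu : u < N)
    (hv : v < N) (hAu : A u ≠ 0) (hAv : A v = 0) :
    Tree N c x (fun w => if A w = 0 then π w + red c x π u v else π w) (Function.update A v 1)
      (Function.update par v u) (Function.update rk v (rk u + 1)) s := by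
  have hm := unmarked_update hv hAv
  have huv : u ≠ v := by rintro rfl; exact hAu hAv
  have hmem : ∀ a, Function.update A v 1 a ≠ 0 → a = v ∨ a ≠ v ∧ A a ≠ 0 := by
    intro a ha
    by_cases hav : a = v
    · exact .inl hav
    · exact .inr ⟨hav, by simpa [hav] using ha⟩
  have hpar : ∀ a < N, A a ≠ 0 → a ≠ s → par a ≠ v := by
    rintro a ha hAa has rfl
    exact h.par_mem a ha hAa has hAv
  constructor
  · by_cases hsv : s = v
    · simp [hsv]
    · simpa [hsv] using h.root
  · intro a ha hAa has
    rcases hmem a hAa with rfl | ⟨hav, hAa⟩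
    · simpa using hu
    · simpa [hav] using h.par_lt a ha hAa has
  · intro a ha hAa has
    rcases hmem a hAa with rfl | ⟨hav, hAa⟩
    · simpa [huv] using hAu
    · simpa [hav, hpar a ha hAa has] using h.par_mem a ha hAa has
  · intro a ha hAa has
    rcases hmem a hAa with rfl | ⟨hav, hAa⟩
    · simp [huv]
    · simpa [hav, hpar a ha hAa has] using h.rk_lt a ha hAa has
  · intro a ha hAa has
    rcases hmem a hAa with rfl | ⟨hav, hAa⟩
    · have := ho.le u hu a hv
      unfold Tight red
      simp only [Function.update_self, hAv, if_true, if_neg hAu]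
      by_cases hx : x a u = 0
      · right; simp only [hx]; simp; omega
      · exact .inl hx
    · have := h.tight a ha hAa has
      have := h.par_mem a ha hAa has
      simp_all [Tight]
  · intro a ha hAa
    rcases hmem a hAa with rfl | ⟨hav, hAa⟩
    · have := h.rk_le u hu hAu
      simp; omega
    · have := h.rk_le a ha hAa
      simp [hav]; omega

/-- Pushing along `(par v, v)` changes one of the entries `(v, par v)` and `(par v, v)`. The first
could concern the tree arc into `w` only for `w = v`, the second only for `w = par v` and `par w =
v`; ranks exclude both. -/
theorem tight_push (h : Tree N c x π A par rk s) {v w : ℕ} {y : ℕ → ℕ → ℕ} (d : ℕ) (hv : v < N)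
    (hAv : A v ≠ 0) (hvs : v ≠ s) (hw : w < N) (hAw : A w ≠ 0) (hws : w ≠ s)
    (hrk : rk w ≤ rk (par v)) (ht : Tight c y π (par w) w) :
    Tight c (push y d (par v) v) π (par w) w := by
  have h1 := h.rk_lt v hv hAv hvs
  have h2 := h.rk_lt w hw hAw hws
  have hwv : w ≠ v := by rintro rfl; omega
  have hpw : ¬ (w = par v ∧ par w = v) := by rintro ⟨e, e'⟩; rw [e'] at h2; omega
  unfold Tight at ht ⊢
  unfold push
  simp only [hwv, false_and, if_false, hpw]
  split_ifs <;> exact ht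

/-- Summation by parts: the right side depends only on supplies and demands, so any two balanced
flows give the same value on the left. It is used with a potential for optimality and with the
indicator of a cut for infeasibility. -/
theorem sum_potential {P Q f : ℕ → ℝ} {z : ℕ → ℕ → ℝ}
    (h : ∀ w < N, ∑ u ∈ Finset.range N, z u w + P w = ∑ u ∈ Finset.range N, z w u + Q w) :
    ∑ u ∈ Finset.range N, ∑ v ∈ Finset.range N, z u v * (f u - f v) =
      ∑ w ∈ Finset.range N, f w * (P w - Q w) := by
  have h1 : ∀ w ∈ Finset.range N, f w * (P w - Q w) =
      ∑ v ∈ Finset.range N, z w v * f w - ∑ u ∈ Finset.range N, z u w * f w := by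
    intro w hw
    rw [← Finset.sum_mul, ← Finset.sum_mul]
    have := h w (Finset.mem_range.1 hw)
    linear_combination f w * this
  rw [Finset.sum_congr rfl h1, Finset.sum_sub_distrib,
    Finset.sum_comm (f := fun w u => z u w * f w), ← Finset.sum_sub_distrib]
  refine Finset.sum_congr rfl fun u _ => ?_
  rw [← Finset.sum_sub_distrib]
  exact Finset.sum_congr rfl fun v _ => by ring

/-- A flow with a certificate has minimum cost. -/
theorem Opt.sum_le (h : Opt N c x π) (hx : Balanced N x P Q (fun _ => 0) (fun _ => 0))
    {y : ℕ → ℕ → ℝ} (hy0 : ∀ u < N, ∀ v < N, 0 ≤ y u v)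
    (hy : ∀ w < N, ∑ u ∈ Finset.range N, y u w + P w = ∑ u ∈ Finset.range N, y w u + Q w) :
    ∑ u ∈ Finset.range N, ∑ v ∈ Finset.range N, (c u v : ℝ) * x u v ≤
      ∑ u ∈ Finset.range N, ∑ v ∈ Finset.range N, (c u v : ℝ) * y u v := by
  have ex := sum_potential (N := N) (f := fun w => (π w : ℝ)) (z := fun u v => (x u v : ℝ))
    (P := fun w => P w) (Q := fun w => Q w) fun w hw => by
      have := hx w hw
      simp only [add_zero] at this
      exact_mod_cast this
  have ey := sum_potential (f := fun w => (π w : ℝ)) hy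
  -- The flow `x` lives on pairs of reduced cost zero, while all reduced costs are nonnegative, so
  -- the left side vanishes and the right side is nonnegative.
  have key : ∀ u ∈ Finset.range N, ∀ v ∈ Finset.range N,
      (c u v : ℝ) * x u v + x u v * (π u - π v) ≤ (c u v : ℝ) * y u v + y u v * (π u - π v) := by
    intro u hu v hv
    rw [Finset.mem_range] at hu hv
    have h1 : (π v : ℝ) ≤ π u + c u v := by exact_mod_cast h.le u hu v hv
    have h2 : (c u v : ℝ) * x u v + x u v * (π u - π v) = 0 := by
      by_cases hx : x u v = 0
      · simp [hx]
      · have : (π u : ℝ) + c u v = π v := by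
          exact_mod_cast le_antisymm (h.tight u hu v hv hx) (h.le u hu v hv)
        linear_combination (x u v : ℝ) * this
    rw [h2]
    have := hy0 u hu v hv
    nlinarith
  have := Finset.sum_le_sum fun u hu => Finset.sum_le_sum fun v hv => key u hu v hv
  simp only [Finset.sum_add_distrib] at this
  rw [ex, ey] at this
  linarith

/-- If an optimal flow uses an expensive pair, then every flow uses an expensive pair. -/
theorem Opt.not_feasible (h : Opt N c x π) (hx : Balanced N x P Q (fun _ => 0) (fun _ => 0))
    {H M : ℕ} (hM : N * H < M) {Arc : ℕ → ℕ → Prop}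
    (hArc : ∀ u < N, ∀ v < N, Arc u v → c u v ≤ H) {u₀ v₀ : ℕ} (hu₀ : u₀ < N) (hv₀ : v₀ < N)
    (h₀ : c u₀ v₀ = M) (hx₀ : x u₀ v₀ ≠ 0)
    {y : ℕ → ℕ → ℝ} (hy0 : ∀ u < N, ∀ v < N, 0 ≤ y u v)
    (hyA : ∀ u < N, ∀ v < N, ¬ Arc u v → y u v = 0)
    (hy : ∀ w < N, ∑ u ∈ Finset.range N, y u w + P w = ∑ u ∈ Finset.range N, y w u + Q w) :
    False := by
  have hπ := h.tight u₀ hu₀ v₀ hv₀ hx₀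
  -- Pigeonhole: the `N` disjoint intervals of length `H` above `π u₀` cannot each contain the
  -- potential of one of the at most `N - 1` nodes other than `u₀`, so one of them is empty.
  obtain ⟨k, hkN, hk⟩ : ∃ k < N, ∀ v < N, π u₀ + k * H < π v → π u₀ + (k + 1) * H < π v := by
    by_contra! hcon
    choose! f hf1 hf2 hf3 using hcon
    have hcard := Finset.card_le_card_of_injOn f (s := Finset.range N)
      (t := (Finset.range N).erase u₀) (by
        intro k hk
        have hk := Finset.mem_range.1 hk
        have := hf2 k hk
        have hne : f k ≠ u₀ := by intro e; rw [e] at this; omega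
        simp [hne, hf1 k hk]) (by
        intro a ha b hb hab
        have ha := Finset.mem_range.1 ha
        have hb := Finset.mem_range.1 hb
        have a2 := hf2 a ha
        have a3 := hf3 a ha
        have b2 := hf2 b hb
        have b3 := hf3 b hb
        rw [← hab] at b2 b3
        by_contra hne
        rcases Nat.lt_or_gt_of_ne hne with hlt | hlt
        · have : (a + 1) * H ≤ b * H := Nat.mul_le_mul_right _ hlt
          omega
        · have : (b + 1) * H ≤ a * H := Nat.mul_le_mul_right _ hlt
          omega)
    rw [Finset.card_erase_of_mem (by simpa using hu₀), Finset.card_range] at hcard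
    omega
  set θ := π u₀ + k * H with hθ
  have hθ' : π u₀ + (k + 1) * H = θ + H := by rw [hθ]; ring
  rw [hθ'] at hk
  have hkH : k * H ≤ N * H := Nat.mul_le_mul_right _ hkN.le
  -- The cut below the empty interval. A pair of cost at most `H` cannot jump over it upwards, so a
  -- flow on arcs has no positive net flow out of the lower side. By tightness `x` never goes
  -- downwards across the cut, yet the expensive pair crosses it upwards.
  set f : ℕ → ℝ := fun w => if π w ≤ θ then 1 else 0 with hf
  have ex := sum_potential (N := N) (f := f) (z := fun u v => (x u v : ℝ))
    (P := fun w => P w) (Q := fun w => Q w) fun w hw => by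
      have := hx w hw
      simp only [add_zero] at this
      exact_mod_cast this
  have ey := sum_potential (f := f) hy
  have hy1 : ∑ u ∈ Finset.range N, ∑ v ∈ Finset.range N, y u v * (f u - f v) ≤ 0 := by
    refine Finset.sum_nonpos fun u hu => Finset.sum_nonpos fun v hv => ?_
    rw [Finset.mem_range] at hu hv
    have h1 := hy0 u hu v hv
    by_cases hA : Arc u v
    · have := hArc u hu v hv hA
      have := h.le u hu v hv
      have := hk v hv
      simp only [hf]
      split_ifs
      · simp
      · omega
      · linarith
      · simp
    · simp [hyA u hu v hv hA]
  have hx1 : ∀ u ∈ Finset.range N, ∀ v ∈ Finset.range N, (0 : ℝ) ≤ x u v * (f u - f v) := by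
    intro u hu v hv
    rw [Finset.mem_range] at hu hv
    by_cases hx' : x u v = 0
    · simp [hx']
    · have := h.tight u hu v hv hx'
      simp only [hf]
      split_ifs
      · simp
      · simp
      · omega
      · simp
  have hx2 : (x u₀ v₀ : ℝ) * (f u₀ - f v₀) ≤ 0 := by
    have h1 := Finset.single_le_sum (fun v hv => hx1 u₀ (Finset.mem_range.2 hu₀) v hv)
      (Finset.mem_range.2 hv₀)
    have h2 := Finset.single_le_sum (f := fun u => ∑ v ∈ Finset.range N, (x u v : ℝ) * (f u - f v))
      (fun u hu => Finset.sum_nonneg (hx1 u hu)) (Finset.mem_range.2 hu₀)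
    rw [ex, ← ey] at h2
    exact (h1.trans h2).trans hy1
  have hfu : f u₀ = 1 := if_pos (by omega)
  have hfv : f v₀ = 0 := if_neg (by omega)
  rw [hfu, hfv] at hx2
  have : (0 : ℝ) < x u₀ v₀ := by exact_mod_cast Nat.pos_of_ne_zero hx₀
  linarith

end Transship

/-! ### The transshipment algorithm as a program -/

namespace RAM

open Transship

/-- The address of the entry `(u, v)` of a matrix. -/
def pr (u v : ℕ) : ℕ := (u + v) * (u + v) + u

/-- Since `u ≤ u + v`, the address lies between `(u + v) ^ 2` and the next square, so it determines
`u + v` and then `u`. -/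
theorem pr_inj {u v u' v' : ℕ} : pr u v = pr u' v' ↔ u = u' ∧ v = v' := by
  refine ⟨fun h => ?_, by rintro ⟨rfl, rfl⟩; rfl⟩
  unfold pr at h
  have hs : u + v = u' + v' := by
    by_contra hne
    rcases Nat.lt_or_gt_of_ne hne with hlt | hlt <;> nlinarith
  rw [hs] at h
  omega

/-- The array with name `a` as a matrix. -/
def State.mat (s : State) (a : ℕ) : ℕ → ℕ → ℕ := fun u v => s a (pr u v)

/-- The variable `a`, stored in the cell `0` of the array `a`. -/
def Expr.var (a : ℕ) : Expr := .get a (.const 0)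

/-- The entry of a matrix. -/
def Expr.entry (a : ℕ) (e₁ e₂ : Expr) : Expr := .get a (.add (.mul (.add e₁ e₂) (.add e₁ e₂)) e₁)

/-- The test whether `e₂ ≤ e₁`. -/
def Expr.ge (e₁ e₂ : Expr) : Expr := .sub (.add e₁ (.const 1)) e₂

/-- Assignment to a variable. -/
def Program.setVar (a : ℕ) (e : Expr) : Program := .assign a (.const 0) e

/-- Assignment to an entry of a matrix. -/
def Program.setEntry (a : ℕ) (e₁ e₂ e : Expr) : Program :=
  .assign a (.add (.mul (.add e₁ e₂) (.add e₁ e₂)) e₁) e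

open RAM.Expr RAM.Program

section Values

variable (s : State) (a b i x k : ℕ) (e e₁ e₂ : Expr)

@[simp] theorem val_var : (var a).val s = s a 0 := rfl
@[simp] theorem val_entry : (entry a e₁ e₂).val s = s.mat a (e₁.val s) (e₂.val s) := rfl
@[simp] theorem val_const : (Expr.const k).val s = k := rfl
@[simp] theorem val_get : (Expr.get a e).val s = s a (e.val s) := rfl
@[simp] theorem val_add : (Expr.add e₁ e₂).val s = e₁.val s + e₂.val s := rfl
@[simp] theorem val_sub : (Expr.sub e₁ e₂).val s = e₁.val s - e₂.val s := rfl
@[simp] theorem val_mul : (Expr.mul e₁ e₂).val s = e₁.val s * e₂.val s := rfl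
@[simp] theorem val_div : (Expr.div e₁ e₂).val s = e₁.val s / e₂.val s := rfl

theorem val_ge : (Expr.ge e₁ e₂).val s ≠ 0 ↔ e₂.val s ≤ e₁.val s := by
  simp only [Expr.ge, val_sub, val_add, val_const]; omega

theorem val_ge_eq_zero : (Expr.ge e₁ e₂).val s = 0 ↔ e₁.val s < e₂.val s := by
  simp only [Expr.ge, val_sub, val_add, val_const]; omega

theorem mat_set_same (u v : ℕ) : (s.set a (pr u v) x).mat a =
    fun u' v' => if u' = u ∧ v' = v then x else s.mat a u' v' := by
  funext u' v'
  simp only [State.mat, State.set_apply, true_and, pr_inj]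

theorem mat_congr {s s' : State} {a : ℕ} (h : s' a = s a) : s'.mat a = s.mat a := by
  unfold State.mat; rw [h]

theorem mat_set_of_ne (h : b ≠ a) : (s.set a i x).mat b = s.mat b := by
  exact mat_congr (State.set_of_ne _ _ _ h)

end Values

section Rules

variable {R : ℕ} {Q : State → Prop} {s : State}

@[simp] theorem wp_skip : wp R .skip Q s ↔ Q s := Iff.rfl
@[simp] theorem wp_assign {a : ℕ} {i e : Expr} :
    wp R (.assign a i e) Q s ↔ Q (s.set a (i.val s) (e.val s)) := Iff.rfl
@[simp] theorem wp_setVar {a : ℕ} {e : Expr} :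
    wp R (setVar a e) Q s ↔ Q (s.set a 0 (e.val s)) := Iff.rfl
@[simp] theorem wp_setEntry {a : ℕ} {e₁ e₂ e : Expr} :
    wp R (setEntry a e₁ e₂ e) Q s ↔ Q (s.set a (pr (e₁.val s) (e₂.val s)) (e.val s)) := Iff.rfl
theorem wp_seq {c₁ c₂ : Program} : wp R (.seq c₁ c₂) Q s ↔ wp R c₁ (wp R c₂ Q) s := Iff.rfl
theorem wp_ite {e : Expr} {c₁ c₂ : Program} : wp R (.ite e c₁ c₂) Q s ↔
    (e.val s ≠ 0 → wp R c₁ Q s) ∧ (e.val s = 0 → wp R c₂ Q s) := Iff.rfl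

/-- Sequential composition, keeping track of the arrays that the first part does not change. -/
theorem wp_seq_frame {c₁ c₂ : Program} {Q₁ : State → Prop} (h₁ : wp R c₁ Q₁ s)
    (h₂ : ∀ s₁, (∀ a, c₁.writes a = false → s₁ a = s a) → Q₁ s₁ → wp R c₂ Q s₁) :
    wp R (.seq c₁ c₂) Q s :=
  wp_mono (c := c₁) (wp_frame h₁) fun s₁ h => h₂ s₁ h.2 h.1

end Rules

/-- `d = red u v` is the least reduced cost of the pairs from a marked to an unmarked node that
satisfy `S`; if `found = 0` there is no such pair. -/
structure IsBest (N : ℕ) (r : ℕ → ℕ → ℕ) (A : ℕ → ℕ) (S : ℕ → ℕ → Prop)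
    (found d u v : ℕ) : Prop where
  none : found = 0 → ∀ a b, S a b → A a ≠ 0 → A b ≠ 0
  lt : found ≠ 0 → u < N ∧ v < N
  mem : found ≠ 0 → A u ≠ 0 ∧ A v = 0
  eq : found ≠ 0 → d = r u v
  le : found ≠ 0 → ∀ a b, S a b → A a ≠ 0 → A b = 0 → d ≤ r a b

/-- Compare the pair `(17, 18)` with the best pair so far. -/
def comparePair : Program :=
  .seq (.ite (entry 10 (var 18) (var 17)) (setVar 23 (.const 0))
    (setVar 23 (.sub (.add (entry 7 (var 17) (var 18)) (.get 11 (var 17))) (.get 11 (var 18)))))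
  (.ite (.mul (var 22) (ge (var 23) (var 19))) .skip
    (.seq (setVar 19 (var 23)) (.seq (setVar 20 (var 17)) (.seq (setVar 21 (var 18))
      (setVar 22 (.const 1))))))

/-- Find the pair with least reduced cost from a marked to an unmarked node. -/
def findPair : Program :=
  .seq (setVar 22 (.const 0))
    (forTo 17 3 (forTo 18 3
      (.ite (.get 12 (var 17)) (.ite (.get 12 (var 18)) .skip comparePair) .skip)))

/-- Memory layout from here on: `0` input, `1` output, `2` the number `n`, `3` the number of nodes,
`4` the cost of pairs that are not arcs, `5` the common denominator, `6` the cost bound; `7` costs,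
`8` and `9` remaining supplies and demands, `10` flow, `11` potentials, `12` marks, `13` parents;
`14` scale, `15` and `16` the ends of the path, `17` and `18` loop variables, `19` to `22` the best
pair (its reduced cost, its two nodes, whether one was found), `23` the candidate's reduced cost,
`24` and `25` the current tree arc, `26` total demand, `27` total supply plus `m`, `28` the flag for
expensive pairs. -/
theorem wp_comparePair {R N : ℕ} {s : State} {S : ℕ → ℕ → Prop}
    (hu : s 17 0 < N) (hv : s 18 0 < N) (hAu : s 12 (s 17 0) ≠ 0) (hAv : s 12 (s 18 0) = 0)
    (h : IsBest N (red (s.mat 7) (s.mat 10) (s 11)) (s 12) S (s 22 0) (s 19 0) (s 20 0) (s 21 0)) :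
    wp R comparePair (fun s' => IsBest N (red (s.mat 7) (s.mat 10) (s 11)) (s 12)
      (fun a b => S a b ∨ a = s 17 0 ∧ b = s 18 0) (s' 22 0) (s' 19 0) (s' 20 0) (s' 21 0)) s := by
  unfold comparePair
  refine wp_seq_frame (Q₁ := fun s' =>
    s' 23 0 = red (s.mat 7) (s.mat 10) (s 11) (s 17 0) (s 18 0)) ?_ ?_
  · rw [wp_ite]
    constructor <;> intro h <;> simp at h <;> simp [h, red, State.set_apply]
  · intro s₁ hf h23
    have hf' : ∀ a, a ≠ 23 → s₁ a = s a := fun a ha => hf a (by simp [writes, setVar, ha])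
    rw [wp_ite]
    constructor <;> intro h'
    -- The product of the two tests is a conjunction: nothing is stored exactly if a pair is already
    -- recorded and is at least as good.
    · simp only [val_mul, val_var, mul_ne_zero_iff, val_ge, h23, hf' _ (by decide : 22 ≠ 23),
        hf' _ (by decide : 19 ≠ 23)] at h'
      simp only [wp_skip, hf' _ (by decide : 22 ≠ 23), hf' _ (by decide : 19 ≠ 23),
        hf' _ (by decide : 20 ≠ 23), hf' _ (by decide : 21 ≠ 23)]
      refine ⟨fun h0 => absurd h0 h'.1, h.lt, h.mem, h.eq, fun h0 a b hab ha hb => ?_⟩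
      rcases hab with hab | ⟨rfl, rfl⟩
      · exact h.le h0 a b hab ha hb
      · exact h'.2
    · simp only [val_mul, val_var, mul_eq_zero, val_ge_eq_zero, h23, hf' _ (by decide : 22 ≠ 23),
        hf' _ (by decide : 19 ≠ 23)] at h'
      simp [wp_seq, State.set_apply, h23, hf']
      refine ⟨by simp, by simp [hu, hv], by simp [hAu, hAv], by simp, fun _ a b hab ha hb => ?_⟩
      rcases hab with hab | ⟨rfl, rfl⟩
      · by_cases h0 : s 22 0 = 0
        · exact absurd hb (h.none h0 a b hab ha)
        · exact (h'.resolve_left h0).le.trans (h.le h0 a b hab ha hb)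
      · exact le_rfl

theorem IsBest.weaken {N : ℕ} {r : ℕ → ℕ → ℕ} {A : ℕ → ℕ} {S S' : ℕ → ℕ → Prop}
    {found d u v : ℕ} (h : IsBest N r A S found d u v)
    (hS : ∀ a b, S' a b → A a ≠ 0 → A b = 0 → S a b) : IsBest N r A S' found d u v where
  none h0 a b hab ha hb := h.none h0 a b (hS a b hab ha hb) ha hb
  lt := h.lt
  mem := h.mem
  eq := h.eq
  le h0 a b hab ha hb := h.le h0 a b (hS a b hab ha hb) ha hb

theorem wp_findPair {R N : ℕ} {s : State} (hN : s 3 0 = N) (hR : N < R) :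
    wp R findPair (fun s' => IsBest N (red (s.mat 7) (s.mat 10) (s 11)) (s 12)
      (fun a b => a < N ∧ b < N) (s' 22 0) (s' 19 0) (s' 20 0) (s' 21 0)) s := by
  unfold findPair
  rw [wp_seq, wp_setVar]
  refine wp_forTo (m := N) (by simpa [State.set_apply] using hN) hR (by decide) (by decide)
    (fun j s' => IsBest N (red (s.mat 7) (s.mat 10) (s 11)) (s 12)
      (fun a b => a < j ∧ b < N) (s' 22 0) (s' 19 0) (s' 20 0) (s' 21 0)) ?_ ?_ ?_ ?_
  · intro j s₁ s₂ h; simp [h]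
  · constructor <;> simp [State.set_apply]
  · intro i hi s₁ hf hi₁ hI
    -- The pairs inspected so far are the complete rows above `i` and the first `j` entries of row
    -- `i`.
    refine wp_forTo (m := N) (by simpa [hf 3 (by decide), State.set_apply] using hN) hR (by decide)
      (by decide) (fun j s' => IsBest N (red (s.mat 7) (s.mat 10) (s 11)) (s 12)
      (fun a b => a < i ∧ b < N ∨ a = i ∧ b < j) (s' 22 0) (s' 19 0) (s' 20 0) (s' 21 0)) ?_ ?_ ?_ ?_
    · intro j s₁ s₂ h; simp [h]
    · simpa using hI
    · intro j hj s₂ hf₂ hj₂ hJ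
      have hi₂ : s₂ 17 0 = i := by rw [hf₂ 17 (by decide), hi₁]
      have hf' : ∀ a, (forTo 17 3 (forTo 18 3 (.ite (.get 12 (var 17))
          (.ite (.get 12 (var 18)) .skip comparePair) .skip))).writes a = false → a ≠ 22 →
          s₂ a = s a := by
        intro a ha ha'
        rw [hf₂ a (by simp only [forTo, writes, Bool.or_eq_false_iff] at ha ⊢; tauto), hf a ha,
          State.set_of_ne _ _ _ ha']
      have h7 := hf' 7 (by decide) (by decide)
      have h10 := hf' 10 (by decide) (by decide)
      have h11 := hf' 11 (by decide) (by decide)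
      have h12 := hf' 12 (by decide) (by decide)
      have m7 : s₂.mat 7 = s.mat 7 := mat_congr h7
      have m10 : s₂.mat 10 = s.mat 10 := mat_congr h10
      simp only [wp_ite, wp_skip, val_get, val_var, hi₂, hj₂, h12]
      refine ⟨fun hA => ⟨fun hB => hJ.weaken ?_, fun hB => ?_⟩, fun hA => hJ.weaken ?_⟩
      · rintro a b h _ hb
        rcases eq_or_ne b j with rfl | hbj
        · exact absurd hb hB
        · omega
      · have := wp_comparePair (R := R) (N := N) (s := s₂) (by omega) (by omega)
          (by rwa [hi₂, h12]) (by rwa [hj₂, h12]) (by rw [m7, m10, h11, h12]; exact hJ)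
        rw [m7, m10, h11, h12, hi₂, hj₂] at this
        refine wp_mono this fun s' h' => h'.weaken ?_
        intro a b h _ _
        omega
      · rintro a b h ha _
        rcases eq_or_ne a i with rfl | hai
        · exact absurd hA ha
        · omega
    · intro s₂ _ h
      refine h.weaken ?_
      intro a b h _ _
      omega
  · intro s' _ h
    exact h

end RAM

namespace Transship

variable {N : ℕ} {c x : ℕ → ℕ → ℕ} {π π' A A' par par' rk : ℕ → ℕ} {s : ℕ}

theorem unmarked_le (N : ℕ) (A : ℕ → ℕ) : unmarked N A ≤ N :=
  (Finset.card_filter_le _ _).trans_eq (Finset.card_range N)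

theorem Opt.congr (h : Opt N c x π) (hπ : ∀ v < N, π' v = π v) : Opt N c x π' where
  le u hu v hv := by rw [hπ u hu, hπ v hv]; exact h.le u hu v hv
  tight u hu v hv := by rw [hπ u hu, hπ v hv]; exact h.tight u hu v hv

theorem Tree.congr (h : Tree N c x π A par rk s) (hπ : ∀ v < N, π' v = π v) :
    Tree N c x π' A par rk s where
  root := h.root
  par_lt := h.par_lt
  par_mem := h.par_mem
  rk_lt := h.rk_lt
  tight v hv hA hs := by
    unfold Tight
    rw [hπ v hv, hπ _ (h.par_lt v hv hA hs)]
    exact h.tight v hv hA hs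
  rk_le := h.rk_le

end Transship

/-! ### Shortest path search and augmentation. -/

namespace RAM

open Transship RAM.Expr RAM.Program

/-- Add the value of `19` to the potential of all unmarked nodes. -/
def raise : Program :=
  forTo 17 3 (.ite (.get 12 (var 17)) .skip
    (.assign 11 (var 17) (.add (.get 11 (var 17)) (var 19))))

/-- Mark one more node. -/
def searchStep : Program :=
  .seq findPair (.seq raise (.seq (.assign 12 (var 21) (.const 1))
    (.assign 13 (var 21) (var 20))))

/-- Grow a tree of residual arcs of reduced cost zero from the node `15` until it contains the
node `16`, changing the potential. -/
def search : Program :=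
  .seq (forTo 17 3 (.assign 12 (var 17) (.const 0))) (.seq (.assign 12 (var 15) (.const 1))
    (.loop (.sub (.const 1) (.get 12 (var 16))) searchStep))

/-- Send `14` units along the residual arc `(25, 24)`. -/
def pushArc : Program :=
  .ite (entry 10 (var 24) (var 25))
    (setEntry 10 (var 24) (var 25) (.sub (entry 10 (var 24) (var 25)) (var 14)))
    (setEntry 10 (var 25) (var 24) (.add (entry 10 (var 25) (var 24)) (var 14)))

/-- Send `14` units from the node `15` to the node `16` in the tree. -/
def walk : Program :=
  .seq (setVar 24 (var 16))
    (.loop (.add (.sub (var 24) (var 15)) (.sub (var 15) (var 24)))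
      (.seq (setVar 25 (.get 13 (var 24))) (.seq pushArc (setVar 24 (var 25)))))

/-- Send `14` units from the node `15` to the node `16` along a shortest path. -/
def augment : Program :=
  .seq search (.seq walk
    (.seq (.assign 8 (var 15) (.sub (.get 8 (var 15)) (var 14)))
      (.assign 9 (var 16) (.sub (.get 9 (var 16)) (var 14)))))

theorem wp_raise {R N : ℕ} {s : State} (hN : s 3 0 = N) (hR : N < R) :
    wp R raise (fun s' => ∀ w < N, s' 11 w = if s 12 w = 0 then s 11 w + s 19 0 else s 11 w) s := by
  unfold raise
  refine wp_forTo hN hR (by decide) (by decide) (fun j s' => ∀ w, s' 11 w =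
    if w < j ∧ s 12 w = 0 then s 11 w + s 19 0 else s 11 w) ?_ ?_ ?_ ?_
  · intro j s₁ s₂ h; simp [h]
  · simp
  · intro j hj s₁ hf hj₁ hI
    have h12 := hf 12 (by decide)
    have h19 := hf 19 (by decide)
    simp only [wp_ite, wp_skip, wp_assign, val_get, val_var, val_add, hj₁, h12, h19,
      State.set_apply, true_and]
    refine ⟨fun h w => ?_, fun h w => ?_⟩
    · rw [hI w]
      congr 1
      rcases eq_or_ne w j with rfl | hw
      · simp [h]
      · simp only [eq_iff_iff, and_congr_left_iff]; omega
    · rcases eq_or_ne w j with rfl | hw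
      · simp [h, hI]
      · rw [if_neg hw, hI w]
        congr 1
        simp only [eq_iff_iff, and_congr_left_iff]; omega
  · intro s₁ _ h w hw
    simp [h, hw]

/-- The state of the search for a path from the node `15`. -/
def IsSearching (N : ℕ) (rk : ℕ → ℕ) (s : State) : Prop :=
  Opt N (s.mat 7) (s.mat 10) (s 11) ∧
    Tree N (s.mat 7) (s.mat 10) (s 11) (s 12) (s 13) rk (s 15 0)

/-- A step of Dijkstra's algorithm in primal-dual form: the least reduced cost on the cut around the
marked nodes is the largest admissible raise, and it makes the minimizing pair tight. -/
theorem wp_searchStep {R N v₀ : ℕ} {s : State} {rk : ℕ → ℕ} (hN : s 3 0 = N) (hR : N < R)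
    (h : IsSearching N rk s) (h15 : s 15 0 < N) (hv₀ : v₀ < N) (hA : s 12 v₀ = 0) :
    wp R searchStep (fun s' => ∃ rk', IsSearching N rk' s' ∧
      unmarked N (s' 12) < unmarked N (s 12)) s := by
  unfold searchStep
  refine wp_seq_frame (wp_findPair hN hR) fun s₁ f₁ hb => ?_
  -- The digraph is complete, so the root and the unmarked `v₀` form a candidate and the search
  -- cannot get stuck.
  have hfound : s₁ 22 0 ≠ 0 := fun h0 => hb.none h0 _ v₀ ⟨h15, hv₀⟩ h.2.root hA
  refine wp_seq_frame (wp_raise (by rw [f₁ 3 (by decide), hN]) hR) fun s₂ f₂ hr => ?_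
  simp only [wp_seq, wp_assign, val_var, val_const, IsSearching, State.set_same,
    State.set_of_ne _ _ _ (by decide : (11 : ℕ) ≠ 12),
    State.set_of_ne _ _ _ (by decide : (11 : ℕ) ≠ 13),
    State.set_of_ne _ _ _ (by decide : (12 : ℕ) ≠ 13),
    State.set_of_ne _ _ _ (by decide : (13 : ℕ) ≠ 12),
    State.set_of_ne _ _ _ (by decide : (15 : ℕ) ≠ 12),
    State.set_of_ne _ _ _ (by decide : (15 : ℕ) ≠ 13),
    State.set_of_ne _ _ _ (by decide : (20 : ℕ) ≠ 12),
    State.set_of_ne _ _ _ (by decide : (21 : ℕ) ≠ 12),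
    mat_set_of_ne _ _ _ _ _ (by decide : (7 : ℕ) ≠ 12),
    mat_set_of_ne _ _ _ _ _ (by decide : (7 : ℕ) ≠ 13),
    mat_set_of_ne _ _ _ _ _ (by decide : (10 : ℕ) ≠ 12),
    mat_set_of_ne _ _ _ _ _ (by decide : (10 : ℕ) ≠ 13)]
  have e7 : s₂.mat 7 = s.mat 7 := mat_congr (by rw [f₂ 7 (by decide), f₁ 7 (by decide)])
  have e10 : s₂.mat 10 = s.mat 10 := mat_congr (by rw [f₂ 10 (by decide), f₁ 10 (by decide)])
  rw [e7, e10, f₂ 12 (by decide), f₁ 12 (by decide), f₂ 13 (by decide), f₁ 13 (by decide),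
    f₂ 15 (by decide), f₁ 15 (by decide), f₂ 20 (by decide), f₂ 21 (by decide)]
  rw [f₁ 12 (by decide), f₁ 11 (by decide), hb.eq hfound] at hr
  obtain ⟨hu, hv⟩ := hb.lt hfound
  obtain ⟨hAu, hAv⟩ := hb.mem hfound
  have hraise := h.1.raise (δ := red (s.mat 7) (s.mat 10) (s 11) (s₁ 20 0) (s₁ 21 0))
    fun a ha b hb' hAa hAb => by
      rw [← hb.eq hfound]; exact hb.le hfound a b ⟨ha, hb'⟩ hAa hAb
  refine ⟨_, ⟨hraise.congr hr, (h.2.extend h.1 hu hv hAu hAv).congr hr⟩, ?_⟩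
  have := unmarked_update hv hAv
  omega

theorem wp_search {R N : ℕ} {s : State} (hN : s 3 0 = N) (hR : N < R)
    (h : Opt N (s.mat 7) (s.mat 10) (s 11)) (h15 : s 15 0 < N) (h16 : s 16 0 < N) :
    wp R search (fun s' => s' 12 (s 16 0) ≠ 0 ∧ ∃ rk, IsSearching N rk s') s := by
  unfold search
  refine wp_seq_frame (Q₁ := fun s' => ∀ v < N, s' 12 v = 0) ?_ fun s₁ f₁ hA => ?_
  · refine wp_forTo hN hR (by decide) (by decide) (fun j s' => ∀ v < j, s' 12 v = 0) ?_ ?_ ?_ ?_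
    · intro j s₁ s₂ h; simp [h]
    · simp
    · intro j hj s₁ _ hj₁ hI
      simp only [wp_assign, val_var, hj₁, State.set_apply, true_and, val_const]
      intro v hv
      split_ifs with hvj
      · rfl
      · exact hI v (by omega)
    · exact fun s₁ _ h => h
  rw [wp_seq, wp_assign]
  simp only [val_var, val_const, f₁ 15 (by decide)]
  -- Each step marks a node, so the number of unmarked nodes is the variant.
  refine wp_loop (k := N) (fun k s' => (∃ rk, IsSearching N rk s') ∧ unmarked N (s' 12) ≤ k) hR
    ⟨⟨fun _ => 0, ?_, ?_⟩, ?_⟩ ?_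
  · rw [State.set_of_ne _ _ _ (by decide), mat_set_of_ne _ _ _ _ _ (by decide),
      mat_set_of_ne _ _ _ _ _ (by decide), mat_congr (f₁ 7 (by decide)),
      mat_congr (f₁ 10 (by decide)), f₁ 11 (by decide)]
    exact h
  · have hroot : ∀ v < N, (s₁.set 12 (s 15 0) 1) 12 v ≠ 0 → v = s 15 0 := by
      intro v hv hv'
      by_contra hne
      rw [State.set_same, Function.update_of_ne hne] at hv'
      exact hv' (hA v hv)
    rw [State.set_of_ne s₁ (b := 15) _ _ (by decide), f₁ 15 (by decide)]
    refine ⟨by rw [State.set_same]; simp, ?_, ?_, ?_, ?_, fun v _ _ => by simpa using unmarked_le _ _⟩ <;>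
    · intro v hv hv' hne
      exact absurd (hroot v hv hv') hne
  · exact unmarked_le _ _
  · rintro k s₂ f₂ ⟨⟨rk, hI⟩, hk⟩
    have h15' : s₂ 15 0 = s 15 0 := by
      rw [f₂ 15 (by decide), State.set_of_ne _ _ _ (by decide), f₁ 15 (by decide)]
    have h16' : s₂ 16 0 = s 16 0 := by
      rw [f₂ 16 (by decide), State.set_of_ne _ _ _ (by decide), f₁ 16 (by decide)]
    have h3' : s₂ 3 0 = N := by
      rw [f₂ 3 (by decide), State.set_of_ne _ _ _ (by decide), f₁ 3 (by decide), hN]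
    simp only [val_sub, val_const, val_get, val_var, h16']
    refine ⟨fun h0 => ⟨by omega, rk, hI⟩, fun h0 => ?_⟩
    refine wp_mono (wp_searchStep (v₀ := s 16 0) h3' hR hI (by omega) h16 (by omega)) ?_
    rintro s₃ ⟨rk', hI', hlt⟩
    exact ⟨unmarked N (s₃ 12), by omega, ⟨rk', hI'⟩, le_rfl⟩

theorem wp_pushArc {R : ℕ} {s : State} : wp R pushArc
    (fun s' => s'.mat 10 = push (s.mat 10) (s 14 0) (s 25 0) (s 24 0)) s := by
  unfold pushArc
  simp only [wp_ite, wp_setEntry, val_entry, val_var, val_sub, val_add, mat_set_same]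
  constructor <;> intro h
  · funext a b
    simp only [push, if_pos h]
    split_ifs with hab
    · rw [hab.1, hab.2]
    · rfl
  · funext a b
    simp only [push, h, ne_eq, not_true_eq_false, if_false]
    split_ifs with hab
    · rw [hab.1, hab.2]
    · rfl

/-- The path is traversed backwards, from the node `16` along parents to the root `15`; ranks
decrease strictly and serve as variant. Pushing before the path is complete is harmless because the
missing units are recorded at the current node. -/
theorem wp_walk {R N : ℕ} {s : State} {rk P Q : ℕ → ℕ} (hR : N < R)
    (h : IsSearching N rk s) (h16 : s 16 0 < N) (hA : s 12 (s 16 0) ≠ 0)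
    (hdvd : ∀ a b, s 14 0 ∣ s.mat 10 a b) (hbal : Balanced N (s.mat 10) P Q (s 8) (s 9)) :
    wp R walk (fun s' => Opt N (s.mat 7) (s'.mat 10) (s 11) ∧ (∀ a b, s 14 0 ∣ s'.mat 10 a b) ∧
      ∀ w < N, ∑ u ∈ Finset.range N, s'.mat 10 u w + P w + s 9 w +
          (if w = s 15 0 then s 14 0 else 0) =
        ∑ u ∈ Finset.range N, s'.mat 10 w u + Q w + s 8 w +
          (if w = s 16 0 then s 14 0 else 0)) s := by
  unfold walk
  rw [wp_seq, wp_setVar]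
  obtain ⟨hopt, htree⟩ := h
  set s₀ := s.set 24 0 ((var 16).val s) with hs₀
  have h10 : s₀.mat 10 = s.mat 10 := mat_set_of_ne _ _ _ _ _ (by decide)
  -- Tightness is kept only for tree arcs of rank at most the current one, the arcs not yet used. In
  -- the balance the correction at the current node cancels that at node `16` at the start, and ends
  -- up at the root.
  refine wp_loop (k := rk (s 16 0)) (fun k s' => s' 24 0 < N ∧ s 12 (s' 24 0) ≠ 0 ∧
    rk (s' 24 0) = k ∧ Opt N (s.mat 7) (s'.mat 10) (s 11) ∧ (∀ a b, s 14 0 ∣ s'.mat 10 a b) ∧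
    (∀ w < N, s 12 w ≠ 0 → w ≠ s 15 0 → rk w ≤ k → Tight (s.mat 7) (s'.mat 10) (s 11) (s 13 w) w) ∧
    ∀ w < N, ∑ u ∈ Finset.range N, s'.mat 10 u w + P w + s 9 w +
          (if w = s' 24 0 then s 14 0 else 0) =
        ∑ u ∈ Finset.range N, s'.mat 10 w u + Q w + s 8 w +
          (if w = s 16 0 then s 14 0 else 0)) ?_ ?_ ?_
  · have := htree.rk_le _ h16 hA
    omega
  · have h24 : s₀ 24 0 = s 16 0 := by simp [hs₀, State.set_apply]
    rw [h24, h10]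
    refine ⟨h16, hA, rfl, hopt, hdvd, fun w hw hAw hws _ => htree.tight w hw hAw hws, ?_⟩
    intro w hw
    rw [hbal w hw]
  · rintro k s₁ f₁ ⟨h24, hA24, hk, ho, hd, ht, hb⟩
    have f : ∀ a, a ≠ 24 → a ≠ 25 → a ≠ 10 → s₁ a = s a := by
      intro a h1 h2 h3
      rw [f₁ a (by simp [writes, setVar, pushArc, setEntry, h1, h2, h3]), hs₀,
        State.set_of_ne _ _ _ h1]
    have e15 := f 15 (by decide) (by decide) (by decide)
    simp only [val_add, val_sub, val_var, e15]
    constructor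
    · intro h0
      have : s₁ 24 0 = s 15 0 := by omega
      rw [this] at hb
      exact ⟨ho, hd, hb⟩
    · intro h0
      have hne : s₁ 24 0 ≠ s 15 0 := by omega
      rw [wp_seq, wp_setVar]
      set s₂ := s₁.set 25 0 ((Expr.get 13 (var 24)).val s₁) with hs₂
      refine wp_seq_frame wp_pushArc fun s₃ f₃ h₃ => ?_
      rw [wp_setVar]
      set v := s₁ 24 0 with hv
      have hu : s₂ 25 0 = s 13 v := by
        simp [hs₂, State.set_apply, f 13 (by decide) (by decide) (by decide), hv]
      have e24 : s₂ 24 0 = v := by simp [hs₂, State.set_apply, hv]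
      have e14 : s₂ 14 0 = s 14 0 := by
        simp [hs₂, State.set_apply, f 14 (by decide) (by decide) (by decide)]
      have e10 : s₂.mat 10 = s₁.mat 10 := mat_set_of_ne _ _ _ _ _ (by decide)
      rw [hu, e24, e14, e10] at h₃
      have e25 : s₃ 25 0 = s 13 v := by rw [f₃ 25 (by decide), hu]
      have hrk := htree.rk_lt v h24 hA24 hne
      have hpar := htree.par_lt v h24 hA24 hne
      refine ⟨rk (s 13 v), by omega, ?_⟩
      simp only [State.set_same, Function.update_self, val_var, e25,
        mat_set_of_ne _ _ _ _ _ (by decide : (10 : ℕ) ≠ 24), h₃]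
      refine ⟨hpar, htree.par_mem v h24 hA24 hne, trivial,
        ho.push (ht v h24 hA24 hne hk.le) _, dvd_push hd, ?_, ?_⟩
      · intro w hw hAw hws hrw
        exact tight_push htree _ h24 hA24 hne hw hAw hws hrw (ht w hw hAw hws (by omega))
      · intro w hw
        have h1 := hb w hw
        have h2 := push_sum hpar h24 (hd v (s 13 v)) w
        omega

/-- The part of the invariant that concerns flow, potential and remaining supplies and demands. -/
structure IsFlowState (N : ℕ) (P Q : ℕ → ℕ) (s : State) : Prop where
  opt : Opt N (s.mat 7) (s.mat 10) (s 11)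
  balanced : Balanced N (s.mat 10) P Q (s 8) (s 9)
  sum_eq : ∑ v ∈ Finset.range N, s 8 v = ∑ v ∈ Finset.range N, s 9 v

theorem sum_update_sub {N a d : ℕ} {f : ℕ → ℕ} (ha : a < N) (hd : d ≤ f a) :
    ∑ v ∈ Finset.range N, Function.update f a (f a - d) v + d = ∑ v ∈ Finset.range N, f v := by
  have ha' := Finset.mem_range.2 ha
  rw [Finset.sum_update_of_mem ha', ← Finset.add_sum_erase _ _ ha', Finset.sdiff_singleton_eq_erase]
  omega

theorem update_sub_add {f : ℕ → ℕ} {a d : ℕ} (hd : d ≤ f a) (w : ℕ) :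
    Function.update f a (f a - d) w + (if w = a then d else 0) = f w := by
  rcases eq_or_ne w a with rfl | h
  · simp [hd]
  · simp [h]

theorem wp_augment {R N : ℕ} {s : State} {P Q : ℕ → ℕ} (hN : s 3 0 = N) (hR : N < R)
    (h : IsFlowState N P Q s) (hdvd : ∀ a b, s 14 0 ∣ s.mat 10 a b) (h15 : s 15 0 < N)
    (h16 : s 16 0 < N) (hp : s 14 0 ≤ s 8 (s 15 0)) (hq : s 14 0 ≤ s 9 (s 16 0)) :
    wp R augment (fun s' => IsFlowState N P Q s' ∧ (∀ a b, s 14 0 ∣ s'.mat 10 a b) ∧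
      ∑ v ∈ Finset.range N, s' 8 v + s 14 0 = ∑ v ∈ Finset.range N, s 8 v) s := by
  unfold augment
  refine wp_seq_frame (wp_search hN hR h.opt h15 h16) fun s₁ f₁ h₁ => ?_
  obtain ⟨hA, rk, hS⟩ := h₁
  have m10 : s₁.mat 10 = s.mat 10 := mat_congr (f₁ 10 (by decide))
  have e8 := f₁ 8 (by decide)
  have e9 := f₁ 9 (by decide)
  have e14 := f₁ 14 (by decide)
  have e15 := f₁ 15 (by decide)
  have e16 := f₁ 16 (by decide)
  refine wp_seq_frame (wp_walk (P := P) (Q := Q) hR hS (by rwa [e16])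
    (by rwa [e16]) (by rw [e14, m10]; exact hdvd) (by rw [m10, e8, e9]; exact h.balanced))
    fun s₂ f₂ h₂ => ?_
  obtain ⟨ho, hd, hb⟩ := h₂
  rw [e8, e9, e14, e15, e16] at hb
  rw [e14] at hd
  have g8 := (f₂ 8 (by decide)).trans e8
  have g9 := (f₂ 9 (by decide)).trans e9
  have g14 := (f₂ 14 (by decide)).trans e14
  have g15 := (f₂ 15 (by decide)).trans e15
  have g16 := (f₂ 16 (by decide)).trans e16
  rw [← f₂ 11 (by decide), ← mat_congr (f₂ 7 (by decide))] at ho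
  rw [wp_seq, wp_assign, wp_assign]
  set s₃ := (s₂.set 8 ((var 15).val s₂) (((Expr.get 8 (var 15)).sub (var 14)).val s₂)) with hs₃
  set s₄ := s₃.set 9 ((var 16).val s₃) (((Expr.get 9 (var 16)).sub (var 14)).val s₃) with hs₄
  have k8 : s₄ 8 = Function.update (s 8) (s 15 0) (s 8 (s 15 0) - s 14 0) := by
    rw [hs₄, State.set_of_ne _ _ _ (by decide), hs₃, State.set_same]
    simp [g8, g15, g14]
  have k9 : s₄ 9 = Function.update (s 9) (s 16 0) (s 9 (s 16 0) - s 14 0) := by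
    rw [hs₄, State.set_same, hs₃]
    simp [State.set_of_ne, g9, g16, g14]
  have k : ∀ a, a ≠ 8 → a ≠ 9 → s₄ a = s₂ a := by
    intro a h8 h9
    rw [hs₄, State.set_of_ne _ _ _ h9, hs₃, State.set_of_ne _ _ _ h8]
  have p8 := sum_update_sub h15 hp
  have p9 := sum_update_sub h16 hq
  rw [← k8] at p8
  rw [← k9] at p9
  refine ⟨⟨?_, ?_, ?_⟩, ?_, p8⟩
  · rw [mat_congr (k 7 (by decide) (by decide)), mat_congr (k 10 (by decide) (by decide)),
      k 11 (by decide) (by decide)]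
    exact ho
  · rw [mat_congr (k 10 (by decide) (by decide))]
    intro w hw
    have h1 := hb w hw
    have h2 := update_sub_add hp w
    have h3 := update_sub_add hq w
    rw [← k8] at h2
    rw [← k9] at h3
    omega
  · have := h.sum_eq
    omega
  · rw [mat_congr (k 10 (by decide) (by decide))]
    exact hd

end RAM

/-! ### Scaling. -/

namespace RAM

open Transship RAM.Expr RAM.Program

/-- Find a node `15` with remaining supply, and a node `16` with remaining demand, at least `14`;
the value is the number of nodes if there is none. -/
def findEnds : Program :=
  .seq (setVar 15 (var 3)) (.seq (setVar 16 (var 3)) (forTo 17 3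
    (.seq (.ite (ge (.get 8 (var 17)) (var 14)) (setVar 15 (var 17)) .skip)
      (.ite (ge (.get 9 (var 17)) (var 14)) (setVar 16 (var 17)) .skip))))

/-- One augmentation, or one halving of the scale `14`. -/
def solveStep : Program :=
  .seq findEnds (.ite (.mul (.sub (var 3) (var 15)) (.sub (var 3) (var 16))) augment
    (setVar 14 (.div (var 14) (.const 2))))

/-- The scaling algorithm. -/
def solve : Program := .loop (var 14) solveStep

/-- `a` is a node with `d ≤ f a`, or else `a = N` and there is no such node below `j`. -/
def IsEnd (N j d : ℕ) (f : ℕ → ℕ) (a : ℕ) : Prop :=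
  a < N ∧ d ≤ f a ∨ a = N ∧ ∀ v < j, f v < d

theorem IsEnd.succ_of_lt {N j d a : ℕ} {f : ℕ → ℕ} (h : IsEnd N j d f a) (hj : f j < d) :
    IsEnd N (j + 1) d f a := by
  refine h.imp_right fun ⟨h1, h2⟩ => ⟨h1, fun v hv => ?_⟩
  rcases Nat.lt_succ_iff_lt_or_eq.1 hv with hv | rfl
  · exact h2 v hv
  · exact hj

theorem wp_findEnds {R N : ℕ} {s : State} (hN : s 3 0 = N) (hR : N < R) :
    wp R findEnds (fun s' => IsEnd N N (s 14 0) (s 8) (s' 15 0) ∧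
      IsEnd N N (s 14 0) (s 9) (s' 16 0)) s := by
  unfold findEnds
  rw [wp_seq, wp_setVar, wp_seq, wp_setVar]
  refine wp_forTo (m := N) (by simpa [State.set_apply] using hN) hR (by decide) (by decide)
    (fun j s' => IsEnd N j (s 14 0) (s 8) (s' 15 0) ∧ IsEnd N j (s 14 0) (s 9) (s' 16 0))
    ?_ ?_ ?_ ?_
  · intro j s₁ s₂ h; simp [h]
  · simp [IsEnd, State.set_apply, hN]
  · rintro j hj s₁ hf hj₁ ⟨h1, h2⟩
    have h8 : s₁ 8 = s 8 := by rw [hf 8 (by decide)]; simp [State.set_of_ne]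
    have h9 : s₁ 9 = s 9 := by rw [hf 9 (by decide)]; simp [State.set_of_ne]
    have h14 : s₁ 14 0 = s 14 0 := by rw [hf 14 (by decide)]; simp [State.set_of_ne]
    simp only [wp_seq, wp_ite, val_ge, val_ge_eq_zero, val_get, val_var, hj₁, h8, h14, wp_setVar,
      wp_skip, State.set_apply]
    simp [h9, -not_lt, -not_le]
    exact ⟨fun h3 => ⟨fun h4 => ⟨.inl ⟨hj, h3⟩, .inl ⟨hj, h4⟩⟩,
        fun h4 => ⟨.inl ⟨hj, h3⟩, h2.succ_of_lt h4⟩⟩,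
      fun h3 => ⟨fun h4 => ⟨h1.succ_of_lt h3, .inl ⟨hj, h4⟩⟩,
        fun h4 => ⟨h1.succ_of_lt h3, h2.succ_of_lt h4⟩⟩⟩
  · exact fun s' _ h => h

/-- The invariant for the scale; `k` bounds the number of the remaining steps. -/
def IsScaled (N k : ℕ) (s : State) : Prop :=
  s 14 0 = 0 ∧ ∑ v ∈ Finset.range N, s 8 v = 0 ∨
    ∃ e, s 14 0 = 2 ^ e ∧ (∀ a b, s 14 0 ∣ s.mat 10 a b) ∧
      ∑ v ∈ Finset.range N, s 8 v < 2 * N * 2 ^ e ∧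
      e * (2 * N + 1) + (∑ v ∈ Finset.range N, s 8 v) / 2 ^ e + 1 ≤ k

/-- In the old scale less than `N * 2 ^ e` remains, which is less than `2 * N` units of the new
scale. Lowering `e` by one releases `2 * N + 1` steps, which pays for the halving itself and for
these units. -/
theorem isScaled_halve {N k e : ℕ} {s : State} (h14 : s 14 0 = 2 ^ e)
    (hdvd : ∀ a b, s 14 0 ∣ s.mat 10 a b)
    (hsum : ∑ v ∈ Finset.range N, s 8 v < N * 2 ^ e)
    (hzero : e = 0 → ∑ v ∈ Finset.range N, s 8 v = 0)
    (hk : e * (2 * N + 1) + (∑ v ∈ Finset.range N, s 8 v) / 2 ^ e + 1 ≤ k) :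
    IsScaled N (k - 1) (s.set 14 0 (s 14 0 / 2)) := by
  unfold IsScaled
  rw [State.set_of_ne s 0 _ (by decide : (8 : ℕ) ≠ 14),
    mat_set_of_ne s _ _ _ _ (by decide : (10 : ℕ) ≠ 14)]
  simp only [State.set_same, Function.update_self]
  rcases e with _ | e
  -- The last halving takes the scale from `1` to `0`, and this ends the main loop with nothing left
  -- to send.
  · exact .inl ⟨by rw [h14]; rfl, hzero rfl⟩
  · have h2 : s 14 0 / 2 = 2 ^ e := by rw [h14, pow_succ]; omega
    refine .inr ⟨e, h2, fun a b => Dvd.dvd.trans ?_ (hdvd a b), ?_, ?_⟩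
    · rw [h2, h14]; exact pow_dvd_pow _ e.le_succ
    · rw [pow_succ] at hsum; linarith
    · have h3 : (∑ v ∈ Finset.range N, s 8 v) / 2 ^ e < 2 * N := by
        rw [Nat.div_lt_iff_lt_mul (by positivity)]
        rw [pow_succ] at hsum; linarith
      have : (e + 1) * (2 * N + 1) = e * (2 * N + 1) + 2 * N + 1 := by ring
      generalize (∑ v ∈ Finset.range N, s 8 v) / 2 ^ (e + 1) = y at *
      rw [this] at hk
      generalize e * (2 * N + 1) = z at *
      omega

/-- An augmentation removes exactly one unit of size `2 ^ e` from the remaining supply, so the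
quotient in `IsScaled` drops by one; a halving is accounted for by `isScaled_halve`. -/
theorem wp_solveStep {R N k : ℕ} {s : State} {P Q : ℕ → ℕ} (hN : s 3 0 = N) (hN0 : 0 < N)
    (hR : N < R) (h : IsFlowState N P Q s) (hs : IsScaled N k s) (h14 : s 14 0 ≠ 0) :
    wp R solveStep (fun s' => ∃ k' < k, IsFlowState N P Q s' ∧ IsScaled N k' s') s := by
  unfold solveStep
  obtain ⟨e, he, hdvd, hsum, hk⟩ := hs.resolve_left fun h' => h14 h'.1
  refine wp_seq_frame (wp_findEnds hN hR) fun s₁ f₁ ⟨h15, h16⟩ => ?_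
  have m7 : s₁.mat 7 = s.mat 7 := mat_congr (f₁ 7 (by decide))
  have m10 : s₁.mat 10 = s.mat 10 := mat_congr (f₁ 10 (by decide))
  have e3 := f₁ 3 (by decide)
  have e8 := f₁ 8 (by decide)
  have e9 := f₁ 9 (by decide)
  have e11 := f₁ 11 (by decide)
  have e14 := f₁ 14 (by decide)
  have hI : IsFlowState N P Q s₁ := by
    refine ⟨?_, ?_, ?_⟩
    · rw [m7, m10, e11]; exact h.opt
    · rw [m10, e8, e9]; exact h.balanced
    · rw [e8, e9]; exact h.sum_eq
  rw [wp_ite]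
  simp only [val_mul, val_sub, val_var, mul_eq_zero, e3, hN, ne_eq, not_or]
  constructor
  · rintro ⟨h1, h2⟩
    have h1 := h15.resolve_right (by omega)
    have h2 := h16.resolve_right (by omega)
    refine wp_mono (wp_augment ((congrFun e3 0).trans hN) hR hI (by rwa [e14, m10]) h1.1 h2.1
      (by rw [e14, e8]; exact h1.2) (by rw [e14, e9]; exact h2.2) |> wp_frame) ?_
    rintro s₂ ⟨⟨hI₂, hd₂, hs₂⟩, f₂⟩
    rw [e14, he, e8] at hs₂
    have hdiv : (∑ v ∈ Finset.range N, s 8 v) / 2 ^ e =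
        (∑ v ∈ Finset.range N, s₂ 8 v) / 2 ^ e + 1 := by
      rw [← hs₂, Nat.add_div_right _ (by positivity)]
    have g14 : s₂ 14 0 = s₁ 14 0 := by rw [f₂ 14 (by decide)]
    rw [hdiv] at hk
    refine ⟨k - 1, Nat.sub_lt ((Nat.le_add_left _ _).trans hk) one_pos, hI₂,
      .inr ⟨e, ?_, ?_, by omega, Nat.le_sub_one_of_lt hk⟩⟩
    · rw [g14, e14, he]
    · rw [g14]; exact hd₂
  · intro h0
    rw [wp_setVar]
    simp only [val_div, val_var, val_const]
    have hlt : ∀ f : ℕ → ℕ, (∀ v < N, f v < 2 ^ e) → ∑ v ∈ Finset.range N, f v < N * 2 ^ e ∧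
        (e = 0 → ∑ v ∈ Finset.range N, f v = 0) := by
      intro f hf
      constructor
      · calc ∑ v ∈ Finset.range N, f v < ∑ v ∈ Finset.range N, 2 ^ e :=
              Finset.sum_lt_sum_of_nonempty (by simpa using hN0.ne')
                fun v hv => hf v (Finset.mem_range.1 hv)
          _ = N * 2 ^ e := by simp
      · rintro rfl
        exact Finset.sum_eq_zero fun v hv => by have := hf v (Finset.mem_range.1 hv); omega
    -- Only one side, supplies or demands, is known to have no node with `2 ^ e` units left;
    -- equality of the two totals transfers the bound to the supplies.
    have key : ∑ v ∈ Finset.range N, s₁ 8 v < N * 2 ^ e ∧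
        (e = 0 → ∑ v ∈ Finset.range N, s₁ 8 v = 0) := by
      rw [he] at h15 h16
      rcases h0 with h0 | h0
      · rw [e8]
        exact hlt _ (h15.resolve_left (by omega)).2
      · rw [e8, h.sum_eq]
        exact hlt _ (h16.resolve_left (by omega)).2
    refine ⟨k - 1, Nat.sub_lt ((Nat.le_add_left _ _).trans hk) one_pos, ⟨?_, ?_, ?_⟩, isScaled_halve (e := e) ?_ ?_ key.1 key.2 ?_⟩
    · simpa [State.set_of_ne, mat_set_of_ne] using hI.opt
    · simpa [State.set_of_ne, mat_set_of_ne] using hI.balanced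
    · simpa [State.set_of_ne, mat_set_of_ne] using hI.sum_eq
    · rw [e14, he]
    · rw [e14, m10]; exact hdvd
    · rw [e8]; exact hk

/-- The scaling algorithm computes an optimal flow. -/
theorem wp_solve {R N e : ℕ} {s : State} {P Q : ℕ → ℕ} (hN : s 3 0 = N) (hN0 : 0 < N)
    (hR : N < R) (h : IsFlowState N P Q s) (h14 : s 14 0 = 2 ^ e)
    (hdvd : ∀ a b, s 14 0 ∣ s.mat 10 a b) (hsum : ∑ v ∈ Finset.range N, s 8 v < 2 ^ e)
    (hRe : e * (2 * N + 1) + 1 < R) :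
    wp R solve (fun s' => ∃ π, Opt N (s.mat 7) (s'.mat 10) π ∧
      Balanced N (s'.mat 10) P Q (fun _ => 0) (fun _ => 0)) s := by
  -- The initial scale exceeds the total supply, so the quotient in `IsScaled` starts at zero.
  refine wp_loop (k := e * (2 * N + 1) + 1) (fun k s' => IsFlowState N P Q s' ∧ IsScaled N k s')
    hRe ⟨h, .inr ⟨e, h14, hdvd, hsum.trans_le ?_, ?_⟩⟩ ?_
  · exact Nat.le_mul_of_pos_left _ (by omega)
  · rw [Nat.div_eq_of_lt hsum]
  · rintro k s₁ f₁ ⟨hI, hs⟩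
    refine ⟨fun h0 => ?_, fun h0 => wp_solveStep ((congrFun (f₁ 3 (by decide)) 0).trans hN) hN0 hR
      hI hs h0⟩
    rw [val_var] at h0
    refine ⟨s₁ 11, ?_, ?_⟩
    · rw [← mat_congr (f₁ 7 (by decide))]; exact hI.opt
    · have hp : ∑ v ∈ Finset.range N, s₁ 8 v = 0 := by
        rcases hs with hs | ⟨e, he, _⟩
        · exact hs.2
        · rw [h0] at he; exact absurd he (by positivity)
      have hq := hI.sum_eq.symm.trans hp
      rw [Finset.sum_eq_zero_iff] at hp hq
      intro w hw
      have := hI.balanced w hw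
      rw [hp w (by simpa using hw), hq w (by simpa using hw)] at this
      exact this

end RAM

/-! ### Reduction to transshipment -/

namespace MCFOInstance

open Transship

variable (I : MCFOInstance)

/-- The demand of the vertex with number `k`. -/
def dem (k : ℕ) : ℕ := if h : k < I.n then (if ⟨k, h⟩ ∈ I.C then I.demand ⟨k, h⟩ else 0) else 0

/-- The supply of the vertex with number `k`. -/
def sup (k : ℕ) : ℕ := if h : k < I.n then (if ⟨k, h⟩ ∈ I.F then I.supply ⟨k, h⟩ else 0) else 0

/-- The total demand. -/
def totalDemand : ℕ := ∑ k ∈ Finset.range I.n, I.dem k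

/-- The total supply. -/
def totalSupply : ℕ := ∑ k ∈ Finset.range I.n, I.sup k

/-- The pairs of nodes that may be joined by an arc.  The nodes are the vertices, a copy `n + v` and
a copy `2 * n + v` of each vertex `v` for demand and supply, a node `3 * n` that absorbs the
outliers, and a node `3 * n + 1` from which the unused supply comes. -/
def IsArcShape (n u v : ℕ) : Prop :=
  u < n ∧ v < n ∨ n ≤ u ∧ u < 2 * n ∧ (v + n = u ∨ v = 3 * n) ∨ u < n ∧ v = 2 * n + u ∨
    u = 3 * n + 1 ∧ 2 * n ≤ v ∧ v ≤ 3 * n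

/-- The arcs of the network. -/
def IsArc (u v : ℕ) : Prop :=
  IsArcShape I.n u v ∧ ∀ (hu : u < I.n) (hv : v < I.n), (⟨u, hu⟩, ⟨v, hv⟩) ∈ I.E

/-- The supplies in the network. -/
def netSupply (w : ℕ) : ℕ :=
  if I.n ≤ w ∧ w < 2 * I.n then I.dem (w - I.n)
  else if w = 3 * I.n + 1 then I.totalSupply + I.m - I.totalDemand else 0

/-- The demands in the network. -/
def netDemand (w : ℕ) : ℕ :=
  if 2 * I.n ≤ w ∧ w < 3 * I.n then I.sup (w - 2 * I.n) else if w = 3 * I.n then I.m else 0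

/-- `c` are the costs in the network, multiplied by `D`; pairs that are not arcs are expensive. -/
structure IsNetCost (D H : ℕ) (c : ℕ → ℕ → ℕ) : Prop where
  pos : 0 < D
  edge : ∀ i j : Fin I.n, (i, j) ∈ I.E → c i j * (I.cost (i, j)).den = (I.cost (i, j)).num * D
  zero : ∀ u v, IsArcShape I.n u v → ¬ (u < I.n ∧ v < I.n) → c u v = 0
  le : ∀ u v, I.IsArc u v → c u v ≤ H
  far : ∀ u < 3 * I.n + 2, ∀ v < 3 * I.n + 2, ¬ I.IsArc u v → c u v = (3 * I.n + 2) * H + 1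

/-! ### Flow into and out of each kind of node. -/

section Sums

variable {α : Type*} [AddCommMonoid α] {n : ℕ} {z : ℕ → ℕ → α}

theorem sum_nodes (n : ℕ) (f : ℕ → α) : ∑ u ∈ Finset.range (3 * n + 2), f u =
    ∑ i ∈ Finset.range n, f i + ∑ i ∈ Finset.range n, f (n + i) +
      ∑ i ∈ Finset.range n, f (2 * n + i) + f (3 * n) + f (3 * n + 1) := by
  rw [Finset.sum_range_succ, Finset.sum_range_succ, show 3 * n = n + n + n by ring,
    Finset.sum_range_add, Finset.sum_range_add, two_mul]

variable (hz : ∀ u < 3 * n + 2, ∀ v < 3 * n + 2, ¬ IsArcShape n u v → z u v = 0)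

include hz

theorem sum_in_vertex {i : ℕ} (hi : i < n) :
    ∑ u ∈ Finset.range (3 * n + 2), z u i = ∑ j ∈ Finset.range n, z j i + z (n + i) i := by
  rw [sum_nodes, Finset.sum_eq_single_of_mem (f := fun k => z (n + k) i) i (by simpa using hi),
    Finset.sum_eq_zero (f := fun k => z (2 * n + k) i), hz (3 * n), hz (3 * n + 1)]
  · simp
  any_goals (first | omega | (unfold IsArcShape; omega))
  · intro k hk
    have := Finset.mem_range.1 hk
    exact hz _ (by omega) _ (by omega) (by unfold IsArcShape; omega)
  · intro k hk hki
    have := Finset.mem_range.1 hk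
    exact hz _ (by omega) _ (by omega) (by unfold IsArcShape; omega)

theorem sum_out_vertex {i : ℕ} (hi : i < n) :
    ∑ u ∈ Finset.range (3 * n + 2), z i u = ∑ j ∈ Finset.range n, z i j + z i (2 * n + i) := by
  rw [sum_nodes, Finset.sum_eq_single_of_mem (f := fun k => z i (2 * n + k)) i (by simpa using hi),
    Finset.sum_eq_zero (f := fun k => z i (n + k)), hz _ _ (3 * n), hz _ _ (3 * n + 1)]
  · simp
  any_goals (first | omega | (unfold IsArcShape; omega))
  · intro k hk
    have := Finset.mem_range.1 hk
    exact hz _ (by omega) _ (by omega) (by unfold IsArcShape; omega)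
  · intro k hk hki
    have := Finset.mem_range.1 hk
    exact hz _ (by omega) _ (by omega) (by unfold IsArcShape; omega)

theorem sum_in_demand {i : ℕ} (hi : i < n) :
    ∑ u ∈ Finset.range (3 * n + 2), z u (n + i) = 0 := by
  refine Finset.sum_eq_zero fun u hu => ?_
  have := Finset.mem_range.1 hu
  exact hz _ (by omega) _ (by omega) (by unfold IsArcShape; omega)

theorem sum_out_demand {i : ℕ} (hi : i < n) :
    ∑ u ∈ Finset.range (3 * n + 2), z (n + i) u = z (n + i) i + z (n + i) (3 * n) := by
  rw [sum_nodes, Finset.sum_eq_single_of_mem (f := fun k => z (n + i) k) i (by simpa using hi),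
    Finset.sum_eq_zero (f := fun k => z (n + i) (n + k)),
    Finset.sum_eq_zero (f := fun k => z (n + i) (2 * n + k)), hz _ _ (3 * n + 1)]
  · simp
  any_goals (first | omega | (unfold IsArcShape; omega))
  all_goals
    intro k hk
    intros
    have := Finset.mem_range.1 hk
    exact hz _ (by omega) _ (by omega) (by unfold IsArcShape; omega)

theorem sum_in_supply {i : ℕ} (hi : i < n) :
    ∑ u ∈ Finset.range (3 * n + 2), z u (2 * n + i) =
      z i (2 * n + i) + z (3 * n + 1) (2 * n + i) := by
  rw [sum_nodes, Finset.sum_eq_single_of_mem (f := fun k => z k (2 * n + i)) i (by simpa using hi),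
    Finset.sum_eq_zero (f := fun k => z (n + k) (2 * n + i)),
    Finset.sum_eq_zero (f := fun k => z (2 * n + k) (2 * n + i)), hz (3 * n)]
  · simp
  any_goals (first | omega | (unfold IsArcShape; omega))
  all_goals
    intro k hk
    intros
    have := Finset.mem_range.1 hk
    exact hz _ (by omega) _ (by omega) (by unfold IsArcShape; omega)

theorem sum_out_supply {i : ℕ} (hi : i ≤ n) :
    ∑ u ∈ Finset.range (3 * n + 2), z (2 * n + i) u = 0 := by
  refine Finset.sum_eq_zero fun u hu => ?_
  have := Finset.mem_range.1 hu
  exact hz _ (by omega) _ (by omega) (by unfold IsArcShape; omega)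

theorem sum_in_outliers : ∑ u ∈ Finset.range (3 * n + 2), z u (3 * n) =
    ∑ i ∈ Finset.range n, z (n + i) (3 * n) + z (3 * n + 1) (3 * n) := by
  rw [sum_nodes, Finset.sum_eq_zero (f := fun k => z k (3 * n)),
    Finset.sum_eq_zero (f := fun k => z (2 * n + k) (3 * n)), hz (3 * n)]
  · simp
  any_goals (first | omega | (unfold IsArcShape; omega))
  all_goals
    intro k hk
    have := Finset.mem_range.1 hk
    exact hz _ (by omega) _ (by omega) (by unfold IsArcShape; omega)

theorem sum_in_unused : ∑ u ∈ Finset.range (3 * n + 2), z u (3 * n + 1) = 0 := by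
  refine Finset.sum_eq_zero fun u hu => ?_
  have := Finset.mem_range.1 hu
  exact hz _ (by omega) _ (by omega) (by unfold IsArcShape; omega)

theorem sum_out_unused : ∑ u ∈ Finset.range (3 * n + 2), z (3 * n + 1) u =
    ∑ i ∈ Finset.range n, z (3 * n + 1) (2 * n + i) + z (3 * n + 1) (3 * n) := by
  rw [sum_nodes, Finset.sum_eq_zero (f := fun k => z (3 * n + 1) k),
    Finset.sum_eq_zero (f := fun k => z (3 * n + 1) (n + k)), hz _ _ (3 * n + 1)]
  · simp
  any_goals (first | omega | (unfold IsArcShape; omega))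
  all_goals
    intro k hk
    have := Finset.mem_range.1 hk
    exact hz _ (by omega) _ (by omega) (by unfold IsArcShape; omega)

end Sums

variable {I} {T : MCFOFlow I.n ℝ}

theorem dem_coe (i : Fin I.n) : I.dem i = if i ∈ I.C then I.demand i else 0 := by simp [dem]

theorem sup_coe (i : Fin I.n) : I.sup i = if i ∈ I.F then I.supply i else 0 := by simp [sup]

theorem totalDemand_eq : I.totalDemand = ∑ i : Fin I.n, I.dem i :=
  (Fin.sum_univ_eq_sum_range _ _).symm

theorem totalSupply_eq : I.totalSupply = ∑ i : Fin I.n, I.sup i :=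
  (Fin.sum_univ_eq_sum_range _ _).symm

theorem totalDemand_eq_sum_C : (I.totalDemand : ℝ) = ∑ v ∈ I.C, (I.demand v : ℝ) := by
  rw [totalDemand_eq, Nat.cast_sum, ← Finset.sum_subset (Finset.subset_univ I.C)]
  · exact Finset.sum_congr rfl fun i hi => by rw [dem_coe, if_pos hi]
  · intro i _ hi; simp [dem_coe, hi]

theorem IsFeasible.served_le_dem (h : I.IsFeasible T) (i : Fin I.n) : T.served i ≤ I.dem i := by
  rw [dem_coe]
  split_ifs with hi
  · exact h.served_le i hi
  · simp [h.served_off i hi]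

theorem IsFeasible.received_le_sup (h : I.IsFeasible T) (i : Fin I.n) :
    T.received i ≤ I.sup i := by
  rw [sup_coe]
  split_ifs with hi
  · exact h.received_le i hi
  · simp [h.received_off i hi]

theorem IsFeasible.sum_served_eq (h : I.IsFeasible T) :
    ∑ i, T.served i = ∑ i, T.received i := by
  have := Finset.sum_congr (rfl : (Finset.univ : Finset (Fin I.n)) = _) fun v _ => h.conservation v
  rw [Finset.sum_add_distrib, Finset.sum_add_distrib, Finset.sum_comm] at this
  exact add_left_cancel this

theorem IsFeasible.le_sum_served (h : I.IsFeasible T) :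
    (I.totalDemand : ℝ) ≤ I.m + ∑ i, T.served i := by
  have h1 := h.outliers
  rw [← totalDemand_eq_sum_C, Finset.sum_subset (Finset.subset_univ I.C)
    (fun i _ hi => h.served_off i hi)] at h1
  linarith

/-- All demand is an outlier or is received by a facility. This makes the truncated subtraction in
`netSupply` exact, and the program tests this inequality before it builds the flow problem. -/
theorem IsFeasible.totalDemand_le (h : I.IsFeasible T) :
    I.totalDemand ≤ I.totalSupply + I.m := by
  have h1 := h.le_sum_served
  rw [h.sum_served_eq] at h1
  have h2 : ∑ i, T.received i ≤ I.totalSupply := by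
    rw [totalSupply_eq, Nat.cast_sum]
    exact Finset.sum_le_sum fun i _ => h.received_le_sup i
  have : (I.totalDemand : ℝ) ≤ I.totalSupply + I.m := by linarith
  exact_mod_cast this

/-- The scaled cost of a solution is the cost of the corresponding flow in the network. -/
theorem IsNetCost.sum_cost {D H : ℕ} {c : ℕ → ℕ → ℕ} (hc : I.IsNetCost D H c) {z : ℕ → ℕ → ℝ}
    (hz : ∀ u < 3 * I.n + 2, ∀ v < 3 * I.n + 2, ¬ I.IsArc u v → z u v = 0)
    (hT : ∀ i j : Fin I.n, T.flow (i, j) = z i j) :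
    ∑ u ∈ Finset.range (3 * I.n + 2), ∑ v ∈ Finset.range (3 * I.n + 2), (c u v : ℝ) * z u v =
      D * I.totalCost T := by
  have h0 : ∀ u < 3 * I.n + 2, ∀ v < 3 * I.n + 2, ¬ (u < I.n ∧ v < I.n) →
      (c u v : ℝ) * z u v = 0 := by
    intro u hu v hv h
    by_cases hs : IsArcShape I.n u v
    · simp [hc.zero u v hs h]
    · rw [hz u hu v hv fun h' => hs h'.1, mul_zero]
  have hsub : Finset.range I.n ⊆ Finset.range (3 * I.n + 2) :=
    Finset.range_subset_range.2 (by omega)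
  rw [← Finset.sum_subset hsub]
  · rw [totalCost, Finset.mul_sum, Finset.sum_subset (Finset.subset_univ I.E), Fintype.sum_prod_type,
      ← Fin.sum_univ_eq_sum_range
        (fun u => ∑ v ∈ Finset.range (3 * I.n + 2), (c u v : ℝ) * z u v)]
    · refine Finset.sum_congr rfl fun i _ => ?_
      rw [← Finset.sum_subset hsub, ← Fin.sum_univ_eq_sum_range (fun v => (c i v : ℝ) * z i v)]
      · refine Finset.sum_congr rfl fun j _ => ?_
        rw [hT]
        by_cases hE : (i, j) ∈ I.E
        · have h1 := hc.edge i j hE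
          have h2 : (c i j : ℝ) = D * (I.cost (i, j) : ℝ) := by
            have h3 : (I.cost (i, j) : ℝ) = (I.cost (i, j)).num / (I.cost (i, j)).den := by
              rw [NNRat.cast_def]
            have h4 : ((I.cost (i, j)).den : ℝ) ≠ 0 := by
              exact_mod_cast (I.cost (i, j)).den_ne_zero
            have h5 : (c i j : ℝ) * (I.cost (i, j)).den = (I.cost (i, j)).num * D := by
              exact_mod_cast h1
            rw [h3]
            field_simp
            linarith
          rw [h2]; ring
        · have : ¬ I.IsArc i j := fun h => hE (h.2 i.2 j.2)
          rw [hz i (by omega) j (by omega) this]; simp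
      · intro v hv hv'
        exact h0 _ (by omega) _ (by simpa using hv) (by simp at hv'; omega)
    · rintro ⟨i, j⟩ _ hE
      have : ¬ I.IsArc i j := fun h => hE (h.2 i.2 j.2)
      rw [hT, hz i (by omega) j (by omega) this]; simp
  · intro u hu hu'
    refine Finset.sum_eq_zero fun v hv => ?_
    exact h0 _ (by simpa using hu) _ (by simpa using hv) (by simp at hu'; omega)

/-- The flow in the network that corresponds to a solution. -/
noncomputable def netFlow (T : MCFOFlow I.n ℝ) (u v : ℕ) : ℝ :=
  if h : u < I.n ∧ v < I.n then T.flow (⟨u, h.1⟩, ⟨v, h.2⟩)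
  else if h : v < I.n ∧ u = I.n + v then T.served ⟨v, h.1⟩
  else if h : (I.n ≤ u ∧ u - I.n < I.n) ∧ v = 3 * I.n then
    I.dem (u - I.n) - T.served ⟨u - I.n, h.1.2⟩
  else if h : u < I.n ∧ v = 2 * I.n + u then T.received ⟨u, h.1⟩
  else if h : u = 3 * I.n + 1 ∧ 2 * I.n ≤ v ∧ v - 2 * I.n < I.n then
    I.sup (v - 2 * I.n) - T.received ⟨v - 2 * I.n, h.2.2⟩
  else if u = 3 * I.n + 1 ∧ v = 3 * I.n then I.m + ∑ i, T.served i - I.totalDemand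
  else 0

/-! ### From solutions to flows in the network. -/

section NetFlow

theorem netFlow_edge (i j : Fin I.n) : netFlow T i j = T.flow (i, j) := by
  simp [netFlow]

theorem netFlow_served (i : Fin I.n) : netFlow T (I.n + i) i = T.served i := by
  simp [netFlow]

theorem netFlow_outlier (i : Fin I.n) :
    netFlow T (I.n + i) (3 * I.n) = I.dem i - T.served i := by
  have h1 : ¬ 3 * I.n < I.n := by omega
  simp [netFlow, h1]

theorem netFlow_received (i : Fin I.n) : netFlow T i (2 * I.n + i) = T.received i := by
  have h1 : ¬ 2 * I.n + i < I.n := by omega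
  have h2 : ¬ I.n ≤ i := by omega
  simp [netFlow, h1, h2]

theorem netFlow_unused (i : Fin I.n) :
    netFlow T (3 * I.n + 1) (2 * I.n + i) = I.sup i - T.received i := by
  have h1 : ¬ 2 * I.n + i < I.n := by omega
  have h2 : 2 * I.n + (i : ℕ) ≠ 3 * I.n := by omega
  have h3 : ¬ 3 * I.n + 1 < I.n := by omega
  simp [netFlow, h1, h2, h3]

theorem netFlow_rest :
    netFlow T (3 * I.n + 1) (3 * I.n) = I.m + ∑ i, T.served i - I.totalDemand := by
  have h1 : ¬ 3 * I.n < I.n := by omega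
  have h2 : ¬ 3 * I.n + 1 - I.n < I.n := by omega
  have h3 : ¬ 3 * I.n - 2 * I.n < I.n := by omega
  have h4 : ¬ 3 * I.n + 1 < I.n := by omega
  simp [netFlow, h1, h2, h3, h4]

theorem netFlow_nonneg (h : I.IsFeasible T) (u v : ℕ) : 0 ≤ netFlow T u v := by
  unfold netFlow
  split_ifs with h1 h2 h3 h4 h5
  · exact h.flow_nonneg _
  · exact h.served_nonneg _
  · exact sub_nonneg.2 (h.served_le_dem ⟨u - I.n, h3.1.2⟩)
  · exact h.received_nonneg _
  · exact sub_nonneg.2 (h.received_le_sup ⟨v - 2 * I.n, h5.2.2⟩)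
  · exact sub_nonneg.2 h.le_sum_served
  · exact le_rfl

theorem netFlow_eq_zero (h : I.IsFeasible T) (u v : ℕ) (huv : ¬ I.IsArc u v) :
    netFlow T u v = 0 := by
  unfold netFlow
  split_ifs with h1 h2 h3 h4 h5 h6
  · refine h.flow_off _ fun hE => huv ⟨.inl h1, fun _ _ => hE⟩
  all_goals
    first
    | rfl
    | refine absurd ⟨?_, fun hu hv => absurd ⟨hu, hv⟩ h1⟩ huv
      unfold IsArcShape
      omega

/-- Every node is a vertex, a copy of a vertex, or one of the two additional nodes. -/
theorem node_cases {motive : ℕ → Prop} (h1 : ∀ i : Fin I.n, motive i)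
    (h2 : ∀ i : Fin I.n, motive (I.n + i)) (h3 : ∀ i : Fin I.n, motive (2 * I.n + i))
    (h4 : motive (3 * I.n)) (h5 : motive (3 * I.n + 1)) : ∀ w < 3 * I.n + 2, motive w := by
  intro w hw
  by_cases c1 : w < I.n
  · exact h1 ⟨w, c1⟩
  by_cases c2 : w < 2 * I.n
  · have := h2 ⟨w - I.n, by omega⟩
    rwa [show I.n + (w - I.n) = w by omega] at this
  by_cases c3 : w < 3 * I.n
  · have := h3 ⟨w - 2 * I.n, by omega⟩
    rwa [show 2 * I.n + (w - 2 * I.n) = w by omega] at this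
  by_cases c4 : w = 3 * I.n
  · rwa [c4]
  · rwa [show w = 3 * I.n + 1 by omega]

theorem netSupply_vertex (i : Fin I.n) : I.netSupply i = 0 := by
  rw [netSupply, if_neg (by omega), if_neg (by omega)]

theorem netSupply_demand (i : Fin I.n) : I.netSupply (I.n + i) = I.dem i := by
  rw [netSupply, if_pos (by omega), Nat.add_sub_cancel_left]

theorem netSupply_supply {k : ℕ} (hk : k ≤ I.n) : I.netSupply (2 * I.n + k) = 0 := by
  rw [netSupply, if_neg (by omega), if_neg (by omega)]

theorem netSupply_unused :
    I.netSupply (3 * I.n + 1) = I.totalSupply + I.m - I.totalDemand := by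
  rw [netSupply, if_neg (by omega), if_pos rfl]

theorem netDemand_vertex (i : Fin I.n) : I.netDemand i = 0 := by
  rw [netDemand, if_neg (by omega), if_neg (by omega)]

theorem netDemand_demand (i : Fin I.n) : I.netDemand (I.n + i) = 0 := by
  rw [netDemand, if_neg (by omega), if_neg (by omega)]

theorem netDemand_supply (i : Fin I.n) : I.netDemand (2 * I.n + i) = I.sup i := by
  rw [netDemand, if_pos (by omega), Nat.add_sub_cancel_left]

theorem netDemand_outliers : I.netDemand (3 * I.n) = I.m := by
  rw [netDemand, if_neg (by omega), if_pos rfl]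

theorem netDemand_unused : I.netDemand (3 * I.n + 1) = 0 := by
  rw [netDemand, if_neg (by omega), if_neg (by omega)]

/-- At vertices this is the conservation law, and at the copies it holds by the choice of the slack
flows. At `3 * n` the outliers and the flow from `3 * n + 1` add up to `m`; at `3 * n + 1` it
amounts to the equality of the total amounts served and received. -/
theorem netFlow_balanced (h : I.IsFeasible T) : ∀ w < 3 * I.n + 2,
    ∑ u ∈ Finset.range (3 * I.n + 2), netFlow T u w + I.netSupply w =
      ∑ u ∈ Finset.range (3 * I.n + 2), netFlow T w u + I.netDemand w := by
  have hz : ∀ u < 3 * I.n + 2, ∀ v < 3 * I.n + 2, ¬ IsArcShape I.n u v → netFlow T u v = 0 :=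
    fun u _ v _ hs => netFlow_eq_zero h u v fun h' => hs h'.1
  refine node_cases (fun i => ?_) (fun i => ?_) (fun i => ?_) ?_ ?_
  · rw [sum_in_vertex hz i.2, sum_out_vertex hz i.2, netFlow_served, netFlow_received,
      netSupply_vertex, netDemand_vertex,
      ← Fin.sum_univ_eq_sum_range (fun j => netFlow T j i),
      ← Fin.sum_univ_eq_sum_range (fun j => netFlow T i j)]
    simp only [netFlow_edge, Nat.cast_zero, add_zero]
    exact h.conservation i
  · rw [sum_in_demand hz i.2, sum_out_demand hz i.2, netFlow_served, netFlow_outlier,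
      netSupply_demand, netDemand_demand]
    simp
  · rw [sum_in_supply hz i.2, sum_out_supply hz i.2.le, netFlow_received, netFlow_unused,
      netSupply_supply i.2.le, netDemand_supply]
    simp
  · have h2 := sum_out_supply hz le_rfl
    rw [show 2 * I.n + I.n = 3 * I.n by ring] at h2
    have h3 := I.netSupply_supply le_rfl
    rw [show 2 * I.n + I.n = 3 * I.n by ring] at h3
    rw [sum_in_outliers hz, h2, h3, netDemand_outliers, netFlow_rest,
      ← Fin.sum_univ_eq_sum_range (fun j => netFlow T (I.n + j) (3 * I.n))]
    simp only [netFlow_outlier, Finset.sum_sub_distrib, totalDemand_eq, Nat.cast_sum]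
    simp
  · rw [sum_in_unused hz, sum_out_unused hz, netDemand_unused, netSupply_unused, netFlow_rest,
      ← Fin.sum_univ_eq_sum_range (fun j => netFlow T (3 * I.n + 1) (2 * I.n + j)),
      Nat.cast_sub h.totalDemand_le]
    simp only [netFlow_unused, Finset.sum_sub_distrib, totalSupply_eq,
      h.sum_served_eq]
    push_cast
    ring

end NetFlow

/-- The solution that corresponds to a flow in the network. -/
def solutionOf (I : MCFOInstance) (x : ℕ → ℕ → ℕ) : MCFOFlow I.n ℕ where
  flow e := x e.1 e.2
  served v := x (I.n + v) v
  received v := x v (2 * I.n + v)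

variable {D H : ℕ} {c x : ℕ → ℕ → ℕ} {π : ℕ → ℕ}

/-- The capacities come back from the copies: a demand copy has no inflow and divides its supply
between service and outliers, and a supply copy has no outflow, so what it gets from its vertex is
at most its demand. The inflow of `3 * n` is `m`, which bounds the outliers. -/
theorem isFeasible_solutionOf
    (hx : Balanced (3 * I.n + 2) x I.netSupply I.netDemand (fun _ => 0) (fun _ => 0))
    (hz : ∀ u < 3 * I.n + 2, ∀ v < 3 * I.n + 2, ¬ I.IsArc u v → x u v = 0) :
    I.IsFeasible (I.solutionOf x).toReal := by
  have hz' : ∀ u < 3 * I.n + 2, ∀ v < 3 * I.n + 2, ¬ IsArcShape I.n u v → x u v = 0 :=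
    fun u hu v hv hs => hz u hu v hv fun h' => hs h'.1
  have hdem : ∀ i : Fin I.n, x (I.n + i) i + x (I.n + i) (3 * I.n) = I.dem i := by
    intro i
    have := hx (I.n + i) (by omega)
    rw [sum_in_demand hz' i.2, sum_out_demand hz' i.2, netSupply_demand, netDemand_demand] at this
    omega
  have hsup : ∀ i : Fin I.n, x i (2 * I.n + i) ≤ I.sup i := by
    intro i
    have := hx (2 * I.n + i) (by omega)
    rw [sum_in_supply hz' i.2, sum_out_supply hz' i.2.le, netSupply_supply i.2.le,
      netDemand_supply] at this
    omega
  refine ⟨fun e => Nat.cast_nonneg _, ?_, fun v => Nat.cast_nonneg _, ?_, ?_,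
    fun v => Nat.cast_nonneg _, ?_, ?_, ?_, ?_⟩
  · rintro ⟨i, j⟩ hE
    simp only [MCFOFlow.toReal, solutionOf, Nat.cast_eq_zero]
    exact hz i (by omega) j (by omega) fun h => hE (h.2 i.2 j.2)
  · intro i hi
    have h1 := hdem i
    rw [dem_coe, if_pos hi] at h1
    simp only [MCFOFlow.toReal, solutionOf, Nat.cast_le]
    omega
  · intro i hi
    have h1 := hdem i
    rw [dem_coe, if_neg hi] at h1
    simp only [MCFOFlow.toReal, solutionOf, Nat.cast_eq_zero]
    omega
  · intro i hi
    have h1 := hsup i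
    rw [sup_coe, if_pos hi] at h1
    simpa only [MCFOFlow.toReal, solutionOf, Nat.cast_le] using h1
  · intro i hi
    have h1 := hsup i
    rw [sup_coe, if_neg hi] at h1
    simp only [MCFOFlow.toReal, solutionOf, Nat.cast_eq_zero]
    omega
  · intro i
    have := hx i (by omega)
    rw [sum_in_vertex hz' i.2, sum_out_vertex hz' i.2, netSupply_vertex, netDemand_vertex,
      ← Fin.sum_univ_eq_sum_range (fun j => x j i),
      ← Fin.sum_univ_eq_sum_range (fun j => x i j)] at this
    simp only [add_zero] at this
    simp only [MCFOFlow.toReal, solutionOf]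
    exact_mod_cast this
  · have h1 := hx (3 * I.n) (by omega)
    have h2 := sum_out_supply hz' le_rfl
    rw [show 2 * I.n + I.n = 3 * I.n by ring] at h2
    have h3 := I.netSupply_supply le_rfl
    rw [show 2 * I.n + I.n = 3 * I.n by ring] at h3
    rw [sum_in_outliers hz', h2, h3, netDemand_outliers,
      ← Fin.sum_univ_eq_sum_range (fun j => x (I.n + j) (3 * I.n))] at h1
    have h4 := Finset.sum_congr (rfl : (Finset.univ : Finset (Fin I.n)) = _) fun i _ => hdem i
    rw [Finset.sum_add_distrib, ← totalDemand_eq] at h4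
    have h5 : ∑ v ∈ I.C, x (I.n + v) v = ∑ v : Fin I.n, x (I.n + v) v := by
      refine Finset.sum_subset (Finset.subset_univ _) fun i _ hi => ?_
      have h1 := hdem i
      rw [dem_coe, if_neg hi] at h1
      omega
    rw [← totalDemand_eq_sum_C, sub_le_iff_le_add]
    simp only [MCFOFlow.toReal, solutionOf]
    rw [← Nat.cast_sum, h5]
    norm_cast
    omega

/-- An optimal flow in the network that uses only arcs yields an optimal solution. -/
theorem isOptimal_solutionOf (hc : I.IsNetCost D H c) (ho : Opt (3 * I.n + 2) c x π)
    (hx : Balanced (3 * I.n + 2) x I.netSupply I.netDemand (fun _ => 0) (fun _ => 0))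
    (hz : ∀ u < 3 * I.n + 2, ∀ v < 3 * I.n + 2, ¬ I.IsArc u v → x u v = 0) :
    I.IsOptimal (I.solutionOf x).toReal := by
  refine ⟨isFeasible_solutionOf hx hz, fun T hT => ?_⟩
  have h1 := ho.sum_le hx (fun u _ v _ => netFlow_nonneg hT u v) (netFlow_balanced hT)
  rw [hc.sum_cost (T := T) (fun u _ v _ huv => netFlow_eq_zero hT u v huv)
    (fun i j => (netFlow_edge i j).symm), hc.sum_cost (T := (I.solutionOf x).toReal)
    (z := fun u v => (x u v : ℝ)) (fun u hu v hv huv => by rw [hz u hu v hv huv, Nat.cast_zero])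
    (fun i j => rfl)] at h1
  exact le_of_mul_le_mul_left h1 (by exact_mod_cast hc.pos)

/-- If an optimal flow in the network uses a pair that is not an arc, there is no solution. -/
theorem not_isFeasible (hc : I.IsNetCost D H c) (ho : Opt (3 * I.n + 2) c x π)
    (hx : Balanced (3 * I.n + 2) x I.netSupply I.netDemand (fun _ => 0) (fun _ => 0))
    {u v : ℕ} (hu : u < 3 * I.n + 2) (hv : v < 3 * I.n + 2) (huv : ¬ I.IsArc u v)
    (h0 : x u v ≠ 0) (T : MCFOFlow I.n ℝ) : ¬ I.IsFeasible T := fun hT =>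
  ho.not_feasible hx (Nat.lt_succ_self _) (fun u _ v _ => hc.le u v) hu hv (hc.far u hu v hv huv)
    h0 (fun u _ v _ => netFlow_nonneg hT u v) (fun u _ v _ huv => netFlow_eq_zero hT u v huv)
    (netFlow_balanced hT)

end MCFOInstance

/-! ### Nested loops and output. -/

namespace RAM

open RAM.Expr RAM.Program

section ForPairs

variable {R m v : ℕ} {c : Program} {Q : State → Prop} {s : State}

/-- `for 17 < v do for 18 < v do c`. -/
def Program.forPairs (v : ℕ) (c : Program) : Program := forTo 17 v (forTo 18 v c)

/-- The rule for two nested `for` loops. -/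
theorem wp_forPairs (hm : s v 0 = m) (hmR : m < R) (hv : (forPairs v c).writes v = false)
    (hc : c.writes 17 = false) (hc' : c.writes 18 = false) (Inv : ℕ → ℕ → State → Prop)
    (hInv : ∀ i j s₁ s₂, (∀ a, a ≠ 17 → a ≠ 18 → s₂ a = s₁ a) → Inv i j s₁ → Inv i j s₂)
    (h0 : Inv 0 0 s) (hrow : ∀ i s, Inv i m s → Inv (i + 1) 0 s)
    (hstep : ∀ i < m, ∀ j < m, ∀ s₁, (∀ a, (forPairs v c).writes a = false → s₁ a = s a) →
      s₁ 17 0 = i → s₁ 18 0 = j → Inv i j s₁ → wp R c (Inv i (j + 1)) s₁)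
    (hend : ∀ s₁, (∀ a, (forPairs v c).writes a = false → s₁ a = s a) → Inv m 0 s₁ → Q s₁) :
    wp R (forPairs v c) Q s := by
  have h17 : (forTo 18 v c).writes 17 = false := by simp [forTo, writes, hc]
  refine wp_forTo hm hmR hv h17 (fun i => Inv i 0) (fun i s₁ s₂ h => hInv i 0 s₁ s₂ fun a ha _ => h a ha)
    h0 ?_ hend
  intro i hi s₁ f₁ hi₁ hI
  have hvi : (forTo 18 v c).writes v = false := by
    simp only [forPairs, forTo, writes, Bool.or_eq_false_iff] at hv ⊢; tauto
  refine wp_forTo ((congrFun (f₁ v hv) 0).trans hm) hmR hvi hc' (fun j => Inv i j)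
    (fun j s₁ s₂ h => hInv i j s₁ s₂ fun a _ ha => h a ha) hI ?_ fun s₂ _ h => hrow i s₂ h
  intro j hj s₂ f₂ hj₂ hJ
  refine hstep i hi j hj s₂ (fun a ha => ?_) ((congrFun (f₂ 17 h17) 0).trans hi₁) hj₂ hJ
  rw [f₂ a _, f₁ a ha]
  simp only [forPairs, forTo, writes, Bool.or_eq_false_iff] at ha ⊢; tauto

end ForPairs

/-- Append the value of `e` to the output. -/
def emit (e : Expr) : Program :=
  .seq (.assign 1 (.add (.get 1 (.const 0)) (.const 1)) e)
    (.assign 1 (.const 0) (.add (.get 1 (.const 0)) (.const 1)))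

theorem wp_emit {R : ℕ} {e : Expr} {s : State} :
    wp R (emit e) (fun s' => output s' = output s ++ [e.val s]) s := by
  simp only [emit, wp_seq, wp_assign, val_add, val_get, val_const]
  have h0 : (s.set 1 (s 1 0 + 1) (e.val s)) 1 0 = s 1 0 := by simp [State.set_apply]
  rw [h0]
  have hlen : ((s.set 1 (s 1 0 + 1) (e.val s)).set 1 0 (s 1 0 + 1)) 1 0 = s 1 0 + 1 := by
    simp [State.set_apply]
  refine List.ext_getElem (by simp [output, hlen]) fun i h1 h2 => ?_
  simp only [output, List.getElem_ofFn, List.getElem_append, List.length_ofFn, State.set_apply]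
  simp only [output, List.length_ofFn, hlen] at h1
  by_cases h : i = s 1 0
  · simp [h]
  · have h' : i < s 1 0 := by omega
    simp [h, h']

end RAM

/-! ### Positions of the data in the encoded input. -/

namespace MCFOInstance

theorem getD_flatMap_finRange {n k : ℕ} (f : Fin n → List ℕ) (hf : ∀ i, (f i).length = k)
    (i : Fin n) {r : ℕ} (hr : r < k) (l : List ℕ) :
    ((List.finRange n).flatMap f ++ l).getD (k * i + r) 0 = (f i).getD r 0 := by
  induction n generalizing l with
  | zero => exact i.elim0
  | succ n ih =>
    rw [List.finRange_succ, List.flatMap_cons, List.flatMap_map, List.append_assoc]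
    refine Fin.cases ?_ (fun i => ?_) i
    · rw [List.getD_append _ _ _ _ (by simp [hf, hr])]; simp
    · rw [List.getD_append_right _ _ _ _ (by simp [hf]; nlinarith), hf]
      rw [← ih (fun i => f i.succ) (fun i => hf _) i l]
      congr 1
      simp only [Fin.val_succ]
      rw [mul_add]; omega

theorem length_flatMap_finRange {n k : ℕ} (f : Fin n → List ℕ) (hf : ∀ i, (f i).length = k) :
    ((List.finRange n).flatMap f).length = k * n := by
  simp [List.length_flatMap, hf, mul_comm]

variable (I : MCFOInstance)

/-- The initial contents of the cells of the input array. -/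
def input (k : ℕ) : ℕ := RAM.initial I.encode 0 k

theorem input_succ (k : ℕ) : I.input (k + 1) = I.encode.getD k 0 := by
  simp [input, RAM.initial]

theorem input_one : I.input 1 = I.n := by
  rw [input_succ]; simp [encode]

theorem input_two : I.input 2 = I.m := by
  rw [input_succ]; simp [encode]

/-- Cell `0` holds the length, `1` and `2` hold `n` and `m`, and blocks of two start at `3`. The
encoding writes `0` for vertices outside `C`, so the membership flag need not be read. -/
theorem input_dem (i : Fin I.n) : I.input (4 + 2 * i) = I.dem i := by
  rw [show 4 + 2 * (i : ℕ) = 2 + (2 * i + 1) + 1 by ring, input_succ, encode]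
  simp only [List.append_assoc]
  rw [List.getD_append_right _ _ _ _ (by simp)]
  simp only [List.length_cons, List.length_nil, zero_add, Nat.add_sub_cancel_left, Nat.reduceAdd]
  rw [getD_flatMap_finRange (k := 2) _ (fun i => by split_ifs <;> rfl) i (by norm_num), dem_coe]
  split_ifs <;> rfl

theorem input_sup (i : Fin I.n) : I.input (4 + 2 * I.n + 2 * i) = I.sup i := by
  rw [show 4 + 2 * I.n + 2 * (i : ℕ) = 2 + (2 * I.n + (2 * i + 1)) + 1 by ring, input_succ, encode]
  simp only [List.append_assoc]
  rw [List.getD_append_right _ _ _ _ (by simp)]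
  simp only [List.length_cons, List.length_nil, zero_add, Nat.add_sub_cancel_left, Nat.reduceAdd]
  rw [List.getD_append_right, length_flatMap_finRange (k := 2), Nat.add_sub_cancel_left,
    getD_flatMap_finRange (k := 2) _ (fun i => by split_ifs <;> rfl) i (by norm_num), sup_coe]
  · split_ifs <;> rfl
  · exact fun i => by split_ifs <;> rfl
  · rw [length_flatMap_finRange (k := 2) _ fun i => by split_ifs <;> rfl]
    omega

theorem input_edge (i j : Fin I.n) {r : ℕ} (hr : r < 3) :
    I.input (3 + r + 4 * I.n + 3 * (i * I.n + j)) =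
      (if (i, j) ∈ I.E then [1, (I.cost (i, j)).num, (I.cost (i, j)).den] else [0, 0, 0]).getD r 0 := by
  rw [show 3 + r + 4 * I.n + 3 * ((i : ℕ) * I.n + j) =
    2 + (2 * I.n + (2 * I.n + (3 * I.n * i + (3 * j + r)))) + 1 by ring, input_succ, encode]
  simp only [List.append_assoc]
  rw [List.getD_append_right _ _ _ _ (by simp)]
  simp only [List.length_cons, List.length_nil, zero_add, Nat.add_sub_cancel_left, Nat.reduceAdd]
  rw [List.getD_append_right, length_flatMap_finRange (k := 2), Nat.add_sub_cancel_left,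
    List.getD_append_right, length_flatMap_finRange (k := 2), Nat.add_sub_cancel_left,
    ← List.append_nil (List.flatMap _ _),
    getD_flatMap_finRange (k := 3 * I.n) _ (fun i => length_flatMap_finRange (k := 3) _
      fun j => by split_ifs <;> rfl) i, ← List.append_nil (List.flatMap _ _),
    getD_flatMap_finRange (k := 3) _ (fun j => by split_ifs <;> rfl) j hr]
  any_goals exact fun i => by split_ifs <;> rfl
  any_goals
    rw [length_flatMap_finRange (k := 2) _ fun i => by split_ifs <;> rfl]
    omega
  omega

end MCFOInstance

/-! ### The stages of the program and their correctness. -/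

namespace RAM

open RAM.Expr RAM.Program Transship

/-- The number `r` in the input for the pair `(17, 18)` of vertices. -/
def readPair (r : ℕ) : Expr :=
  .get 0 (.add (.add (.const (3 + r)) (.mul (.const 4) (var 2)))
    (.mul (.const 3) (.add (.mul (var 17) (var 2)) (var 18))))

/-- Compute a common denominator `5` of the costs and a bound `6` for the scaled costs. -/
def denominators : Program :=
  forPairs 2 (.ite (readPair 0) (.seq (setVar 5 (.mul (readPair 2) (var 5)))
    (.seq (setVar 6 (.add (.mul (readPair 1) (var 6)) (var 6)))
      (setVar 6 (.mul (readPair 2) (var 6))))) .skip)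

/-- Give all pairs of nodes the cost `4`. -/
def fillCosts : Program := forPairs 3 (setEntry 7 (var 17) (var 18) (var 4))

/-- Give all arcs that do not join two vertices the cost `0`. -/
def zeroCosts : Program :=
  .seq (forTo 17 2
    (.seq (setEntry 7 (.add (var 2) (var 17)) (var 17) (.const 0))
    (.seq (setEntry 7 (.add (var 2) (var 17)) (.mul (.const 3) (var 2)) (.const 0))
    (.seq (setEntry 7 (var 17) (.add (.mul (.const 2) (var 2)) (var 17)) (.const 0))
      (setEntry 7 (.add (.mul (.const 3) (var 2)) (.const 1))
        (.add (.mul (.const 2) (var 2)) (var 17)) (.const 0))))))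
    (setEntry 7 (.add (.mul (.const 3) (var 2)) (.const 1)) (.mul (.const 3) (var 2)) (.const 0))

/-- Give the edges their scaled costs. -/
def edgeCosts : Program :=
  forPairs 2 (.ite (readPair 0)
    (setEntry 7 (var 17) (var 18) (.mul (readPair 1) (.div (var 5) (readPair 2)))) .skip)

/-- Compute the supplies and demands in the network and their sums. -/
def balances : Program :=
  .seq (forTo 17 2
    (.seq (.assign 8 (.add (var 2) (var 17)) (.get 0 (.add (.const 4) (.mul (.const 2) (var 17)))))
    (.seq (setVar 26 (.add (var 26) (.get 0 (.add (.const 4) (.mul (.const 2) (var 17))))))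
    (.seq (.assign 9 (.add (.mul (.const 2) (var 2)) (var 17))
        (.get 0 (.add (.add (.const 4) (.mul (.const 2) (var 2))) (.mul (.const 2) (var 17)))))
      (setVar 27 (.add (var 27) (.get 0
        (.add (.add (.const 4) (.mul (.const 2) (var 2))) (.mul (.const 2) (var 17))))))))))
    (.seq (.assign 9 (.mul (.const 3) (var 2)) (.get 0 (.const 2)))
      (setVar 27 (.add (var 27) (.get 0 (.const 2)))))

/-- Compute a power `14` of two that exceeds the value of `27`. -/
def scale : Program :=
  .seq (setVar 14 (.const 1)) (.loop (ge (var 27) (var 14)) (setVar 14 (.add (var 14) (var 14))))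

/-- Test whether the flow uses an expensive pair. -/
def checkFar : Program :=
  .seq (setVar 28 (.const 0)) (forPairs 3 (.ite (entry 10 (var 17) (var 18))
    (.ite (ge (entry 7 (var 17) (var 18)) (var 4)) (setVar 28 (.const 1)) .skip) .skip))

/-- Output the solution that corresponds to the flow. -/
def emitSolution : Program :=
  .seq (emit (.const 1)) (.seq (forPairs 2 (emit (entry 10 (var 17) (var 18))))
    (.seq (forTo 17 2 (emit (entry 10 (.add (var 2) (var 17)) (var 17))))
      (forTo 17 2 (emit (entry 10 (var 17) (.add (.mul (.const 2) (var 2)) (var 17)))))))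

variable {R : ℕ} {s : State} {I : MCFOInstance}

theorem val_readPair (hin : s 0 = I.input) (h2 : s 2 0 = I.n) {i j : Fin I.n} (hi : s 17 0 = i)
    (hj : s 18 0 = j) {r : ℕ} (hr : r < 3) : (readPair r).val s =
      (if (i, j) ∈ I.E then [1, (I.cost (i, j)).num, (I.cost (i, j)).den] else [0, 0, 0]).getD r 0 := by
  rw [← I.input_edge i j hr, ← hin]
  simp [readPair, h2, hi, hj]

theorem wp_denominators (hin : s 0 = I.input) (h2 : s 2 0 = I.n) (h5 : s 5 0 = 1) (h6 : s 6 0 = 1)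
    (hR : I.n < R) : wp R denominators (fun s' => 0 < s' 5 0 ∧ ∀ i j : Fin I.n, (i, j) ∈ I.E →
      (I.cost (i, j)).den ∣ s' 5 0 ∧ (I.cost (i, j)).num * s' 5 0 ≤ s' 6 0) s := by
  unfold denominators
  -- The denominator accumulates the product of all `den`, and the bound that of all `den * (num +
  -- 1)`. For a new edge `num * D ≤ H` follows from `D ≤ H`, which is therefore part of the
  -- invariant; the bound is formed this way so that all factors are input cells.
  refine wp_forPairs h2 hR (by decide) (by decide) (by decide)
    (fun i j s' => 0 < s' 5 0 ∧ s' 5 0 ≤ s' 6 0 ∧ ∀ a b : Fin I.n, (a < i ∨ a = i ∧ b < j) →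
      (a, b) ∈ I.E → (I.cost (a, b)).den ∣ s' 5 0 ∧ (I.cost (a, b)).num * s' 5 0 ≤ s' 6 0)
    ?_ ?_ ?_ ?_ ?_
  · intro i j s₁ s₂ h; simp [h]
  · simp [h5, h6]
  · rintro i s₁ ⟨h1, h2, h3⟩
    exact ⟨h1, h2, fun a b hab => h3 a b (by omega)⟩
  · rintro i hi j hj s₁ f₁ hi₁ hj₁ ⟨hD, hDH, hI⟩
    have e0 := (f₁ 0 (by decide)).trans hin
    have e2 := (congrFun (f₁ 2 (by decide)) 0).trans h2
    have r0 := val_readPair e0 e2 (i := ⟨i, hi⟩) (j := ⟨j, hj⟩) hi₁ hj₁ (r := 0) (by norm_num)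
    have r1 : ∀ x y, (readPair 1).val (s₁.set 5 x y) = _ := fun x y =>
      val_readPair (s := s₁.set 5 x y) (by rw [State.set_of_ne _ _ _ (by decide), e0])
        (by rw [State.set_of_ne _ _ _ (by decide), e2]) (i := ⟨i, hi⟩) (j := ⟨j, hj⟩)
        (by rw [State.set_of_ne _ _ _ (by decide), hi₁])
        (by rw [State.set_of_ne _ _ _ (by decide), hj₁]) (by norm_num)
    have r2 := val_readPair e0 e2 (i := ⟨i, hi⟩) (j := ⟨j, hj⟩) hi₁ hj₁ (r := 2) (by norm_num)
    have r2' : ∀ x y z w, (readPair 2).val ((s₁.set 5 x y).set 6 z w) = _ := fun x y z w =>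
      val_readPair (s := (s₁.set 5 x y).set 6 z w) (by simp [State.set_of_ne, e0])
        (by simp [State.set_of_ne, e2]) (i := ⟨i, hi⟩) (j := ⟨j, hj⟩)
        (by simp [State.set_of_ne, hi₁]) (by simp [State.set_of_ne, hj₁]) (by norm_num)
    simp only [wp_ite, wp_seq, wp_setVar, wp_skip, val_mul, val_add, val_var, r0, r1, r2, r2']
    by_cases hE : ((⟨i, hi⟩ : Fin I.n), (⟨j, hj⟩ : Fin I.n)) ∈ I.E
    · simp only [hE, if_true]
      refine ⟨fun _ => ?_, fun h => absurd h (by simp)⟩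
      have hden : 0 < (I.cost (⟨i, hi⟩, ⟨j, hj⟩)).den := (I.cost _).den_pos
      simp [State.set_apply]
      generalize hd : (I.cost (⟨i, hi⟩, ⟨j, hj⟩)).den = d at hden
      generalize hnu : (I.cost (⟨i, hi⟩, ⟨j, hj⟩)).num = nu
      refine ⟨hD, hDH.trans (Nat.le_add_left _ _), fun a b hab hE' => ?_⟩
      by_cases h : (a : ℕ) < i ∨ (a : ℕ) = i ∧ (b : ℕ) < j
      · obtain ⟨g1, g2⟩ := hI a b h hE'
        refine ⟨g1.mul_left _, ?_⟩
        calc _ = d * ((I.cost (a, b)).num * s₁ 5 0) := by ring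
          _ ≤ d * (nu * s₁ 6 0 + s₁ 6 0) :=
            Nat.mul_le_mul_left _ (g2.trans (Nat.le_add_left _ _))
      · obtain rfl : a = ⟨i, hi⟩ := Fin.ext (by simp; omega)
        obtain rfl : b = ⟨j, hj⟩ := Fin.ext (by simp; omega)
        rw [hd, hnu]
        refine ⟨Dvd.intro _ rfl, ?_⟩
        calc _ = d * (nu * s₁ 5 0) := by ring
          _ ≤ d * (nu * s₁ 6 0 + s₁ 6 0) :=
            Nat.mul_le_mul_left _ ((Nat.mul_le_mul_left _ hDH).trans (Nat.le_add_right _ _))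
    · simp only [hE, if_false]
      refine ⟨fun h => absurd rfl h, fun _ => ⟨hD, hDH, fun a b hab hE' => hI a b ?_ hE'⟩⟩
      by_contra h
      obtain rfl : a = ⟨i, hi⟩ := Fin.ext (by simp; omega)
      obtain rfl : b = ⟨j, hj⟩ := Fin.ext (by simp; omega)
      exact hE hE'
  · rintro s₁ _ ⟨h1, _, h3⟩
    exact ⟨h1, fun i j => h3 i j (.inl i.2)⟩

theorem wp_fillCosts {N : ℕ} (hN : s 3 0 = N) (hR : N < R) :
    wp R fillCosts (fun s' => ∀ u < N, ∀ v < N, s'.mat 7 u v = s 4 0) s := by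
  unfold fillCosts
  refine wp_forPairs hN hR (by decide) (by decide) (by decide)
    (fun i j s' => ∀ u v, v < N → (u < i ∨ u = i ∧ v < j) → s'.mat 7 u v = s 4 0)
    ?_ ?_ ?_ ?_ ?_
  · intro i j s₁ s₂ h
    rw [mat_congr (h 7 (by decide) (by decide))]
    exact id
  · intro u v _ h; omega
  · intro i s₁ h u v hv huv
    exact h u v hv (by omega)
  · intro i hi j hj s₁ f₁ hi₁ hj₁ hI
    rw [wp_setEntry, mat_set_same]
    simp only [val_var, hi₁, hj₁, f₁ 4 (by decide)]
    intro u v hv huv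
    split_ifs
    · rfl
    · exact hI u v hv (by omega)
  · intro s₁ _ h u hu v hv
    exact h u v hv (.inl hu)

/-- Each assignment of a zero entry adds one disjunct to the description of the entries that are
zero. -/
theorem ite_zero_step {p q : Prop} [Decidable p] {a b : ℕ} (h : (q → a = 0) ∧ (¬ q → a = b)) :
    (p ∨ q → (if p then 0 else a) = 0) ∧ (¬ (p ∨ q) → (if p then 0 else a) = b) := by
  by_cases hp : p
  · simp [hp]
  · simpa [hp] using h

open MCFOInstance in
theorem wp_zeroCosts {n : ℕ} (h2 : s 2 0 = n) (hR : n < R) :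
    wp R zeroCosts (fun s' => ∀ u v, (IsArcShape n u v ∧ ¬ (u < n ∧ v < n) → s'.mat 7 u v = 0) ∧
      (¬ (IsArcShape n u v ∧ ¬ (u < n ∧ v < n)) → s'.mat 7 u v = s.mat 7 u v)) s := by
  unfold zeroCosts
  -- The arcs treated in the first `j` iterations. The arc from `3 * n + 1` to `3 * n` is missing,
  -- as it is treated after the loop.
  let Z : ℕ → ℕ → ℕ → Prop := fun j u v => n ≤ u ∧ u < n + j ∧ (v + n = u ∨ v = 3 * n) ∨
    u < j ∧ v = 2 * n + u ∨ u = 3 * n + 1 ∧ 2 * n ≤ v ∧ v < 2 * n + j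
  refine wp_seq_frame (Q₁ := fun s' => ∀ u v, (Z n u v → s'.mat 7 u v = 0) ∧
    (¬ Z n u v → s'.mat 7 u v = s.mat 7 u v)) ?_ ?_
  · refine wp_forTo h2 hR (by decide) (by decide) (fun j s' => ∀ u v, (Z j u v → s'.mat 7 u v = 0) ∧
      (¬ Z j u v → s'.mat 7 u v = s.mat 7 u v)) ?_ ?_ ?_ ?_
    · intro j s₁ s₂ h
      rw [mat_congr (h 7 (by decide))]
      exact id
    · intro u v
      exact ⟨fun h => by simp only [Z] at h; omega, fun _ => rfl⟩
    · intro j hj s₁ f₁ hj₁ hI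
      have e2 := (congrFun (f₁ 2 (by decide)) 0).trans h2
      simp only [wp_seq, wp_setEntry, val_add, val_mul, val_const, val_var,
        State.set_of_ne _ _ _ (by decide : (2 : ℕ) ≠ 7),
        State.set_of_ne _ _ _ (by decide : (17 : ℕ) ≠ 7), e2, hj₁, mat_set_same]
      intro u v
      have hZ : Z (j + 1) u v ↔ (u = 3 * n + 1 ∧ v = 2 * n + j) ∨ (u = j ∧ v = 2 * n + j) ∨
          (u = n + j ∧ v = 3 * n) ∨ (u = n + j ∧ v = j) ∨ Z j u v := by
        clear hI
        constructor
        · rintro (⟨h1, h2, h3 | h3⟩ | ⟨h1, h2⟩ | ⟨h1, h2, h3⟩) <;> simp only [Z] <;> omega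
        · rintro (⟨h1, h2⟩ | ⟨h1, h2⟩ | ⟨h1, h2⟩ | ⟨h1, h2⟩ | ⟨h1, h2, h3 | h3⟩ | ⟨h1, h2⟩ |
            ⟨h1, h2, h3⟩) <;> simp only [Z] <;> omega
      rw [hZ]
      exact ite_zero_step (ite_zero_step (ite_zero_step (ite_zero_step (hI u v))))
    · exact fun s₁ _ h => h
  · intro s₁ f₁ h
    have e2 := (congrFun (f₁ 2 (by decide)) 0).trans h2
    rw [wp_setEntry, mat_set_same]
    simp only [val_add, val_mul, val_const, val_var, e2]
    intro u v
    have hZ : (IsArcShape n u v ∧ ¬ (u < n ∧ v < n)) ↔ (u = 3 * n + 1 ∧ v = 3 * n) ∨ Z n u v := by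
      clear h
      constructor
      · rintro ⟨h1 | ⟨h1, h2, h3 | h3⟩ | ⟨h1, h2⟩ | ⟨h1, h2, h3⟩, h4⟩ <;> simp only [Z] <;> omega
      · rintro (⟨h1, h2⟩ | ⟨h1, h2, h3 | h3⟩ | ⟨h1, h2⟩ | ⟨h1, h2, h3⟩) <;>
          simp only [IsArcShape] <;> omega
    rw [hZ]
    exact ite_zero_step (h u v)

theorem wp_edgeCosts (hin : s 0 = I.input) (h2 : s 2 0 = I.n) (hR : I.n < R) :
    wp R edgeCosts (fun s' =>
      (∀ i j : Fin I.n, (i, j) ∈ I.E →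
        s'.mat 7 i j = (I.cost (i, j)).num * (s 5 0 / (I.cost (i, j)).den)) ∧
      ∀ u v : ℕ, (∀ i j : Fin I.n, (i, j) ∈ I.E → ¬ (u = i ∧ v = j)) → s'.mat 7 u v = s.mat 7 u v) s := by
  unfold edgeCosts
  refine wp_forPairs h2 hR (by decide) (by decide) (by decide) (fun i j s' =>
      (∀ a b : Fin I.n, (a < i ∨ a = i ∧ b < j) → (a, b) ∈ I.E →
        s'.mat 7 a b = (I.cost (a, b)).num * (s 5 0 / (I.cost (a, b)).den)) ∧
      ∀ u v : ℕ, (∀ i j : Fin I.n, (i, j) ∈ I.E → ¬ (u = i ∧ v = j)) → s'.mat 7 u v = s.mat 7 u v)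
    ?_ ?_ ?_ ?_ ?_
  · intro i j s₁ s₂ h
    rw [mat_congr (h 7 (by decide) (by decide))]
    exact id
  · exact ⟨fun a b h => by omega, fun _ _ _ => rfl⟩
  · rintro i s₁ ⟨g1, g2⟩
    exact ⟨fun a b hab => g1 a b (by omega), g2⟩
  · rintro i hi j hj s₁ f₁ hi₁ hj₁ ⟨g1, g2⟩
    have e0 := (f₁ 0 (by decide)).trans hin
    have e2 := (congrFun (f₁ 2 (by decide)) 0).trans h2
    have r := fun r hr =>
      val_readPair e0 e2 (i := ⟨i, hi⟩) (j := ⟨j, hj⟩) hi₁ hj₁ (r := r) hr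
    simp only [wp_ite, wp_setEntry, wp_skip, val_mul, val_div, val_var, r 0 (by norm_num),
      r 1 (by norm_num), r 2 (by norm_num), mat_set_same, hi₁, hj₁, f₁ 5 (by decide)]
    by_cases hE : ((⟨i, hi⟩ : Fin I.n), (⟨j, hj⟩ : Fin I.n)) ∈ I.E
    · simp only [hE, if_true]
      refine ⟨fun _ => ⟨fun a b hab hE' => ?_, fun u v huv => ?_⟩, fun h => absurd h (by simp)⟩
      · split_ifs with h
        · obtain rfl : a = ⟨i, hi⟩ := Fin.ext (by simp; omega)
          obtain rfl : b = ⟨j, hj⟩ := Fin.ext (by simp; omega)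
          rfl
        · exact g1 a b (by omega) hE'
      · rw [if_neg (huv _ _ hE)]
        exact g2 u v huv
    · simp only [hE, if_false]
      refine ⟨fun h => absurd rfl h, fun _ => ⟨fun a b hab hE' => g1 a b ?_ hE', g2⟩⟩
      by_contra h
      obtain rfl : a = ⟨i, hi⟩ := Fin.ext (by simp; omega)
      obtain rfl : b = ⟨j, hj⟩ := Fin.ext (by simp; omega)
      exact hE hE'
  · rintro s₁ _ ⟨g1, g2⟩
    exact ⟨fun i j => g1 i j (.inl i.2), g2⟩

/-- Compute the costs in the network. -/
def netCosts : Program := .seq fillCosts (.seq zeroCosts edgeCosts)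

open MCFOInstance in
theorem wp_netCosts {H : ℕ} (hin : s 0 = I.input) (h2 : s 2 0 = I.n) (h3 : s 3 0 = 3 * I.n + 2)
    (h4 : s 4 0 = (3 * I.n + 2) * H + 1) (h5 : 0 < s 5 0)
    (hE : ∀ i j : Fin I.n, (i, j) ∈ I.E →
      (I.cost (i, j)).den ∣ s 5 0 ∧ (I.cost (i, j)).num * s 5 0 ≤ H) (hR : 3 * I.n + 2 < R) :
    wp R netCosts (fun s' => I.IsNetCost (s 5 0) H (s'.mat 7)) s := by
  unfold netCosts
  refine wp_seq_frame (wp_fillCosts h3 hR) fun s₁ f₁ g₁ => ?_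
  refine wp_seq_frame (wp_zeroCosts ((congrFun (f₁ 2 (by decide)) 0).trans h2) (by omega))
    fun s₂ f₂ g₂ => ?_
  have e0 : s₂ 0 = I.input := by rw [f₂ 0 (by decide), f₁ 0 (by decide), hin]
  have e2 : s₂ 2 0 = I.n := by rw [f₂ 2 (by decide), f₁ 2 (by decide), h2]
  have e5 : s₂ 5 0 = s 5 0 := by rw [f₂ 5 (by decide), f₁ 5 (by decide)]
  refine wp_mono (wp_edgeCosts e0 e2 (by omega)) ?_
  rintro s₃ ⟨k1, k2⟩
  rw [e5] at k1
  have hzero : ∀ u v, IsArcShape I.n u v → ¬ (u < I.n ∧ v < I.n) → s₃.mat 7 u v = 0 := by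
    intro u v hs hn
    rw [k2 u v fun i j _ h => hn (by omega), (g₂ u v).1 ⟨hs, hn⟩]
  refine ⟨h5, fun i j hij => ?_, hzero, fun u v huv => ?_, fun u hu v hv huv => ?_⟩
  · rw [k1 i j hij, mul_assoc, Nat.div_mul_cancel (hE i j hij).1]
  · by_cases hn : u < I.n ∧ v < I.n
    · have hij := huv.2 hn.1 hn.2
      rw [k1 ⟨u, hn.1⟩ ⟨v, hn.2⟩ hij]
      exact (Nat.mul_le_mul_left _ (Nat.div_le_self _ _)).trans (hE _ _ hij).2
    · rw [hzero u v huv.1 hn]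
      exact Nat.zero_le _
  · rw [k2 u v, (g₂ u v).2, g₁ u hu v hv, h4]
    · exact fun h => huv ⟨h.1, fun hu hv => absurd ⟨hu, hv⟩ h.2⟩
    · rintro i j hij ⟨rfl, rfl⟩
      exact huv ⟨.inl ⟨i.2, j.2⟩, fun _ _ => hij⟩

open MCFOInstance in
theorem wp_balances (hin : s 0 = I.input) (h2 : s 2 0 = I.n) (h8 : s 8 = fun _ => 0)
    (h9 : s 9 = fun _ => 0) (h26 : s 26 0 = 0) (h27 : s 27 0 = 0) (hR : I.n < R) :
    wp R balances (fun s' =>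
      (∀ w, s' 8 w = if I.n ≤ w ∧ w < 2 * I.n then I.dem (w - I.n) else 0) ∧
      s' 9 = I.netDemand ∧ s' 26 0 = I.totalDemand ∧ s' 27 0 = I.totalSupply + I.m) s := by
  unfold balances
  refine wp_seq_frame (Q₁ := fun s' =>
    (∀ w, s' 8 w = if I.n ≤ w ∧ w < I.n + I.n then I.dem (w - I.n) else 0) ∧
    (∀ w, s' 9 w = if 2 * I.n ≤ w ∧ w < 2 * I.n + I.n then I.sup (w - 2 * I.n) else 0) ∧
    s' 26 0 = I.totalDemand ∧ s' 27 0 = I.totalSupply) ?_ ?_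
  · refine wp_forTo h2 hR (by decide) (by decide) (fun j s' =>
      (∀ w, s' 8 w = if I.n ≤ w ∧ w < I.n + j then I.dem (w - I.n) else 0) ∧
      (∀ w, s' 9 w = if 2 * I.n ≤ w ∧ w < 2 * I.n + j then I.sup (w - 2 * I.n) else 0) ∧
      s' 26 0 = ∑ k ∈ Finset.range j, I.dem k ∧ s' 27 0 = ∑ k ∈ Finset.range j, I.sup k) ?_ ?_ ?_ ?_
    · intro j s₁ s₂ h; simp [h]
    · refine ⟨fun w => ?_, fun w => ?_, by simp [h26], by simp [h27]⟩
      · rw [h8, if_neg (by omega)]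
      · rw [h9, if_neg (by omega)]
    · rintro j hj s₁ f₁ hj₁ ⟨g1, g2, g3, g4⟩
      have e0 := (f₁ 0 (by decide)).trans hin
      have e2 := (congrFun (f₁ 2 (by decide)) 0).trans h2
      have r1 := I.input_dem ⟨j, hj⟩
      have r2 := I.input_sup ⟨j, hj⟩
      simp only at r1 r2
      simp only [wp_seq, wp_assign, wp_setVar, val_get, val_add, val_mul, val_const, val_var]
      simp [State.set_apply, e0, e2, hj₁, r1, r2, g3, g4, Finset.sum_range_succ]
      constructor
      · intro w
        rcases eq_or_ne w (I.n + j) with rfl | hw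
        · simp
        · rw [if_neg hw, g1 w]
          congr 1
          simp only [eq_iff_iff, and_congr_right_iff]; omega
      · intro w
        rcases eq_or_ne w (2 * I.n + j) with rfl | hw
        · simp
        · rw [if_neg hw, g2 w]
          congr 1
          simp only [eq_iff_iff, and_congr_right_iff]; omega
    · exact fun s₁ _ h => h
  · rintro s₁ f₁ ⟨g1, g2, g3, g4⟩
    have e0 := (f₁ 0 (by decide)).trans hin
    have e2 := (congrFun (f₁ 2 (by decide)) 0).trans h2
    have r := I.input_two
    simp only [wp_seq, wp_assign, wp_setVar, val_get, val_add, val_mul, val_const, val_var]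
    simp only [State.set_apply, e0, e2, r, g3, g4, two_mul]
    simp only [two_mul] at g1 g2
    simp [g1]
    funext w
    rw [State.set_of_ne _ _ _ (by decide), State.set_same, Function.update_apply, g2 w, netDemand]
    split_ifs <;> first | rfl | omega | (congr 1; omega)

theorem wp_scale (hR : Nat.size (s 27 0) < R) : wp R scale (fun s' => ∃ e, s' 14 0 = 2 ^ e ∧
    s 27 0 < 2 ^ e ∧ e ≤ Nat.size (s 27 0)) s := by
  unfold scale
  rw [wp_seq, wp_setVar]
  refine wp_loop (k := Nat.size (s 27 0)) (fun k s' => ∃ e, s' 14 0 = 2 ^ e ∧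
    e + k = Nat.size (s 27 0)) hR ⟨0, by simp [State.set_apply], by simp⟩ ?_
  rintro k s₁ f₁ ⟨e, he, hk⟩
  have e27 : s₁ 27 0 = s 27 0 := by
    rw [f₁ 27 (by decide), State.set_of_ne _ _ _ (by decide)]
  rw [val_ge, val_ge_eq_zero]
  simp only [val_var, e27, he]
  refine ⟨fun h => ⟨e, rfl, h, by omega⟩, fun h => ?_⟩
  -- As long as the power does not exceed the number, its exponent is below the bit length.
  have hlt := Nat.lt_size.2 h
  refine ⟨k - 1, by omega, e + 1, ?_, by omega⟩
  simp [State.set_apply, he, pow_succ]; omega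

theorem wp_checkFar {N : ℕ} (hN : s 3 0 = N) (hR : N < R) :
    wp R checkFar (fun s' =>
      (s' 28 0 = 0 → ∀ u < N, ∀ v < N, s.mat 10 u v ≠ 0 → s.mat 7 u v < s 4 0) ∧
      (s' 28 0 ≠ 0 → ∃ u < N, ∃ v < N, s.mat 10 u v ≠ 0 ∧ s 4 0 ≤ s.mat 7 u v)) s := by
  unfold checkFar
  rw [wp_seq, wp_setVar]
  refine wp_forPairs (m := N) (by rwa [State.set_of_ne _ _ _ (by decide)]) hR (by decide) (by decide)
    (by decide) (fun i j s' =>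
      (s' 28 0 = 0 → ∀ u v, v < N → (u < i ∨ u = i ∧ v < j) → s.mat 10 u v ≠ 0 →
        s.mat 7 u v < s 4 0) ∧
      (s' 28 0 ≠ 0 → ∃ u < N, ∃ v < N, s.mat 10 u v ≠ 0 ∧ s 4 0 ≤ s.mat 7 u v)) ?_ ?_ ?_ ?_ ?_
  · intro i j s₁ s₂ h
    rw [h 28 (by decide) (by decide)]
    exact id
  · exact ⟨fun _ u v _ h => by omega, fun h => absurd (by simp [State.set_apply]) h⟩
  · rintro i s₁ ⟨h1, h2⟩
    exact ⟨fun h u v hv huv => h1 h u v hv (by omega), h2⟩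
  · rintro i hi j hj s₁ f₁ hi₁ hj₁ ⟨h1, h2⟩
    have m10 : s₁.mat 10 = s.mat 10 := mat_congr (by
      rw [f₁ 10 (by decide), State.set_of_ne _ _ _ (by decide)])
    have m7 : s₁.mat 7 = s.mat 7 := mat_congr (by
      rw [f₁ 7 (by decide), State.set_of_ne _ _ _ (by decide)])
    have e4 : s₁ 4 0 = s 4 0 := by
      rw [f₁ 4 (by decide), State.set_of_ne _ _ _ (by decide)]
    simp only [wp_ite, wp_setVar, wp_skip, val_ge, val_ge_eq_zero, val_entry, val_var, val_const, m10,
      m7, e4, hi₁, hj₁]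
    have hcase : ∀ u v, (u < i ∨ u = i ∧ v < j + 1) → (u < i ∨ u = i ∧ v < j) ∨ u = i ∧ v = j := by
      omega
    refine ⟨fun hx => ⟨fun hc => ⟨fun h => absurd h (by simp [State.set_apply]),
      fun _ => ⟨i, hi, j, hj, hx, hc⟩⟩, fun hc => ⟨fun h u v hv huv hx' => ?_, h2⟩⟩,
      fun hx => ⟨fun h u v hv huv hx' => ?_, h2⟩⟩
    · rcases hcase u v huv with h' | ⟨rfl, rfl⟩
      · exact h1 h u v hv h' hx'
      · exact hc
    · rcases hcase u v huv with h' | ⟨rfl, rfl⟩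
      · exact h1 h u v hv h' hx'
      · exact absurd hx hx'
  · rintro s₁ _ ⟨h1, h2⟩
    exact ⟨fun h u hu v hv => h1 h u v hv (.inl hu), h2⟩

theorem output_congr {s s' : State} (h : s' 1 = s 1) : output s' = output s := by
  unfold output; rw [h]

open MCFOInstance in
theorem wp_emitSolution (h2 : s 2 0 = I.n) (h1 : s 1 0 = 0) (hR : I.n < R) :
    wp R emitSolution (fun s' => output s' = I.encodeAnswer (some (I.solutionOf (s.mat 10)))) s := by
  unfold emitSolution
  set x := s.mat 10 with hx
  have hout : output s = [] := by simp [output, h1]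
  have hfin : ∀ f : ℕ → ℕ, (List.finRange I.n).map (fun v : Fin I.n => f v) = (List.range I.n).map f := by
    intro f
    rw [← List.map_coe_finRange_eq_range, List.map_map]; rfl
  have hfin' : (List.finRange I.n).flatMap (fun u : Fin I.n => (List.finRange I.n).map fun v : Fin I.n => x u v) =
      (List.range I.n).flatMap fun u => (List.range I.n).map (x u) := by
    rw [← List.map_coe_finRange_eq_range, List.flatMap_map]
    simp only [List.map_map]; rfl
  refine wp_seq_frame wp_emit fun s₁ f₁ g₁ => ?_
  rw [hout, val_const, List.nil_append] at g₁
  have e2₁ := (congrFun (f₁ 2 (by decide)) 0).trans h2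
  have m₁ : s₁.mat 10 = x := mat_congr (f₁ 10 (by decide))
  refine wp_seq_frame (Q₁ := fun s' => output s' = [1] ++
    (List.range I.n).flatMap (fun u => (List.range I.n).map (x u))) ?_ fun s₂ f₂ g₂ => ?_
  · refine wp_forPairs e2₁ hR (by decide) (by decide) (by decide) (fun i j s' => output s' = [1] ++
      ((List.range i).flatMap (fun u => (List.range I.n).map (x u)) ++ (List.range j).map (x i)))
      ?_ ?_ ?_ ?_ ?_
    · intro i j s₁ s₂ h
      rw [output_congr (h 1 (by decide) (by decide))]
      exact id
    · simpa using g₁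
    · intro i s' h
      simp [h, List.range_succ, List.flatMap_append]
    · intro i hi j hj s' f' hi' hj' h
      refine wp_mono wp_emit fun s'' h'' => ?_
      rw [h'', h, val_entry, val_var, val_var, hi', hj', mat_congr (f' 10 (by decide)), m₁]
      simp [List.range_succ]
    · intro s' _ h
      simpa using h
  have e2₂ := (congrFun (f₂ 2 (by decide)) 0).trans e2₁
  have m₂ : s₂.mat 10 = x := (mat_congr (f₂ 10 (by decide))).trans m₁
  have hloop : ∀ (s₀ : State) (l : List ℕ) (e₁ e₂ : Expr) (f : ℕ → ℕ), s₀ 2 0 = I.n →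
      s₀.mat 10 = x → output s₀ = l →
      (∀ s' j, s'.mat 10 = x → s' 2 0 = I.n → s' 17 0 = j → (entry 10 e₁ e₂).val s' = f j) →
      wp R (forTo 17 2 (emit (entry 10 e₁ e₂)))
        (fun s' => output s' = l ++ (List.range I.n).map f) s₀ := by
    intro s₀ l e₁ e₂ f h2 hm hl hf
    refine wp_forTo h2 hR (by rfl) (by rfl)
      (fun j s' => output s' = l ++ (List.range j).map f) ?_ ?_ ?_ ?_
    · intro j s₁ s₂ h
      rw [output_congr (h 1 (by decide))]
      exact id
    · simpa using hl
    · intro j hj s' f' hj' h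
      refine wp_mono wp_emit fun s'' h'' => ?_
      rw [h'', h, hf s' j ((mat_congr (f' 10 (by rfl))).trans hm)
        ((congrFun (f' 2 (by rfl)) 0).trans h2) hj']
      simp [List.range_succ]
    · exact fun s' _ h => h
  refine wp_seq_frame (hloop s₂ _ _ _ (fun v => x (I.n + v) v) e2₂ m₂ g₂ ?_) fun s₃ f₃ g₃ => ?_
  · intro s' j hm h2 hj
    simp only [val_entry, val_add, val_var, hm, h2, hj]
  refine wp_mono (hloop s₃ _ _ _ (fun v => x v (2 * I.n + v))
    ((congrFun (f₃ 2 (by decide)) 0).trans e2₂) ((mat_congr (f₃ 10 (by decide))).trans m₂) g₃ ?_) ?_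
  · intro s' j hm h2 hj
    simp only [val_entry, val_add, val_mul, val_const, val_var, hm, h2, hj]
  · intro s₄ h
    rw [h]
    simp only [encodeAnswer, solutionOf, hfin', hfin fun v => x (I.n + v) v,
      hfin fun v => x v (2 * I.n + v)]

end RAM

/-! ### Equality of total supply and demand in the network. -/

namespace MCFOInstance

variable (I : MCFOInstance)

theorem sum_netDemand :
    ∑ w ∈ Finset.range (3 * I.n + 2), I.netDemand w = I.totalSupply + I.m := by
  rw [sum_nodes, ← Fin.sum_univ_eq_sum_range, ← Fin.sum_univ_eq_sum_range (fun i => I.netDemand (I.n + i)),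
    ← Fin.sum_univ_eq_sum_range (fun i => I.netDemand (2 * I.n + i))]
  simp only [netDemand_vertex, netDemand_demand, netDemand_supply, netDemand_outliers,
    netDemand_unused, totalSupply_eq, Finset.sum_const_zero, zero_add, add_zero]

theorem sum_netSupply (h : I.totalDemand ≤ I.totalSupply + I.m) :
    ∑ w ∈ Finset.range (3 * I.n + 2), I.netSupply w = I.totalSupply + I.m := by
  have h3 := I.netSupply_supply le_rfl
  rw [show 2 * I.n + I.n = 3 * I.n by ring] at h3
  rw [sum_nodes, ← Fin.sum_univ_eq_sum_range, ← Fin.sum_univ_eq_sum_range (fun i => I.netSupply (I.n + i)),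
    ← Fin.sum_univ_eq_sum_range (fun i => I.netSupply (2 * I.n + i))]
  simp only [netSupply_vertex, netSupply_demand, netSupply_supply (Fin.is_lt _).le, h3,
    netSupply_unused, ← totalDemand_eq, Finset.sum_const_zero, zero_add, add_zero]
  omega

end MCFOInstance

/-! ### Correctness of the whole program. -/

namespace RAM

open RAM.Expr RAM.Program Transship MCFOInstance

/-- The part of the program after the costs and the balances have been computed. -/
def solveAndEmit : Program :=
  .seq (.assign 8 (.add (.mul (.const 3) (var 2)) (.const 1)) (.sub (var 27) (var 26)))
    (.seq scale (.seq solve (.seq checkFar (.ite (var 28) (emit (.const 0)) emitSolution))))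

/-- The program for minimum cost flow with outliers. -/
def mcfoProgram : Program :=
  .seq (setVar 2 (.get 0 (.const 1)))
  (.seq (setVar 3 (.add (.add (.add (var 2) (var 2)) (var 2)) (.const 2)))
  (.seq (setVar 5 (.const 1)) (.seq (setVar 6 (.const 1)) (.seq denominators
  (.seq (setVar 4 (.mul (.get 0 (.const 1)) (var 6)))
  (.seq (setVar 4 (.add (.add (.add (.add (var 4) (var 4)) (var 4)) (.add (var 6) (var 6)))
    (.const 1)))
  (.seq netCosts (.seq balances
    (.ite (ge (var 27) (var 26)) solveAndEmit (emit (.const 0)))))))))))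

/-- The program has output a correct answer. -/
def HasCorrectOutput (I : MCFOInstance) (s : State) : Prop :=
  ∃ b : Option (MCFOFlow I.n ℕ), I.IsCorrectAnswer b ∧ output s = I.encodeAnswer b

variable {R : ℕ} {s : State} {I : MCFOInstance}

theorem wp_emit_none (h1 : s 1 0 = 0) (h : ∀ T, ¬ I.IsFeasible T) :
    wp R (emit (.const 0)) (HasCorrectOutput I) s := by
  refine wp_mono wp_emit fun s' h' => ⟨none, h, ?_⟩
  rw [h']
  simp [output, h1, encodeAnswer]

theorem wp_solveAndEmit {D H : ℕ} (hc : I.IsNetCost D H (s.mat 7)) (h1 : s 1 0 = 0)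
    (h2 : s 2 0 = I.n) (h3 : s 3 0 = 3 * I.n + 2) (h4 : s 4 0 = (3 * I.n + 2) * H + 1)
    (h8 : ∀ w, s 8 w = if I.n ≤ w ∧ w < 2 * I.n then I.dem (w - I.n) else 0)
    (h9 : s 9 = I.netDemand) (h10 : ∀ u v, s.mat 10 u v = 0) (h11 : ∀ v, s 11 v = 0)
    (h26 : s 26 0 = I.totalDemand) (h27 : s 27 0 = I.totalSupply + I.m)
    (hle : I.totalDemand ≤ I.totalSupply + I.m) (hR : 3 * I.n + 2 < R)
    (hR' : Nat.size (I.totalSupply + I.m) * (2 * (3 * I.n + 2) + 1) + 1 < R) :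
    wp R solveAndEmit (HasCorrectOutput I) s := by
  unfold solveAndEmit
  rw [wp_seq, wp_assign]
  set s₁ := s.set 8 ((((Expr.const 3).mul (var 2)).add (.const 1)).val s)
    (((var 27).sub (var 26)).val s) with hs₁
  have f₁ : ∀ a, a ≠ 8 → s₁ a = s a := fun a ha => State.set_of_ne _ _ _ ha
  have g8 : s₁ 8 = I.netSupply := by
    funext w
    simp only [hs₁, State.set_apply, val_add, val_mul, val_sub, val_const, val_var, h2, h26, h27,
      h8, netSupply, true_and]
    split_ifs <;> first | rfl | omega
  refine wp_seq_frame (wp_scale (s := s₁) (by rw [f₁ 27 (by decide), h27]; nlinarith))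
    fun s₂ f₂ ⟨e, he, hlt, hsize⟩ => ?_
  rw [f₁ 27 (by decide), h27] at hlt hsize
  have m7₂ : s₂.mat 7 = s.mat 7 := mat_congr (by rw [f₂ 7 (by decide), f₁ 7 (by decide)])
  have m10₂ : ∀ u v, s₂.mat 10 u v = 0 := by
    rw [mat_congr ((f₂ 10 (by decide)).trans (f₁ 10 (by decide)))]; exact h10
  have g8₂ : s₂ 8 = I.netSupply := by rw [f₂ 8 (by decide), g8]
  have g9₂ : s₂ 9 = I.netDemand := by rw [f₂ 9 (by decide), f₁ 9 (by decide), h9]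
  have g11₂ : ∀ v, s₂ 11 v = 0 := by rw [f₂ 11 (by decide), f₁ 11 (by decide)]; exact h11
  have g3₂ : s₂ 3 0 = 3 * I.n + 2 := by rw [f₂ 3 (by decide), f₁ 3 (by decide), h3]
  have hflow : IsFlowState (3 * I.n + 2) I.netSupply I.netDemand s₂ := by
    refine ⟨⟨fun u _ v _ => ?_, fun u _ v _ h => absurd (m10₂ u v) h⟩, fun w _ => ?_, ?_⟩
    · rw [g11₂, g11₂]; exact Nat.zero_le _
    · simp only [m10₂, g8₂, g9₂, Finset.sum_const_zero]; ring
    · rw [g8₂, g9₂, I.sum_netSupply hle, I.sum_netDemand]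
  refine wp_seq_frame (wp_solve g3₂ (by omega) hR hflow he (fun u v => ?_) ?_ ?_)
    fun s₃ f₃ ⟨π, ho, hb⟩ => ?_
  · rw [m10₂]; exact dvd_zero _
  · rw [g8₂, I.sum_netSupply hle]; exact hlt
  · exact lt_of_le_of_lt (Nat.add_le_add_right (Nat.mul_le_mul_right _ hsize) 1) hR'
  have m7₃ : s₃.mat 7 = s.mat 7 := (mat_congr (f₃ 7 (by decide))).trans m7₂
  rw [m7₂] at ho
  have g3₃ : s₃ 3 0 = 3 * I.n + 2 := by rw [f₃ 3 (by decide), g3₂]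
  refine wp_seq_frame (wp_checkFar g3₃ hR) fun s₄ f₄ ⟨k1, k2⟩ => ?_
  have g4 : s₃ 4 0 = (3 * I.n + 2) * H + 1 := by
    rw [f₃ 4 (by decide), f₂ 4 (by decide), f₁ 4 (by decide), h4]
  rw [g4, m7₃] at k1 k2
  have g1 : s₄ 1 0 = 0 := by
    rw [f₄ 1 (by decide), f₃ 1 (by decide), f₂ 1 (by decide), f₁ 1 (by decide), h1]
  have g2 : s₄ 2 0 = I.n := by
    rw [f₄ 2 (by decide), f₃ 2 (by decide), f₂ 2 (by decide), f₁ 2 (by decide), h2]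
  have m10 : s₄.mat 10 = s₃.mat 10 := mat_congr (f₄ 10 (by decide))
  rw [wp_ite, val_var]
  constructor
  · intro h
    obtain ⟨u, hu, v, hv, hx, hM⟩ := k2 h
    refine wp_emit_none g1 (not_isFeasible hc ho hb hu hv (fun hA => ?_) hx)
    -- An arc costs at most `H`, less than the cost found for the pair.
    have := hc.le u v hA
    nlinarith
  · intro h
    refine wp_mono (wp_emitSolution g2 g1 (by omega)) fun s₅ h₅ =>
      ⟨some (I.solutionOf (s₃.mat 10)), isOptimal_solutionOf hc ho hb fun u hu v hv hA => ?_,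
        by rw [h₅, m10]⟩
    by_contra hx
    have h1 := k1 h u hu v hv hx
    rw [hc.far u hu v hv hA] at h1
    exact lt_irrefl _ h1

theorem wp_mcfoProgram (hR : 3 * I.n + 2 < R)
    (hR' : Nat.size (I.totalSupply + I.m) * (2 * (3 * I.n + 2) + 1) + 1 < R) :
    wp R mcfoProgram (HasCorrectOutput I) (initial I.encode) := by
  unfold mcfoProgram
  have z : ∀ a, a ≠ 0 → initial I.encode a = fun _ => 0 := by
    intro a ha
    funext i
    simp [initial, ha]
  have hin : initial I.encode 0 = I.input := rfl
  simp only [wp_seq, wp_setVar]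
  set s₀ := initial I.encode
  set s₁ := ((((s₀.set 2 0 _).set 3 0 _).set 5 0 _).set 6 0 _) with hs₁
  have f₁ : ∀ a, a ≠ 2 → a ≠ 3 → a ≠ 5 → a ≠ 6 → s₁ a = s₀ a := by
    intro a h2 h3 h5 h6
    simp [hs₁, State.set_of_ne, h2, h3, h5, h6]
  have e0 : s₁ 0 = I.input := by rw [f₁ 0 (by decide) (by decide) (by decide) (by decide), hin]
  have e2 : s₁ 2 0 = I.n := by
    simp [hs₁, State.set_apply, hin, I.input_one]
  have e3 : s₁ 3 0 = 3 * I.n + 2 := by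
    simp [hs₁, State.set_apply, hin, I.input_one]; ring
  have e5 : s₁ 5 0 = 1 := by simp [hs₁, State.set_apply]
  have e6 : s₁ 6 0 = 1 := by simp [hs₁, State.set_apply]
  refine wp_mono (wp_frame (wp_denominators e0 e2 e5 e6 (by omega))) ?_
  rintro s₂ ⟨⟨hD, hE⟩, f₂⟩
  simp only [wp_seq, wp_setVar]
  set s₃ := ((s₂.set 4 0 _).set 4 0 _) with hs₃
  have f₃ : ∀ a, a ≠ 4 → s₃ a = s₂ a := by
    intro a h4
    simp [hs₃, State.set_of_ne, h4]
  have g0 : s₃ 0 = I.input := by rw [f₃ 0 (by decide), f₂ 0 (by decide), e0]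
  have g2 : s₃ 2 0 = I.n := by rw [f₃ 2 (by decide), f₂ 2 (by decide), e2]
  have g3 : s₃ 3 0 = 3 * I.n + 2 := by rw [f₃ 3 (by decide), f₂ 3 (by decide), e3]
  have g5 : s₃ 5 0 = s₂ 5 0 := by rw [f₃ 5 (by decide)]
  have g4 : s₃ 4 0 = (3 * I.n + 2) * s₂ 6 0 + 1 := by
    simp [hs₃, State.set_apply, f₂ 0 (by decide), e0, I.input_one]; ring
  refine wp_mono (wp_frame (wp_netCosts g0 g2 g3 g4 (by rwa [g5]) (by rwa [g5]) hR)) ?_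
  rintro s₄ ⟨hc, f₄⟩
  -- Flow, potentials, balances, totals and output have not been touched so far and rely on the
  -- memory being initially zero.
  have z₄ : ∀ a, a ∉ [0, 2, 3, 4, 5, 6, 7, 17, 18] → s₄ a = fun _ => 0 := by
    intro a ha
    simp only [List.mem_cons, List.not_mem_nil, or_false, not_or] at ha
    obtain ⟨a0, a2, a3, a4, a5, a6, a7, a17, a18⟩ := ha
    rw [f₄ a, f₃ a a4, f₂ a, f₁ a a2 a3 a5 a6, z a a0]
    · simp [denominators, forPairs, forTo, writes, setVar, a5, a6, a17, a18]
    · simp [netCosts, fillCosts, zeroCosts, edgeCosts, forPairs, forTo, writes, setEntry, a7, a17,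
        a18]
  rw [wp_seq]
  refine wp_mono (wp_frame (wp_balances ((f₄ 0 (by decide)).trans g0)
    ((congrFun (f₄ 2 (by decide)) 0).trans g2) (z₄ 8 (by decide)) (z₄ 9 (by decide))
    (by rw [z₄ 26 (by decide)]) (by rw [z₄ 27 (by decide)]) (by omega))) ?_
  rintro s₅ ⟨⟨k8, k9, k26, k27⟩, f₅⟩
  have k1 : s₅ 1 0 = 0 := by rw [f₅ 1 (by decide), z₄ 1 (by decide)]
  rw [wp_ite, val_ge, val_ge_eq_zero]
  simp only [val_var, k26, k27]
  constructor
  · intro hle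
    refine wp_solveAndEmit (D := s₃ 5 0) (H := s₂ 6 0) ?_ k1 ?_ ?_ ?_ k8 k9 ?_ ?_ k26 k27 hle hR hR'
    · rw [mat_congr (f₅ 7 (by decide))]; exact hc
    · rw [f₅ 2 (by decide), f₄ 2 (by decide), g2]
    · rw [f₅ 3 (by decide), f₄ 3 (by decide), g3]
    · rw [f₅ 4 (by decide), f₄ 4 (by decide), g4]
    · intro u v
      simp only [State.mat, f₅ 10 (by decide), z₄ 10 (by decide)]
    · intro v
      simp only [f₅ 11 (by decide), z₄ 11 (by decide)]
  · intro hlt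
    exact wp_emit_none k1 fun T hT => absurd hT.totalDemand_le (by omega)

/-- For this reason `n` is read again from the input when the cost of pairs that are not arcs is
formed, and the scale is doubled by an addition. Addresses and tests may multiply freely, because
nothing of them is stored. -/
theorem mcfoProgram_tame : mcfoProgram.tame = true := by decide

/-- Each addition lengthens the larger summand by at most one bit, which the extra one per entry in
`bitSize` covers. -/
theorem size_sum_le_bitSize (l : List ℕ) : Nat.size l.sum ≤ bitSize l := by
  induction l with
  | nil => simp
  | cons a l ih =>
    have := size_add_le_max a l.sum
    simp only [List.sum_cons, bitSize, List.map_cons] at *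
    omega

theorem length_le_bitSize (l : List ℕ) : l.length ≤ bitSize l := by
  induction l with
  | nil => simp
  | cons a l ih =>
    simp only [bitSize, List.map_cons, List.sum_cons, List.length_cons] at *
    omega

theorem size_le_bitSize {l : List ℕ} {a : ℕ} (ha : a ∈ l) : Nat.size a ≤ bitSize l :=
  (Nat.size_le_size (List.single_le_sum (by simp) _ ha)).trans (size_sum_le_bitSize l)

theorem size_initial_le (l : List ℕ) (a i : ℕ) : Nat.size (initial l a i) ≤ bitSize l := by
  unfold initial
  split_ifs
  · rcases i with _ | i
    · simp only [List.getD_cons_zero]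
      exact (Nat.size_le.2 Nat.lt_two_pow_self).trans (length_le_bitSize l)
    · simp only [List.getD_cons_succ]
      by_cases hi : i < l.length
      · rw [List.getD_eq_getElem _ _ hi]
        exact size_le_bitSize (List.getElem_mem hi)
      · rw [List.getD_eq_default _ _ (by omega)]
        simp
  · simp

theorem n_le_bitSize (I : MCFOInstance) : I.n ≤ bitSize I.encode := by
  refine le_trans ?_ (length_le_bitSize _)
  unfold encode
  rw [List.length_append, List.length_append, List.length_append,
    length_flatMap_finRange (k := 2) _ fun i => by split_ifs <;> rfl]
  omega

/-- The supplies and `m` are distinct entries of the encoding, so their sum is at most the sum of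
the list. This bounds the number of scales. -/
theorem size_total_le_bitSize (I : MCFOInstance) :
    Nat.size (I.totalSupply + I.m) ≤ bitSize I.encode := by
  refine le_trans (Nat.size_le_size ?_) (size_sum_le_bitSize _)
  have h : I.totalSupply ≤ ((List.finRange I.n).flatMap
      (fun v => if v ∈ I.F then [1, I.supply v] else [0, 0])).sum := by
    rw [totalSupply_eq, ← List.sum_ofFn, List.ofFn_eq_map, List.flatMap, List.sum_flatten,
      List.map_map]
    refine List.sum_le_sum fun i _ => ?_
    rw [sup_coe]
    by_cases hi : i ∈ I.F <;> simp [hi]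
  unfold encode
  simp only [List.sum_append, List.sum_cons, List.sum_nil]
  omega

end RAM

open Polynomial in
theorem mainTheorem5 :
    RAM.SolvableInPolyTime (β := fun I : MCFOInstance => Option (MCFOFlow I.n ℕ))
      MCFOInstance.encode MCFOInstance.encodeAnswer MCFOInstance.IsCorrectAnswer := by
  -- With `n` and the bit length of the total at most `B`, the needed iteration bounds are at most
  -- `3 * B + 2` and `B * (2 * (3 * B + 2) + 1) + 1 = 6 * B ^ 2 + 5 * B + 1`. The polynomial exceeds
  -- both, and it also bounds the bit lengths in the initial memory, as `exec_of_wp` uses one number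
  -- for both purposes.
  refine ⟨RAM.mcfoProgram, (RAM.mcfoProgram.timeBound X).comp (6 * X ^ 2 + 6 * X + 4), fun I => ?_⟩
  set B := RAM.bitSize I.encode with hB
  have hR : (6 * X ^ 2 + 6 * X + 4 : Polynomial ℕ).eval B = 6 * B ^ 2 + 6 * B + 4 := by simp
  have hn := RAM.n_le_bitSize I
  have hs := RAM.size_total_le_bitSize I
  rw [← hB] at hn hs
  have hBR : B ≤ 6 * B ^ 2 + 6 * B + 4 := by nlinarith
  obtain ⟨t, s, he, ht, -, -, hc⟩ := RAM.exec_of_wp (X := 6 * B ^ 2 + 6 * B + 4) (by omega)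
    RAM.mcfoProgram RAM.mcfoProgram_tame (RAM.HasCorrectOutput I) (RAM.initial I.encode) _ X
    (by omega) eval_X.ge (fun a i => (RAM.size_initial_le _ a i).trans hBR)
    (fun i => (RAM.size_initial_le _ 0 i).trans hBR)
    (RAM.wp_mcfoProgram (by nlinarith) (by
      have := Nat.mul_le_mul hs (Nat.add_le_add_right (Nat.mul_le_mul_left 2
        (Nat.add_le_add_right (Nat.mul_le_mul_left 3 hn) 2)) 1)
      nlinarith))
  refine ⟨t, s, he, ?_, hc⟩
  rw [eval_comp, hR]
  exact ht
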